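/- **Conventions.** Let $n\ge 2$ and let $(M,\omega)$ be a smooth symplectic manifold of dimension $2n$. A *symplectic connection* $\nabla$ is a smooth torsion-free linear connection on $TM$ with $\nabla\omega=0$. Put $R(X,Y)Z=(\nabla_X\nabla_Y-\nabla_Y\nabla_X-\nabla_{[X,Y]})Z$ and $r(X,Y)=\mathrm{Tr}(Z\mapsto R(X,Z)Y)$. The connection is *of Ricci type* if $$\omega(R(X,Y)Z,T)=-\tfrac1{2(n+1)}\big[2\omega(X,Y)r(Z,T)+\omega(X,Z)r(Y,T)+\omega(X,T)r(Y,Z)-\omega(Y,Z)r(X,T)-\omega(Y,T)r(X,Z)\big]$$ for all $X,Y,Z,T$. Let $\Omega'$ be the standard symplectic form on $\mathbb R^{2n+2}$, with coordinates $(q_0,\dots,q_n,p_0,\dots,p_n)$ and $\Omega'=\sum_i dq_i\wedge dp_i$, and let $e_0=(1,0,\dots,0)$. For $A\in sp(\mathbb R^{2n+2},\Omega')$ let $\Sigma_A=\{x:\Omega'(x,Ax)=1\}$, a level set of the quadratic polynomial $H_A(x)=\frac12\Omega'(x,Ax)$. If $e_0\in\Sigma_A$, a *local reduction of $\Sigma_A$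 around $e_0$* consists of an open ball $D\subset\mathbb R^{2n}$ centred at $0$, an interval $I=(-\epsilon,\epsilon)$ and a diffeomorphism $\chi$ from $D\times I$ onto a neighbourhood $U$ of $e_0$ in $\Sigma_A$ with $\chi(0,0)=e_0$ and $\chi(y,t)=\exp(-tA)\chi(y,0)$. Let $\pi:U\to D$ be $\chi^{-1}$ followed by the projection onto $D$. For $x\in U$ and $X\in T_{\pi(x)}D$ let $\overline X$ be the *horizontal lift*, i.e. the vector in $T_x\Sigma_A$ with $\Omega'(x,\overline X)=\Omega'(Ax,\overline X)=0$ and $\pi_*\overline X=X$. The *reduced form* and *reduced connection* on $D$ are $$\omega^{red}_{\pi(x)}(X,Y)=\Omega'(\overline X,\overline Y),\qquad (\nabla^{red}_XY)_{\pi(x)}=\pi_{*x}\big(\nabla^0_{\overline X}\overline Y-\Omega'(A\overline X,\overline Y)\,x+\Omega'(\overline X,\overline Y)\,Ax\big),$$ where $\nabla^0$ is the standard flat connection on $\mathbb R^{2n+2}$. **Theorem.** Let $(M,\omega)$ be a smooth symplectic manifold of dimension $2n\ge4$ with a symplectic connection $\nabla$ of Ricci type, and let $p\in M$. Then there is $A\in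 sp(\mathbb R^{2n+2},\Omega')$ with $e_0\in\Sigma_A$ such that local reductions of $\Sigma_A$ around $e_0$ exist, and for every such local reduction $(D,\chi)$ there is a diffeomorphism $\varphi$ from an open neighbourhood of $p$ in $M$ onto an open neighbourhood of $0$ in $D$ with $\varphi(p)=0$, which is symplectic, $\varphi^*\omega^{red}=\omega$, and affine, $\varphi_*(\nabla_XY)=\nabla^{red}_{\varphi_*X}\,\varphi_*Y$. -/

import Mathlib

open scoped Manifold ContDiff Topology

noncomputable section

namespace RicciType

/-! ### Symplectic manifolds and symplectic connections -/

section Manifold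

variable {n : ℕ} {M : Type*} [TopologicalSpace M]
  [ChartedSpace (EuclideanSpace ℝ (Fin (2 * n))) M] [IsManifold (𝓡 (2 * n)) ∞ M]

/-- A (not necessarily continuous) vector field on a `2n`-dimensional manifold. -/
abbrev VField (n : ℕ) (M : Type*) [TopologicalSpace M]
    [ChartedSpace (EuclideanSpace ℝ (Fin (2 * n))) M] [IsManifold (𝓡 (2 * n)) ∞ M] :=
  (x : M) → TangentSpace (𝓡 (2 * n)) x

/-- Smooth vector fields. -/
def VField.Smooth (X : VField n M) : Prop :=
  ContMDiff (𝓡 (2 * n)) (𝓡 (2 * n)).tangent ∞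
    (fun x => (⟨x, X x⟩ : TangentBundle (𝓡 (2 * n)) M))

/-- Vector fields that are differentiable at a given point. -/
def VField.DiffAt (X : VField n M) (x : M) : Prop :=
  MDifferentiableAt (𝓡 (2 * n)) (𝓡 (2 * n)).tangent
    (fun y => (⟨y, X y⟩ : TangentBundle (𝓡 (2 * n)) M)) x

/-- The Lie bracket of vector fields. -/
def bracket (X Y : VField n M) : VField n M :=
  VectorField.mlieBracket (𝓡 (2 * n)) X Y

/-- The derivative `X(f)` of a function along a vector field. -/
def lieDeriv (X : VField n M) (f : M → ℝ) (x : M) : ℝ :=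
  mvfderiv (𝓡 (2 * n)) f x (X x)

variable (n M) in
/-- A symplectic form: a smooth closed non-degenerate 2-form. -/
structure SymplecticForm where
  toFun (x : M) :
    TangentSpace (𝓡 (2 * n)) x →L[ℝ] TangentSpace (𝓡 (2 * n)) x →L[ℝ] ℝ
  alternating (x : M) (u : TangentSpace (𝓡 (2 * n)) x) : toFun x u u = 0
  nondegenerate (x : M) (u : TangentSpace (𝓡 (2 * n)) x) : (∀ v, toFun x u v = 0) → u = 0
  smooth : ContMDiff (𝓡 (2 * n))
    ((𝓡 (2 * n)).prod 𝓘(ℝ, EuclideanSpace ℝ (Fin (2 * n)) →L[ℝ]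
      EuclideanSpace ℝ (Fin (2 * n)) →L[ℝ] ℝ)) ∞
    (fun x => Bundle.TotalSpace.mk' (EuclideanSpace ℝ (Fin (2 * n)) →L[ℝ]
      EuclideanSpace ℝ (Fin (2 * n)) →L[ℝ] ℝ)
      (E := fun y : M => TangentSpace (𝓡 (2 * n)) y →L[ℝ]
        TangentSpace (𝓡 (2 * n)) y →L[ℝ] ℝ) x (toFun x))
  /-- `dω (X, Y, Z) = 0`, by the invariant formula for the exterior derivative. -/
  closed (X Y Z : VField n M) : X.Smooth → Y.Smooth → Z.Smooth → ∀ x : M,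
    lieDeriv X (fun y => toFun y (Y y) (Z y)) x
      + lieDeriv Y (fun y => toFun y (Z y) (X y)) x
      + lieDeriv Z (fun y => toFun y (X y) (Y y)) x
      - toFun x (bracket X Y x) (Z x)
      - toFun x (bracket Y Z x) (X x)
      - toFun x (bracket Z X x) (Y x) = 0

variable (n M) in
/-- Linear connections on `TM`, as maps on vector fields. The value `(∇_X Y)(x)` is
`nabla Y x (X x)`. -/
abbrev LinearConnection :=
  CovariantDerivative (𝓡 (2 * n)) (EuclideanSpace ℝ (Fin (2 * n)))
    (TangentSpace (𝓡 (2 * n)) : M → Type _)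

/-- The vector field `∇_X Y`. -/
def covDeriv (nabla : LinearConnection n M) (X Y : VField n M) : VField n M :=
  fun x => nabla Y x (X x)

/-- A symplectic connection: smooth, without torsion, and such that the symplectic
form is parallel. -/
structure IsSymplecticConnection (om : SymplecticForm n M) (nabla : LinearConnection n M) :
    Prop where
  smooth : nabla.ContMDiffCovariantDerivative ∞
  torsion_eq_zero : nabla.torsion = 0
  parallel (X Y Z : VField n M) : X.Smooth → Y.Smooth → Z.Smooth → ∀ x : M,
    lieDeriv X (fun y => om.toFun y (Y y) (Z y)) x
      - om.toFun x (covDeriv nabla X Y x) (Z x)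
      - om.toFun x (Y x) (covDeriv nabla X Z x) = 0

/-- The vector field `∇_X ∇_Y Z - ∇_Y ∇_X Z - ∇_[X,Y] Z`. -/
def curvatureField (nabla : LinearConnection n M) (X Y Z : VField n M) : VField n M :=
  covDeriv nabla X (covDeriv nabla Y Z) - covDeriv nabla Y (covDeriv nabla X Z)
    - covDeriv nabla (bracket X Y) Z

/-- The curvature tensor `R_x(u, v)w`, computed on vector fields which extend the tangent vectors
`u, v, w` and are smooth near `x` (the result does not depend on the extensions). -/
def curvature (nabla : LinearConnection n M) (x : M) (u v w : TangentSpace (𝓡 (2 * n)) x) :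
    TangentSpace (𝓡 (2 * n)) x :=
  curvatureField nabla
    (FiberBundle.extend (EuclideanSpace ℝ (Fin (2 * n))) u)
    (FiberBundle.extend (EuclideanSpace ℝ (Fin (2 * n))) v)
    (FiberBundle.extend (EuclideanSpace ℝ (Fin (2 * n))) w) x

/-- The Ricci tensor `r_x(u, v) = Tr (z ↦ R_x(u, z)v)`, the trace being written in the standard
basis of `T_x M = ℝ^{2n}`. -/
def ricci (nabla : LinearConnection n M) (x : M) (u v : TangentSpace (𝓡 (2 * n)) x) : ℝ :=
  ∑ i, (EuclideanSpace.basisFun (Fin (2 * n)) ℝ).toBasis.coord i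
    (curvature nabla x u ((EuclideanSpace.basisFun (Fin (2 * n)) ℝ).toBasis i) v)

/-- The symplectic curvature tensor `ω(R(u, v)w, z)`. -/
def symplecticCurvature (om : SymplecticForm n M) (nabla : LinearConnection n M) (x : M)
    (u v w z : TangentSpace (𝓡 (2 * n)) x) : ℝ :=
  om.toFun x (curvature nabla x u v w) z

/-- The Ricci component `E` of the symplectic curvature tensor. -/
def ricciPart (om : SymplecticForm n M) (nabla : LinearConnection n M) (x : M)
    (u v w z : TangentSpace (𝓡 (2 * n)) x) : ℝ :=
  -(1 / (2 * ((n : ℝ) + 1))) *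
    (2 * om.toFun x u v * ricci nabla x w z
      + om.toFun x u w * ricci nabla x v z
      + om.toFun x u z * ricci nabla x v w
      - om.toFun x v w * ricci nabla x u z
      - om.toFun x v z * ricci nabla x u w)

/-- The component `W = R - E` of the symplectic curvature tensor. -/
def weylPart (om : SymplecticForm n M) (nabla : LinearConnection n M) (x : M)
    (u v w z : TangentSpace (𝓡 (2 * n)) x) : ℝ :=
  symplecticCurvature om nabla x u v w z - ricciPart om nabla x u v w z

/-- A symplectic connection is of Ricci type if the component `W` of its curvature vanishes. -/
structure IsRicciTypeConnection (om : SymplecticForm n M) (nabla : LinearConnection n M) :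
    Prop extends IsSymplecticConnection om nabla where
  weylPart_eq_zero (x : M) (u v w z : TangentSpace (𝓡 (2 * n)) x) :
    weylPart om nabla x u v w z = 0

end Manifold

/-! ### Local reduction of the standard symplectic vector space -/

section Reduction

variable {n : ℕ}

/-- The vector space `ℝ^{2n+2}`, with coordinates `(q_0, …, q_n, p_0, …, p_n)`. -/
abbrev BigSpace (n : ℕ) := EuclideanSpace ℝ (Fin (n + 1) ⊕ Fin (n + 1))

/-- The standard symplectic form `Ω' = ∑ dq_i ∧ dp_i`. -/
def Omega (x y : BigSpace n) : ℝ :=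
  ∑ i : Fin (n + 1), (x (Sum.inl i) * y (Sum.inr i) - x (Sum.inr i) * y (Sum.inl i))

/-- `Ω'` as a bilinear map. -/
def omegaLin : BigSpace n →ₗ[ℝ] BigSpace n →ₗ[ℝ] ℝ :=
  LinearMap.mk₂ ℝ Omega
    (by
      intros
      simp only [Omega, ← Finset.sum_add_distrib]
      refine Finset.sum_congr rfl fun i _ => ?_
      simp; ring)
    (by
      intros
      simp only [Omega, Finset.smul_sum]
      refine Finset.sum_congr rfl fun i _ => ?_
      simp; ring)
    (by
      intros
      simp only [Omega, ← Finset.sum_add_distrib]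
      refine Finset.sum_congr rfl fun i _ => ?_
      simp; ring)
    (by
      intros
      simp only [Omega, Finset.smul_sum]
      refine Finset.sum_congr rfl fun i _ => ?_
      simp; ring)

/-- `Ω'` as a continuous bilinear map. -/
def omegaCLM : BigSpace n →L[ℝ] BigSpace n →L[ℝ] ℝ := omegaLin.toContinuousBilinearMap

lemma omegaCLM_apply (x y : BigSpace n) : omegaCLM x y = Omega x y := rfl

lemma omega_neg (x y : BigSpace n) : Omega x y = - Omega y x := by
  simp only [Omega, ← Finset.sum_neg_distrib]
  exact Finset.sum_congr rfl fun i _ => by ring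

/-- The vector `e_0 = (1, 0, …, 0)`. -/
def e0 (n : ℕ) : BigSpace n := EuclideanSpace.single (Sum.inl 0) 1

/-- Membership in the symplectic Lie algebra `sp(ℝ^{2n+2}, Ω')`. -/
def InSp (A : BigSpace n →L[ℝ] BigSpace n) : Prop :=
  ∀ x y, Omega (A x) y + Omega x (A y) = 0

/-- The quadratic Hamiltonian `H_A(x) = Ω'(x, Ax) / 2`. -/
def hamiltonian (A : BigSpace n →L[ℝ] BigSpace n) (x : BigSpace n) : ℝ :=
  (1 / 2) * Omega x (A x)

/-- The constraint surface `Σ_A = {x | Ω'(x, Ax) = 1}`, a level set of `H_A`. -/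
def constraintSurface (A : BigSpace n →L[ℝ] BigSpace n) : Set (BigSpace n) :=
  {x | hamiltonian A x = 1 / 2}

/-- Local reduction data around a point `x₀ ∈ Σ_A`: a diffeomorphism `chi` from `D × I` onto a
neighbourhood `U` of `x₀` in `Σ_A`, where `D` is a ball in `ℝ^{2n}` centred at `0` and
`I = (-ε, ε)`, such that `chi(0, 0) = x₀` and `chi(y, t) = exp(-tA) chi(y, 0)`. The neighbourhood is
`U = O ∩ Σ_A` with `O` open in `ℝ^{2n+2}`, and the inverse diffeomorphism `U → D × I` is the
restriction to `U` of the smooth map `psi` on `O`. -/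
structure LocalReduction (A : BigSpace n →L[ℝ] BigSpace n) (x₀ : BigSpace n) where
  radius : ℝ
  eps : ℝ
  radius_pos : 0 < radius
  eps_pos : 0 < eps
  chi : EuclideanSpace ℝ (Fin (2 * n)) × ℝ → BigSpace n
  O : Set (BigSpace n)
  psi : BigSpace n → EuclideanSpace ℝ (Fin (2 * n)) × ℝ
  isOpen_O : IsOpen O
  chi_smooth : ContDiffOn ℝ ∞ chi (Metric.ball 0 radius ×ˢ Set.Ioo (-eps) eps)
  psi_smooth : ContDiffOn ℝ ∞ psi O
  image_chi : chi '' (Metric.ball 0 radius ×ˢ Set.Ioo (-eps) eps) = O ∩ constraintSurface A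
  psi_chi : ∀ q ∈ Metric.ball 0 radius ×ˢ Set.Ioo (-eps) eps, psi (chi q) = q
  chi_zero : chi (0, 0) = x₀
  chi_flow : ∀ y ∈ Metric.ball 0 radius, ∀ t ∈ Set.Ioo (-eps) eps,
    chi (y, t) = NormedSpace.exp ((-t) • A) (chi (y, 0))

namespace LocalReduction

variable {A : BigSpace n →L[ℝ] BigSpace n} {x₀ : BigSpace n} (L : LocalReduction A x₀)

/-- The ball `D`, which is the local reduced space. -/
def D : Set (EuclideanSpace ℝ (Fin (2 * n))) := Metric.ball 0 L.radius

/-- The projection `π = p₁ ∘ chi⁻¹` onto the reduced space (extended smoothly to `O`). -/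
def proj (x : BigSpace n) : EuclideanSpace ℝ (Fin (2 * n)) := (L.psi x).1

/-- The horizontal lift to `x ∈ U` of a tangent vector `X` of the reduced space at `π(x)`, i.e. the
vector `v` with `π_* v = X` and `Ω'(x, v) = 0 = Ω'(Ax, v)`; it is given by the explicit
formula `v = chi_*(X, s)` with `s = Ω'(x, chi_*(X, 0))`. -/
def lift (x : BigSpace n) (X : EuclideanSpace ℝ (Fin (2 * n))) : BigSpace n :=
  fderiv ℝ L.chi (L.psi x) (X, Omega x (fderiv ℝ L.chi (L.psi x) (X, 0)))

/-- The explicit formula does give the horizontal lift. -/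
theorem lift_spec (hA : InSp A) (x : BigSpace n) (hx : x ∈ L.O ∩ constraintSurface A)
   (X : EuclideanSpace ℝ (Fin (2 * n))) :
   fderiv ℝ L.proj x (L.lift x X) = X ∧ Omega x (L.lift x X) = 0 ∧ Omega (A x) (L.lift x X) = 0 := by
  have hx' := hx
  rw [← L.image_chi] at hx
  obtain ⟨⟨y, t⟩, hq, rfl⟩ := hx
  have hopen : IsOpen ((Metric.ball 0 L.radius : Set (EuclideanSpace ℝ (Fin (2 * n)))) ×ˢ Set.Ioo (-L.eps) L.eps) :=
    Metric.isOpen_ball.prod isOpen_Ioo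
  have hn := hopen.mem_nhds hq
  have hd : DifferentiableAt ℝ L.chi (y,t) := (L.chi_smooth.contDiffAt hn).differentiableAt (by simp)
  have hp : DifferentiableAt ℝ L.psi (L.chi (y,t)) :=
    (L.psi_smooth.contDiffAt (L.isOpen_O.mem_nhds hx'.1)).differentiableAt (by simp)
  have hpq := L.psi_chi _ hq
  have hid : HasFDerivAt (fun q => L.psi (L.chi q)) (ContinuousLinearMap.id ℝ _) (y,t) :=
    (hasFDerivAt_id _).congr_of_eventuallyEq (Filter.eventually_of_mem hn fun q h => L.psi_chi q h)
  have hcomp := hid.unique (hp.hasFDerivAt.comp (y,t) hd.hasFDerivAt)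
  have hH : HasFDerivAt (fun q => omegaCLM (L.chi q) (A (L.chi q))) (0 : _ →L[ℝ] ℝ) (y,t) := by
    refine (hasFDerivAt_const (1:ℝ) _).congr_of_eventuallyEq (Filter.eventually_of_mem hn fun q h => ?_)
    have : L.chi q ∈ L.O ∩ constraintSurface A := L.image_chi ▸ Set.mem_image_of_mem _ h
    have h2 := this.2
    simp only [constraintSurface, hamiltonian, Set.mem_ofPred_eq] at h2
    show Omega _ _ = (1:ℝ); linarith
  have hB := (ContinuousLinearMap.isBoundedBilinearMap (omegaCLM (n := n))).hasFDerivAt (L.chi (y,t), A (L.chi (y,t)))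
  have hP := hd.hasFDerivAt.prodMk (A.hasFDerivAt.comp (y,t) hd.hasFDerivAt)
  have hC := HasFDerivAt.comp (g := fun p : BigSpace n × BigSpace n => omegaCLM p.1 p.2) (y,t) hB hP
  have hH2 := hH.unique hC
  have tang : ∀ w, Omega (A (L.chi (y,t))) (fderiv ℝ L.chi (y,t) w) = 0 := by
    intro w
    have := congrArg (fun T => T w) hH2
    simp [IsBoundedBilinearMap.deriv, omegaCLM_apply] at this
    have h1 := hA (L.chi (y,t)) (fderiv ℝ L.chi (y,t) w)
    have h2 := omega_neg (A (L.chi (y,t))) (fderiv ℝ L.chi (y,t) w)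
    linarith
  have hvert : fderiv ℝ L.chi (y,t) (0,1) = - A (L.chi (y,t)) := by
    have e1 : HasDerivAt (fun s : ℝ => L.chi (y,s)) (fderiv ℝ L.chi (y,t) (0,1)) t := by
      have := hd.hasFDerivAt.comp_hasDerivAt t ((hasDerivAt_const t y).prodMk (hasDerivAt_id t))
      exact this
    have e2 : HasDerivAt (fun s : ℝ => NormedSpace.exp (s • (-A)) (L.chi (y,0)))
        (((-A) * NormedSpace.exp (t • (-A))) (L.chi (y,0))) t := by
      have := (hasDerivAt_exp_smul_const' (𝕂 := ℝ) (-A) t)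
      exact (ContinuousLinearMap.apply ℝ (BigSpace n) (L.chi (y,0))).hasFDerivAt.comp_hasDerivAt t this
    have e3 : HasDerivAt (fun s : ℝ => L.chi (y,s)) (((-A) * NormedSpace.exp (t • (-A))) (L.chi (y,0))) t := by
      refine e2.congr_of_eventuallyEq (Filter.eventually_of_mem (isOpen_Ioo.mem_nhds hq.2) fun s hs => ?_)
      simp only [L.chi_flow y hq.1 s hs]; rw [smul_neg]; rw [← neg_smul]
    rw [e1.unique e3, L.chi_flow y hq.1 t hq.2]; rw [smul_neg, ← neg_smul]; rfl
  refine ⟨?_, ?_, ?_⟩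
  · have : fderiv ℝ L.proj (L.chi (y,t)) = (ContinuousLinearMap.fst ℝ _ _).comp (fderiv ℝ L.psi (L.chi (y,t))) :=
      (hp.hasFDerivAt.fst).fderiv
    rw [this, lift, hpq]
    set s := Omega (L.chi (y,t)) (fderiv ℝ L.chi (y,t) (X,0))
    have := congrArg (fun T => (T (X,s)).1) hcomp
    simpa using this.symm
  · rw [lift, hpq]
    set s := Omega (L.chi (y,t)) (fderiv ℝ L.chi (y,t) (X,0)) with hs
    have e : (X, s) = (X,0) + s • ((0,1) : EuclideanSpace ℝ (Fin (2 * n)) × ℝ) := by ext <;> simp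
    rw [e, map_add, map_smul, hvert, ← omegaCLM_apply, map_add, map_smul, map_neg, omegaCLM_apply, omegaCLM_apply, ← hs]
    have h2 := hx'.2
    simp only [constraintSurface, hamiltonian, Set.mem_ofPred_eq] at h2
    rw [smul_eq_mul]
    have : Omega (L.chi (y,t)) (A (L.chi (y,t))) = 1 := by linarith
    rw [this]; ring
  · rw [lift, hpq]; exact tang _

/-- The horizontal lift of a vector field on the reduced space. -/
def liftField (Y : EuclideanSpace ℝ (Fin (2 * n)) → EuclideanSpace ℝ (Fin (2 * n)))
    (x : BigSpace n) : BigSpace n :=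
  L.lift x (Y (L.proj x))

/-- The slice point `chi(y, 0)` over `y`. The form and the connection below do not depend on
the choice of a point over `y`, because `exp(tA)` preserves all the data. -/
def slice (y : EuclideanSpace ℝ (Fin (2 * n))) : BigSpace n := L.chi (y, 0)

/-- The reduced symplectic form: `ω^red_{π(x)}(X, Y) = Ω'_x(X̄, Ȳ)`. -/
def reducedForm (y X Y : EuclideanSpace ℝ (Fin (2 * n))) : ℝ :=
  Omega (L.lift (L.slice y) X) (L.lift (L.slice y) Y)

/-- The reduced connection: for a tangent vector `X` at `y = π(x)` and a vector field `Y`,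
`(∇^red_X Y)(y) = π_{*x}(∇_X̄ Ȳ - Ω'(AX̄, Ȳ) x + Ω'(X̄, Ȳ) Ax)`, with `∇` the standard flat
connection of `ℝ^{2n+2}`. -/
def reducedConnection (X : EuclideanSpace ℝ (Fin (2 * n)))
    (Y : EuclideanSpace ℝ (Fin (2 * n)) → EuclideanSpace ℝ (Fin (2 * n)))
    (y : EuclideanSpace ℝ (Fin (2 * n))) : EuclideanSpace ℝ (Fin (2 * n)) :=
  let x := L.slice y
  fderiv ℝ L.proj x
    (fderiv ℝ (L.liftField Y) x (L.lift x X)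
      - Omega (A (L.lift x X)) (L.liftField Y x) • x
      + Omega (L.lift x X) (L.liftField Y x) • A x)

end LocalReduction

end Reduction

/-! ### Local isomorphisms -/

section Isomorphism

variable {n : ℕ} {M : Type*} [TopologicalSpace M]
  [ChartedSpace (EuclideanSpace ℝ (Fin (2 * n))) M] [IsManifold (𝓡 (2 * n)) ∞ M]

/-- The push-forward `φ_* Y` of a vector field by a local diffeomorphism with values
in `ℝ^{2n}`. -/
def pushforward (φ : OpenPartialHomeomorph M (EuclideanSpace ℝ (Fin (2 * n))))
    (Y : VField n M) (y : EuclideanSpace ℝ (Fin (2 * n))) : EuclideanSpace ℝ (Fin (2 * n)) :=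
  mfderiv (𝓡 (2 * n)) (𝓡 (2 * n)) φ (φ.symm y) (Y (φ.symm y))

/-- `φ` is a diffeomorphism of an open neighbourhood of `p` in `M` onto an open neighbourhood of `0`
in the reduced space `D`, with `φ(p) = 0`, which is symplectic, `φ^* ω^red = ω`, and affine,
`φ_*(∇_X Y) = ∇^red_{φ_* X} φ_* Y`. -/
structure IsLocalIso (om : SymplecticForm n M) (nabla : LinearConnection n M) (p : M)
    {A : BigSpace n →L[ℝ] BigSpace n} {x₀ : BigSpace n} (L : LocalReduction A x₀)
    (φ : OpenPartialHomeomorph M (EuclideanSpace ℝ (Fin (2 * n)))) : Prop where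
  mem_source : p ∈ φ.source
  map_base : φ p = 0
  target_subset : φ.target ⊆ L.D
  smooth : ContMDiffOn (𝓡 (2 * n)) (𝓡 (2 * n)) ∞ φ φ.source
  smooth_symm : ContMDiffOn (𝓡 (2 * n)) (𝓡 (2 * n)) ∞ φ.symm φ.target
  symplectic : ∀ q ∈ φ.source, ∀ u v : TangentSpace (𝓡 (2 * n)) q,
    L.reducedForm (φ q) (mfderiv (𝓡 (2 * n)) (𝓡 (2 * n)) φ q u)
      (mfderiv (𝓡 (2 * n)) (𝓡 (2 * n)) φ q v) = om.toFun q u v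
  affine : ∀ q ∈ φ.source, ∀ X Y : VField n M, Y.DiffAt q →
    mfderiv (𝓡 (2 * n)) (𝓡 (2 * n)) φ q (covDeriv nabla X Y q)
      = L.reducedConnection (pushforward φ X (φ q)) (pushforward φ Y) (φ q)

end Isomorphism

end RicciType

end

/-!
The proof reconstructs the embedding of a symplectic manifold of Ricci type as a reduced space, by
trivialising a flat connection on a bundle of rank `2n + 2`.

In a chart, write `w` for the form and `Γ` for the Christoffel symbols. The Ricci tensor corresponds
to an endomorphism `S` with `w(S u, v)` symmetric, and the curvature is an algebraic expression in
`w` and `S`. As the dimension is at least `3`, the second Bianchi identity determines `∇S` through a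
vector field `U`, the Ricci identity for `S` determines `∇U` through a function `f`, and the Ricci
identity for `U` determines `df`. This closed system is `IsRicciTypeData`, and its existence is
`exists_ricciTypeData`.

On the bundle `ℝ ⊕ TM ⊕ ℝ` with the symplectic form `fibreForm`, the data `S`, `U`, `f` define a
symplectic connection `fibreConn` and an infinitesimally symplectic endomorphism `fibreEnd`. The
system says exactly that `fibreEnd` is parallel and that the curvature of `fibreConn` is `-2 w ⊗
fibreEnd` (`IsRicciTypeData.fderiv_fibreEnd`, `IsRicciTypeData.fibreConn_curvature`). A 2-form which
is parallel for a torsion-free connection is closed, so the Poincaré lemma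
`exists_primitive_of_closed` provides a local 1-form `α` with `dα = 2 w`, and the connection
`fibreConn + α ⊗ fibreEnd` is flat (`IsRicciTypeData.flatConn_flat`). It still preserves `fibreForm`
and `fibreEnd`. Integrable linear total differential equations have solutions
(`exists_solution_of_integrable`), so there is a parallel symplectic frame, in which `fibreEnd`
becomes a constant element `A` of `sp`. The section `(1, 0, 0)` becomes a map `Φ` into the
constraint surface of `A`, whose derivative is, up to the multiple `α ⊗ AΦ` of the direction of the
flow of `A`, a symplectic isomorphism onto the horizontal space, and for which `Γ` is the reduced
connection. This is the notion `IsDevelopment`, and the construction is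
`IsRicciTypeData.exists_development`.

Given any local reduction of the constraint surface, the composition of `Φ` with the projection
along the flow is the required isomorphism in the chart. To compare the two, `Φ` is moved along the
flow into the slice of the reduction (`IsDevelopment.gauge`); among `w`, `Γ` and `α` this alters only `α`. The inverse
function theorem then gives a local diffeomorphism, and the equations of a development translate
into compatibility with the reduced form and the reduced connection
(`IsDevelopment.exists_local_iso`). Local reductions exist since a slice through the point,
transverse to the flow, can be swept out by the flow (`nonempty_localReduction`).

The passage between the manifold and the chart uses the Christoffel symbols, defined as the
difference tensor of the connection and the flat connection of the chart, which are smooth by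
`christoffel_smooth`. The hypotheses on the manifold become the hypotheses in the chart by
`isSymplecticChart_chartAt` and `isRicciTypeChart_chartAt`, and the isomorphism is transported back
by `isLocalIso_chart_trans`.
-/

noncomputable section

namespace RicciType

set_option maxSynthPendingDepth 3

/-! ### Integrable linear systems -/

section Integrable

open Metric Set

variable {E W : Type*} [NormedAddCommGroup E] [NormedSpace ℝ E]
  [NormedAddCommGroup W] [NormedSpace ℝ W]

/-- A linear equation `c' = N(t) c` on `[0, 1]` with `‖N‖ ≤ 1/2` has a solution on all
of `[0, 1]`. -/
lemma exists_linear_ode_solution [CompleteSpace W] (N : ℝ → W →L[ℝ] W)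
    (hN : ContinuousOn N (Icc 0 1)) (hb : ∀ t ∈ Icc (0 : ℝ) 1, ‖N t‖ ≤ 1 / 2) (w₀ : W) :
    ∃ c : ℝ → W, c 0 = w₀ ∧
      ∀ t ∈ Icc (0 : ℝ) 1, HasDerivWithinAt c (N t (c t)) (Icc 0 1) t := by
  have hP : IsPicardLindelof (fun t c => N t c) (⟨0, by simp⟩ : Icc (0 : ℝ) 1) w₀
      ‖w₀‖₊ 0 ‖w₀‖₊ 1 := by
    refine ⟨fun t ht => ?_, fun c _ => hN.clm_apply continuousOn_const, fun t ht c hc => ?_, ?_⟩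
    · refine ((N t).lipschitz.weaken ?_).lipschitzOnWith
      have := hb t ht
      rw [← NNReal.coe_le_coe]
      simp only [coe_nnnorm, NNReal.coe_one]
      linarith
    · have h1 := (N t).le_opNorm c
      have h2 : ‖c‖ ≤ 2 * ‖w₀‖ := by
        have := norm_le_norm_add_norm_sub w₀ c
        rw [mem_closedBall, dist_eq_norm, coe_nnnorm] at hc
        rw [norm_sub_rev] at this
        linarith
      have h3 := hb t ht
      have : ‖N t‖ * ‖c‖ ≤ 1 / 2 * (2 * ‖w₀‖) :=
        mul_le_mul h3 h2 (norm_nonneg _) (by norm_num)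
      simp only [coe_nnnorm]
      linarith
    · simp
  exact hP.exists_eq_forall_mem_Icc_hasDerivWithinAt₀

/-- Gronwall's inequality on `[0, 1]` for a curve which starts at `0`. -/
lemma norm_le_of_deriv_le_mul_add {e e' : ℝ → W} {K ε : ℝ} (hK : 0 < K)
    (hd : ∀ t ∈ Icc (0 : ℝ) 1, HasDerivWithinAt e (e' t) (Icc 0 1) t) (h0 : e 0 = 0)
    (hb : ∀ t ∈ Icc (0 : ℝ) 1, ‖e' t‖ ≤ K * ‖e t‖ + ε) :
    ‖e 1‖ ≤ ε * ((Real.exp K - 1) / K) := by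
  have := norm_le_gronwallBound_of_norm_deriv_right_le (f := e) (f' := e') (δ := 0) (K := K)
    (ε := ε) (a := 0) (b := 1) (fun t ht => (hd t ht).continuousWithinAt)
    (fun t ht => (hd t (Ico_subset_Icc_self ht)).mono_of_mem_nhdsWithin
      (Icc_mem_nhdsGE_of_mem ht)) (by simp [h0])
    (fun t ht => hb t (Ico_subset_Icc_self ht)) 1 (by simp)
  rw [gronwallBound_of_K_ne_0 hK.ne'] at this
  calc ‖e 1‖ ≤ _ := this
    _ = _ := by simp; ring

/-- Second order Taylor estimate on a convex set on which the derivative is Lipschitz. -/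
lemma norm_sub_sub_fderiv_le {f : E → W} {s : Set E} {C : ℝ} (hs : Convex ℝ s)
    (hf : ∀ x ∈ s, DifferentiableAt ℝ f x) (hC : 0 ≤ C)
    (hL : ∀ x ∈ s, ∀ y ∈ s, ‖fderiv ℝ f y - fderiv ℝ f x‖ ≤ C * ‖y - x‖) {x y : E}
    (hx : x ∈ s) (hy : y ∈ s) :
    ‖f y - f x - fderiv ℝ f x (y - x)‖ ≤ C * ‖y - x‖ ^ 2 := by
  have := (convex_segment x y).norm_image_sub_le_of_norm_hasFDerivWithin_le' (f := f)
    (f' := fderiv ℝ f) (φ := fderiv ℝ f x) (C := C * ‖y - x‖)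
    (fun z hz => (hf z (hs.segment_subset hx hy hz)).hasFDerivAt.hasFDerivWithinAt)
    (fun z hz => (hL x hx z (hs.segment_subset hx hy hz)).trans (by
      gcongr
      have := norm_sub_le_of_mem_segment hz
      exact this))
    (left_mem_segment ℝ x y) (right_mem_segment ℝ x y)
  calc _ ≤ _ := this
    _ = _ := by ring

/-- A function with `DG(x) v = O(‖G(x)‖)` which vanishes at the centre of a ball vanishes on the
ball. -/
lemma eq_zero_of_hasFDerivAt_of_le {r : ℝ} {G : E → W} {G' : E → E →L[ℝ] W}
    (hd : ∀ x ∈ ball (0 : E) r, HasFDerivAt G (G' x) x) (h0 : G 0 = 0)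
    (hb : ∀ x ∈ ball (0 : E) r, ∃ K : ℝ, ∀ t ∈ Icc (0 : ℝ) 1,
      ‖G' (t • x) x‖ ≤ K * ‖G (t • x)‖) {x : E} (hx : x ∈ ball (0 : E) r) :
    G x = 0 := by
  obtain ⟨K, hK⟩ := hb x hx
  have hmem : ∀ t ∈ Icc (0 : ℝ) 1, t • x ∈ ball (0 : E) r := by
    intro t ht
    rw [mem_ball_zero_iff] at hx ⊢
    rw [norm_smul, Real.norm_eq_abs, abs_of_nonneg ht.1]
    nlinarith [norm_nonneg x, ht.2]
  have := norm_le_of_deriv_le_mul_add (e := fun t : ℝ => G (t • x))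
    (e' := fun t : ℝ => G' (t • x) x) (K := max K 1) (ε := 0) (by positivity)
    (fun t ht => by
      have h0 : HasDerivAt (fun t : ℝ => t • x) x t := by
        simpa using (hasDerivAt_id t).smul_const x
      exact ((hd _ (hmem t ht)).comp_hasDerivAt t h0).hasDerivWithinAt) (by simpa using h0)
    (fun t ht => (hK t ht).trans (by
      rw [add_zero]; gcongr; exact le_max_left _ _))
  simpa using this

variable [FiniteDimensional ℝ E]

/-- A smooth function on a ball has a Lipschitz derivative on any smaller closed ball. -/
lemma exists_lipschitz_bounds {f : E → W} {r ρ : ℝ} (hρ : ρ < r)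
    (hf : ContDiffOn ℝ ∞ f (ball 0 r)) :
    ∃ C : ℝ, 0 < C ∧ (∀ x ∈ closedBall (0 : E) ρ, ‖f x‖ ≤ C) ∧
      (∀ x ∈ closedBall (0 : E) ρ, ∀ y ∈ closedBall (0 : E) ρ, ‖f y - f x‖ ≤ C * ‖y - x‖) ∧
      (∀ x ∈ closedBall (0 : E) ρ, ∀ y ∈ closedBall (0 : E) ρ,
        ‖f y - f x - fderiv ℝ f x (y - x)‖ ≤ C * ‖y - x‖ ^ 2) := by
  have hsub : closedBall (0 : E) ρ ⊆ ball 0 r := closedBall_subset_ball hρ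
  have hK : IsCompact (closedBall (0 : E) ρ) := isCompact_closedBall _ _
  have hd : ∀ x ∈ closedBall (0 : E) ρ, DifferentiableAt ℝ f x := fun x hx =>
    (hf.contDiffAt (isOpen_ball.mem_nhds (hsub hx))).differentiableAt (by simp)
  have hf1 : ContDiffOn ℝ ∞ (fderiv ℝ f) (ball 0 r) :=
    hf.fderiv_of_isOpen isOpen_ball (by simp)
  have hd1 : ∀ x ∈ closedBall (0 : E) ρ, DifferentiableAt ℝ (fderiv ℝ f) x := fun x hx =>
    (hf1.contDiffAt (isOpen_ball.mem_nhds (hsub hx))).differentiableAt (by simp)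
  have hf2 : ContDiffOn ℝ ∞ (fderiv ℝ (fderiv ℝ f)) (ball 0 r) :=
    hf1.fderiv_of_isOpen isOpen_ball (by simp)
  obtain ⟨C0, h0⟩ := hK.exists_bound_of_continuousOn (hf.continuousOn.mono hsub)
  obtain ⟨C1, h1⟩ := hK.exists_bound_of_continuousOn (hf1.continuousOn.mono hsub)
  obtain ⟨C2, h2⟩ := hK.exists_bound_of_continuousOn (f := fderiv ℝ (fderiv ℝ f))
    (hf2.continuousOn.mono hsub)
  have hC0 : C0 ≤ max 1 (max C0 (max C1 C2)) := by simp
  have hC1 : C1 ≤ max 1 (max C0 (max C1 C2)) := by simp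
  have hC2 : C2 ≤ max 1 (max C0 (max C1 C2)) := by simp
  have hC : (0 : ℝ) < max 1 (max C0 (max C1 C2)) := lt_of_lt_of_le one_pos (le_max_left _ _)
  refine ⟨max 1 (max C0 (max C1 C2)), hC, fun x hx => (h0 x hx).trans hC0, fun x hx y hy => ?_,
    fun x hx y hy => ?_⟩
  · exact (convex_closedBall 0 ρ).norm_image_sub_le_of_norm_fderiv_le hd
      (fun z hz => (h1 z hz).trans hC1) hx hy
  · refine norm_sub_sub_fderiv_le (convex_closedBall 0 ρ) hd hC.le (fun a ha b hb => ?_) hx hy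
    exact (convex_closedBall 0 ρ).norm_image_sub_le_of_norm_fderiv_le hd1
      (fun z hz => (h2 z hz).trans hC2) ha hb

/-- **Frobenius' theorem for linear systems.** An integrable linear total differential equation
`DF(x) v = Θ(x)(v) F(x)` has a solution near `0` with any prescribed value at `0`. The value `F(x)`
is obtained by solving the equation along the ray through `x`; integrability shows that, for
increments `h`, the curve `t ↦ F(tx) + t Θ(tx)(h) F(tx)` solves the equation along the ray
through `x + h` up to an error `O(‖h‖²)`, so that Gronwall's inequality gives the derivative. -/
theorem exists_solution_of_integrable [CompleteSpace W] {r : ℝ} (hr : 0 < r)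
    (Θ : E → E →L[ℝ] W →L[ℝ] W) (hΘ : ContDiffOn ℝ ∞ Θ (ball 0 r))
    (hflat : ∀ x ∈ ball (0 : E) r, ∀ u v : E,
      fderiv ℝ Θ x u v + Θ x v ∘L Θ x u = fderiv ℝ Θ x v u + Θ x u ∘L Θ x v) (w₀ : W) :
    ∃ ρ, 0 < ρ ∧ ρ ≤ r ∧ ∃ F : E → W, F 0 = w₀ ∧
      ∀ x ∈ ball (0 : E) ρ, HasFDerivAt F ((Θ x).flip (F x)) x := by
  obtain ⟨C, hC, hb, hL, hT⟩ := exists_lipschitz_bounds (ρ := r / 2) (by linarith) hΘ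
  set ρ : ℝ := min (r / 2) (1 / (2 * C)) with hρ
  have hρ0 : 0 < ρ := lt_min (by linarith) (by positivity)
  have hρr : ρ ≤ r / 2 := min_le_left _ _
  have hCρ : C * ρ ≤ 1 / 2 := by
    have : ρ ≤ 1 / (2 * C) := min_le_right _ _
    calc C * ρ ≤ C * (1 / (2 * C)) := by gcongr
      _ = 1 / 2 := by field_simp
  -- points on the ray through `x`
  have hmem : ∀ x ∈ ball (0 : E) ρ, ∀ t ∈ Icc (0 : ℝ) 1, t • x ∈ closedBall (0 : E) (r / 2) := by
    intro x hx t ht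
    rw [mem_ball_zero_iff] at hx
    rw [mem_closedBall_zero_iff, norm_smul, Real.norm_eq_abs, abs_of_nonneg ht.1]
    nlinarith [norm_nonneg x, ht.2]
  have hsub : closedBall (0 : E) (r / 2) ⊆ ball 0 r := closedBall_subset_ball (by linarith)
  have hNb : ∀ x ∈ ball (0 : E) ρ, ∀ t ∈ Icc (0 : ℝ) 1, ‖Θ (t • x) x‖ ≤ 1 / 2 := by
    intro x hx t ht
    have h1 := (Θ (t • x)).le_opNorm x
    have h2 := hb _ (hmem x hx t ht)
    rw [mem_ball_zero_iff] at hx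
    calc _ ≤ _ := h1
      _ ≤ C * ρ := by gcongr
      _ ≤ _ := hCρ
  have hNc : ∀ x ∈ ball (0 : E) ρ, ContinuousOn (fun t : ℝ => Θ (t • x) x) (Icc 0 1) := by
    intro x hx
    refine ContinuousOn.clm_apply (hΘ.continuousOn.comp
      (continuous_id.smul continuous_const).continuousOn fun t ht => hsub (hmem x hx t ht))
      continuousOn_const
  choose! c hc0 hc using fun x (hx : x ∈ ball (0 : E) ρ) =>
    exists_linear_ode_solution _ (hNc x hx) (hNb x hx) w₀
  refine ⟨ρ, hρ0, by linarith, fun x => c x 1, ?_, fun x hx => ?_⟩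
  · have h0 : (0 : E) ∈ ball (0 : E) ρ := mem_ball_self hρ0
    have := norm_le_of_deriv_le_mul_add (e := fun t => c 0 t - w₀) (K := 1) (ε := 0) one_pos
      (fun t ht => (hc 0 h0 t ht).sub_const w₀) (by simp [hc0 0 h0]) (fun t ht => by simp)
    simpa [sub_eq_zero] using this
  · -- a bound for the solution along the ray through `x`
    obtain ⟨m, hm⟩ := (isCompact_Icc (a := (0 : ℝ)) (b := 1)).exists_bound_of_continuousOn
      (f := c x) (fun t ht => (hc x hx t ht).continuousWithinAt)
    have hm0 : 0 ≤ m := (norm_nonneg _).trans (hm 0 (by simp))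
    have hxρ : ‖x‖ < ρ := by simpa using hx
    have key : ∀ h : E, x + h ∈ ball (0 : E) ρ →
        ‖c (x + h) 1 - c x 1 - Θ x h (c x 1)‖ ≤
          ((C * ‖x‖ * m + C * m + (C * ‖x‖ + C) * C * m) * ‖h‖ ^ 2) *
            ((Real.exp (1 / 2) - 1) / (1 / 2)) := by
      intro h hh
      have hderiv : ∀ t ∈ Icc (0 : ℝ) 1, HasDerivWithinAt
          (fun t => c (x + h) t - c x t - t • Θ (t • x) h (c x t))
          (Θ (t • (x + h)) (x + h) (c (x + h) t) - Θ (t • x) x (c x t)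
            - (t • ((fderiv ℝ Θ (t • x) x h) (c x t) + Θ (t • x) h (Θ (t • x) x (c x t)))
              + (1 : ℝ) • Θ (t • x) h (c x t))) (Icc 0 1) t := by
        intro t ht
        refine ((hc (x + h) hh t ht).sub (hc x hx t ht)).sub ?_
        have hd : DifferentiableAt ℝ Θ (t • x) :=
          (hΘ.contDiffAt (isOpen_ball.mem_nhds (hsub (hmem x hx t ht)))).differentiableAt (by simp)
        have h1 : HasDerivAt (fun t : ℝ => Θ (t • x)) (fderiv ℝ Θ (t • x) x) t := by
          have h0 : HasDerivAt (fun t : ℝ => t • x) x t := by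
            simpa using (hasDerivAt_id t).smul_const x
          exact HasFDerivAt.comp_hasDerivAt (l := Θ) t hd.hasFDerivAt h0
        have h2 : HasDerivAt (fun t : ℝ => Θ (t • x) h) (fderiv ℝ Θ (t • x) x h) t := by
          simpa using h1.clm_apply (hasDerivAt_const t h)
        exact (hasDerivAt_id t).hasDerivWithinAt.smul
          (h2.hasDerivWithinAt.clm_apply (hc x hx t ht))
      have := norm_le_of_deriv_le_mul_add (K := 1 / 2)
        (ε := (C * ‖x‖ * m + C * m + (C * ‖x‖ + C) * C * m) * ‖h‖ ^ 2) (by norm_num) hderiv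
        (by simp [hc0 x hx, hc0 _ hh]) ?_
      · simpa using this
      intro t ht
      have hy := hmem x hx t ht
      have hz := hmem (x + h) hh t ht
      have hn : ‖t • (x + h) - t • x‖ ≤ ‖h‖ := by
        rw [← smul_sub, add_sub_cancel_left, norm_smul, Real.norm_eq_abs, abs_of_nonneg ht.1]
        nlinarith [norm_nonneg h, ht.2]
      have hfl := congrArg (fun T : W →L[ℝ] W => T (c x t)) (hflat (t • x) (hsub hy) x h)
      simp only [add_apply, ContinuousLinearMap.comp_apply] at hfl
      rw [hfl]
      set y := t • x
      set z := t • (x + h)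
      set q := c x t
      have hq : ‖q‖ ≤ m := hm t ht
      have hsplit : Θ z (x + h) (c (x + h) t) - Θ y x q
            - (t • (fderiv ℝ Θ y h x q + Θ y x (Θ y h q)) + (1 : ℝ) • Θ y h q)
          = Θ z (x + h) (c (x + h) t - q - t • Θ y h q)
            + ((Θ z - Θ y - fderiv ℝ Θ y (z - y)) x q + (Θ z - Θ y) h q
              + t • (((Θ z - Θ y) x + Θ z h) (Θ y h q))) := by
        have : z - y = t • h := by simp [z, y]
        rw [this]
        simp only [map_add, map_sub, map_smul, add_apply,
          sub_apply, smul_apply]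
        module
      rw [hsplit]
      have hh2 : ‖h‖ ^ 2 = ‖h‖ * ‖h‖ := sq _
      have e1 : ‖(Θ z - Θ y - fderiv ℝ Θ y (z - y)) x q‖ ≤ C * ‖h‖ ^ 2 * ‖x‖ * m := by
        calc _ ≤ ‖Θ z - Θ y - fderiv ℝ Θ y (z - y)‖ * ‖x‖ * ‖q‖ :=
              ContinuousLinearMap.le_opNorm₂ _ _ _
          _ ≤ (C * ‖z - y‖ ^ 2) * ‖x‖ * m := by
              gcongr
              exact hT y hy z hz
          _ ≤ _ := by gcongr
      have e2 : ‖(Θ z - Θ y) h q‖ ≤ (C * ‖h‖) * ‖h‖ * m := by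
        calc _ ≤ ‖Θ z - Θ y‖ * ‖h‖ * ‖q‖ := ContinuousLinearMap.le_opNorm₂ _ _ _
          _ ≤ (C * ‖z - y‖) * ‖h‖ * m := by
              gcongr
              exact hL y hy z hz
          _ ≤ _ := by gcongr
      have e3 : ‖t • (((Θ z - Θ y) x + Θ z h) (Θ y h q))‖
          ≤ (C * ‖h‖ * ‖x‖ + C * ‖h‖) * (C * ‖h‖ * m) := by
        have a1 : ‖(Θ z - Θ y) x‖ ≤ C * ‖h‖ * ‖x‖ := by
          calc _ ≤ ‖Θ z - Θ y‖ * ‖x‖ := ContinuousLinearMap.le_opNorm _ _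
            _ ≤ (C * ‖z - y‖) * ‖x‖ := by
                gcongr
                exact hL y hy z hz
            _ ≤ _ := by gcongr
        have a2 : ‖Θ z h‖ ≤ C * ‖h‖ :=
          (ContinuousLinearMap.le_opNorm _ _).trans (by gcongr; exact hb z hz)
        have a3 : ‖Θ y h q‖ ≤ C * ‖h‖ * m :=
          (ContinuousLinearMap.le_opNorm₂ _ _ _).trans (by gcongr; exact hb y hy)
        rw [norm_smul, Real.norm_eq_abs, abs_of_nonneg ht.1]
        calc t * ‖((Θ z - Θ y) x + Θ z h) (Θ y h q)‖
            ≤ 1 * ‖((Θ z - Θ y) x + Θ z h) (Θ y h q)‖ := by gcongr; exact ht.2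
          _ ≤ ‖(Θ z - Θ y) x + Θ z h‖ * ‖Θ y h q‖ := by
              rw [one_mul]; exact ContinuousLinearMap.le_opNorm _ _
          _ ≤ _ := by
              gcongr
              exact (norm_add_le _ _).trans (add_le_add a1 a2)
      have e0 : ‖Θ z (x + h) (c (x + h) t - q - t • Θ y h q)‖
          ≤ 1 / 2 * ‖c (x + h) t - q - t • Θ y h q‖ :=
        (ContinuousLinearMap.le_opNorm _ _).trans (by gcongr; exact hNb _ hh t ht)
      calc _ ≤ _ := norm_add_le _ _
        _ ≤ 1 / 2 * ‖c (x + h) t - q - t • Θ y h q‖ + (C * ‖h‖ ^ 2 * ‖x‖ * m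
            + (C * ‖h‖) * ‖h‖ * m + (C * ‖h‖ * ‖x‖ + C * ‖h‖) * (C * ‖h‖ * m)) := by
            gcongr
            exact (norm_add_le _ _).trans (add_le_add ((norm_add_le _ _).trans
              (add_le_add e1 e2)) e3)
        _ = _ := by ring
    rw [hasFDerivAt_iff_isLittleO_nhds_zero]
    refine Asymptotics.IsBigO.trans_isLittleO (g := fun h : E => ‖h‖ ^ 2) ?_ ?_
    · refine Asymptotics.IsBigO.of_bound ((C * ‖x‖ * m + C * m + (C * ‖x‖ + C) * C * m) *
        ((Real.exp (1 / 2) - 1) / (1 / 2))) ?_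
      have : ∀ᶠ h : E in 𝓝 0, x + h ∈ ball (0 : E) ρ := by
        have : ContinuousAt (fun h : E => x + h) 0 := by fun_prop
        exact this.eventually_mem (isOpen_ball.mem_nhds (by simpa using hxρ))
      filter_upwards [this] with h hh
      rw [norm_pow, norm_norm]
      calc _ ≤ _ := key h hh
        _ = _ := by ring
    · exact Asymptotics.isLittleO_norm_pow_id one_lt_two

end Integrable

section Integrable

open Metric Set

variable {E W : Type*} [NormedAddCommGroup E] [NormedSpace ℝ E]
  [NormedAddCommGroup W] [NormedSpace ℝ W]

/-- Solutions of a smooth linear total differential equation are smooth. -/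
lemma contDiffOn_of_hasFDerivAt_flip [FiniteDimensional ℝ E] {s : Set E} (hs : IsOpen s)
    {Θ : E → E →L[ℝ] W →L[ℝ] W} (hΘ : ContDiffOn ℝ ∞ Θ s) {F : E → W}
    (hF : ∀ x ∈ s, HasFDerivAt F ((Θ x).flip (F x)) x) : ContDiffOn ℝ ∞ F s := by
  rw [contDiffOn_infty]
  intro k
  induction k with
  | zero =>
    exact contDiffOn_zero.2 fun x hx => (hF x hx).continuousAt.continuousWithinAt
  | succ k ih =>
    rw [Nat.cast_succ, contDiffOn_succ_iff_fderiv_of_isOpen hs]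
    refine ⟨fun x hx => (hF x hx).differentiableAt.differentiableWithinAt, by simp, ?_⟩
    refine ContDiffOn.congr (f := fun x => (Θ x).flip (F x)) ?_ fun x hx => (hF x hx).fderiv
    refine contDiffOn_clm_apply.2 fun v => ?_
    exact ((hΘ.of_le (by exact_mod_cast le_top)).clm_apply contDiffOn_const).clm_apply ih

end Integrable

/-! ### The Poincaré lemma for closed 2-forms -/

section Poincare

open Metric Set

/-- A cut-off of a function which is smooth on a ball is globally smooth and agrees with it on a
smaller ball. -/
lemma exists_contDiff_eqOn_ball {E G : Type*} [NormedAddCommGroup E] [InnerProductSpace ℝ E]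
    [NormedAddCommGroup G] [NormedSpace ℝ G] {r : ℝ} (hr : 0 < r)
    {g : E → G} (hg : ContDiffOn ℝ ∞ g (ball 0 r)) :
    ∃ g' : E → G, ContDiff ℝ ∞ g' ∧ ∀ x ∈ ball (0 : E) (r / 4), g' x = g x := by
  let χ : ContDiffBump (0 : E) := ⟨r / 4, r / 2, by linarith, by linarith⟩
  refine ⟨fun x => χ x • g x, ?_, fun x hx => ?_⟩
  · rw [contDiff_iff_contDiffAt]
    intro x
    by_cases hx : x ∈ ball (0 : E) r
    · exact χ.contDiff.contDiffAt.smul (hg.contDiffAt (isOpen_ball.mem_nhds hx))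
    · refine (contDiffAt_const (c := (0 : G))).congr_of_eventuallyEq ?_
      have : x ∈ (closedBall (0 : E) (r / 2))ᶜ := fun h =>
        hx (closedBall_subset_ball (by linarith) h)
      filter_upwards [isClosed_closedBall.isOpen_compl.mem_nhds this] with y hy
      have : χ y = 0 := by
        have h2 : y ∉ Function.support χ := by
          rw [χ.support_eq]
          exact fun h => hy (ball_subset_closedBall h)
        simpa using h2
      simp [this]
  · have : χ x = 1 := χ.one_of_mem_closedBall (ball_subset_closedBall hx)
    simp [this]

lemma hasFDerivAt_integral_of_contDiff {E G : Type*} [NormedAddCommGroup E] [NormedSpace ℝ E]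
    [FiniteDimensional ℝ E] [NormedAddCommGroup G] [NormedSpace ℝ G] [CompleteSpace G]
    {g : ℝ × E → G} (hg : ContDiff ℝ ∞ g) (x₀ : E) :
    HasFDerivAt (fun x => ∫ t in (0 : ℝ)..1, g (t, x))
      (∫ t in (0 : ℝ)..1, (fderiv ℝ g (t, x₀)).comp (ContinuousLinearMap.inr ℝ ℝ E)) x₀ := by
  have hg' : Continuous (fun q : ℝ × E => (fderiv ℝ g q).comp (ContinuousLinearMap.inr ℝ ℝ E)) :=
    (hg.continuous_fderiv (by simp)).clm_comp continuous_const
  obtain ⟨C, hC⟩ := ((isCompact_Icc (a := (0 : ℝ)) (b := 1)).prod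
    (isCompact_closedBall x₀ 1)).exists_bound_of_continuousOn hg'.continuousOn
  refine intervalIntegral.hasFDerivAt_integral_of_dominated_of_fderiv_le
    (F := fun x t => g (t, x)) (bound := fun _ => C)
    (F' := fun x t => (fderiv ℝ g (t, x)).comp (ContinuousLinearMap.inr ℝ ℝ E))
    (ball_mem_nhds x₀ one_pos) ?_ ?_ ?_ ?_ ?_ ?_
  · exact Filter.Eventually.of_forall fun x =>
      (hg.continuous.comp (by fun_prop)).aestronglyMeasurable
  · exact (hg.continuous.comp (by fun_prop)).intervalIntegrable _ _
  · exact (hg'.comp (by fun_prop : Continuous fun t : ℝ => (t, x₀))).aestronglyMeasurable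
  · refine Filter.Eventually.of_forall fun t ht x hx => hC (t, x) ⟨?_, ball_subset_closedBall hx⟩
    rw [uIoc_of_le zero_le_one] at ht
    exact Ioc_subset_Icc_self ht
  · exact intervalIntegrable_const
  · refine Filter.Eventually.of_forall fun t _ x _ => ?_
    have h1 : HasFDerivAt g (fderiv ℝ g (t, x)) (t, x) :=
      (hg.contDiffAt.differentiableAt (by simp)).hasFDerivAt
    exact h1.comp x (hasFDerivAt_prodMk_right t x)

/-- The integral over `[0, 1]` of a smooth function depends smoothly on parameters. -/
lemma contDiff_integral_of_contDiff {E G : Type} [NormedAddCommGroup E] [NormedSpace ℝ E]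
    [FiniteDimensional ℝ E] [NormedAddCommGroup G] [NormedSpace ℝ G] [CompleteSpace G]
    {g : ℝ × E → G} (hg : ContDiff ℝ ∞ g) :
    ContDiff ℝ ∞ (fun x => ∫ t in (0 : ℝ)..1, g (t, x)) := by
  rw [contDiff_infty]
  intro k
  induction k generalizing G with
  | zero =>
    exact contDiff_zero.2 (continuous_iff_continuousAt.2 fun x =>
      (hasFDerivAt_integral_of_contDiff hg x).continuousAt)
  | succ k ih =>
    rw [Nat.cast_succ, contDiff_succ_iff_hasFDerivAt]
    refine ⟨_, ih (g := fun q => (fderiv ℝ g q).comp (ContinuousLinearMap.inr ℝ ℝ E)) ?_,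
      hasFDerivAt_integral_of_contDiff hg⟩
    exact (hg.fderiv_right (by simp)).clm_comp contDiff_const

/-- **Poincaré lemma** for a closed 2-form `w` near the centre of a ball: a primitive of `2w` is
`α(x)(v) = ∫₀¹ 2 t w(tx)(x, v) dt`, by the usual radial homotopy. -/
theorem exists_primitive_of_closed {E : Type} [NormedAddCommGroup E] [InnerProductSpace ℝ E]
    [FiniteDimensional ℝ E] {r : ℝ} (hr : 0 < r) {w : E → E →L[ℝ] E →L[ℝ] ℝ}
    (hw : ContDiffOn ℝ ∞ w (ball 0 r))
    (halt : ∀ x ∈ ball (0 : E) r, ∀ u v, w x u v = - w x v u)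
    (hcl : ∀ x ∈ ball (0 : E) r, ∀ u v z,
      fderiv ℝ w x u v z + fderiv ℝ w x v z u + fderiv ℝ w x z u v = 0) :
    ∃ ρ, 0 < ρ ∧ ρ ≤ r ∧ ∃ α : E → E →L[ℝ] ℝ, ContDiff ℝ ∞ α ∧
      ∀ x ∈ ball (0 : E) ρ, ∀ u v, fderiv ℝ α x u v - fderiv ℝ α x v u = 2 * w x u v := by
  obtain ⟨w', hw', heq⟩ := exists_contDiff_eqOn_ball hr hw
  set g : ℝ × E → E →L[ℝ] ℝ := fun q => (2 * q.1) • w' (q.1 • q.2) q.2 with hgdef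
  have hg : ContDiff ℝ ∞ g := by
    have h1 : ContDiff ℝ ∞ fun q : ℝ × E => w' (q.1 • q.2) :=
      hw'.comp (contDiff_fst.smul contDiff_snd)
    exact (contDiff_const.mul contDiff_fst).smul (h1.clm_apply contDiff_snd)
  refine ⟨r / 4, by linarith, by linarith, _, contDiff_integral_of_contDiff hg, ?_⟩
  intro x hx u v
  have hmem : ∀ t ∈ Icc (0 : ℝ) 1, t • x ∈ ball (0 : E) (r / 4) := by
    intro t ht
    rw [mem_ball_zero_iff] at hx ⊢
    rw [norm_smul, Real.norm_eq_abs, abs_of_nonneg ht.1]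
    nlinarith [norm_nonneg x, ht.2]
  have hbig : ball (0 : E) (r / 4) ⊆ ball 0 r := ball_subset_ball (by linarith)
  have hfd : ∀ y ∈ ball (0 : E) (r / 4), fderiv ℝ w' y = fderiv ℝ w y := fun y hy =>
    Filter.EventuallyEq.fderiv_eq (Filter.eventually_of_mem (isOpen_ball.mem_nhds hy) heq)
  have hd' : ∀ y, HasFDerivAt w' (fderiv ℝ w' y) y := fun y =>
    (hw'.contDiffAt.differentiableAt (by simp)).hasFDerivAt
  -- the derivative of the integrand
  have hdg : ∀ t : ℝ, ∀ a b : E, (fderiv ℝ g (t, x)).comp (ContinuousLinearMap.inr ℝ ℝ E) a b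
      = (2 * t) * (t * fderiv ℝ w' (t • x) a x b + w' (t • x) a b) := by
    intro t a b
    have h0 : HasDerivAt (fun s : ℝ => x + s • a) a 0 := by
      simpa using ((hasDerivAt_id (0 : ℝ)).smul_const a).const_add x
    have h1 : HasDerivAt (fun s : ℝ => g (t, x + s • a)) (fderiv ℝ g (t, x) (0, a)) 0 := by
      have hgd : HasFDerivAt g (fderiv ℝ g (t, x)) (t, x + (0 : ℝ) • a) := by
        simpa using (hg.contDiffAt.differentiableAt (by simp)).hasFDerivAt
      exact HasFDerivAt.comp_hasDerivAt (l := g) 0 hgd ((hasDerivAt_const (0 : ℝ) t).prodMk h0)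
    have h2 : HasDerivAt (fun s : ℝ => w' (t • (x + s • a))) (fderiv ℝ w' (t • x) (t • a)) 0 := by
      have hwd : HasFDerivAt w' (fderiv ℝ w' (t • x)) (t • (x + (0 : ℝ) • a)) := by
        simpa using hd' (t • x)
      exact HasFDerivAt.comp_hasDerivAt (l := w') 0 hwd (h0.const_smul t)
    have h3 := (h2.clm_apply h0).const_smul (2 * t)
    have h4 := h1.unique h3
    have h5 := congrArg (fun T : E →L[ℝ] ℝ => T b) h4
    simp only [zero_smul, add_zero, map_smul, smul_apply, add_apply, smul_eq_mul] at h5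
    simpa using h5
  have hint : ∀ a b : E, fderiv ℝ (fun x => ∫ t in (0 : ℝ)..1, g (t, x)) x a b
      = ∫ t in (0 : ℝ)..1, (2 * t) * (t * fderiv ℝ w' (t • x) a x b + w' (t • x) a b) := by
    intro a b
    rw [(hasFDerivAt_integral_of_contDiff hg x).fderiv]
    have hc : Continuous fun t : ℝ =>
        (fderiv ℝ g (t, x)).comp (ContinuousLinearMap.inr ℝ ℝ E) :=
      ((hg.continuous_fderiv (by simp)).comp (by fun_prop)).clm_comp continuous_const
    rw [ContinuousLinearMap.intervalIntegral_apply (hc.intervalIntegrable _ _),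
      ContinuousLinearMap.intervalIntegral_apply
        ((hc.clm_apply continuous_const).intervalIntegrable _ _)]
    exact intervalIntegral.integral_congr fun t _ => hdg t a b
  have hwc : ∀ a b c : E, Continuous fun t : ℝ => fderiv ℝ w' (t • x) a b c := fun a b c =>
    ((((hw'.continuous_fderiv (by simp)).comp (by fun_prop)).clm_apply
      continuous_const).clm_apply continuous_const).clm_apply continuous_const
  have hwc0 : ∀ a b : E, Continuous fun t : ℝ => w' (t • x) a b := fun a b =>
    ((hw'.continuous.comp (by fun_prop)).clm_apply continuous_const).clm_apply continuous_const
  have hci : ∀ a b : E, Continuous fun t : ℝ =>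
      (2 * t) * (t * fderiv ℝ w' (t • x) a x b + w' (t • x) a b) := fun a b => by
    have h1 := hwc a x b
    have h2 := hwc0 a b
    exact (continuous_const.mul continuous_id).mul ((continuous_id.mul h1).add h2)
  rw [hint, hint, ← intervalIntegral.integral_sub ((hci u v).intervalIntegrable _ _)
    ((hci v u).intervalIntegrable _ _)]
  -- by closedness, the difference is a total derivative
  have hFTC : ∀ t ∈ uIcc (0 : ℝ) 1, HasDerivAt (fun t : ℝ => (2 * t ^ 2) * w' (t • x) u v)
      ((2 * t) * (t * fderiv ℝ w' (t • x) u x v + w' (t • x) u v)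
        - (2 * t) * (t * fderiv ℝ w' (t • x) v x u + w' (t • x) v u)) t := by
    intro t ht
    rw [uIcc_of_le zero_le_one] at ht
    have hy := hmem t ht
    have h0 : HasDerivAt (fun t : ℝ => t • x) x t := by
      simpa using (hasDerivAt_id t).smul_const x
    have h1 : HasDerivAt (fun t : ℝ => w' (t • x)) (fderiv ℝ w' (t • x) x) t :=
      HasFDerivAt.comp_hasDerivAt (l := w') t (hd' (t • x)) h0
    have h2 : HasDerivAt (fun t : ℝ => w' (t • x) u v) (fderiv ℝ w' (t • x) x u v) t := by
      simpa using (h1.clm_apply (hasDerivAt_const t u)).clm_apply (hasDerivAt_const t v)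
    have h3 := ((hasDerivAt_pow 2 t).const_mul 2).mul h2
    refine h3.congr_deriv ?_
    have e1 : w' (t • x) v u = - w' (t • x) u v := by
      rw [heq _ hy]; exact halt _ (hbig hy) v u
    -- antisymmetry of the derivative, from antisymmetry of `w`
    have e2 : fderiv ℝ w' (t • x) v x u = - fderiv ℝ w' (t • x) v u x := by
      have ha : HasFDerivAt (fun y => w' y x u) _ (t • x) :=
        ((hd' (t • x)).clm_apply (hasFDerivAt_const x _)).clm_apply (hasFDerivAt_const u _)
      have hb : HasFDerivAt (fun y => - w' y u x) _ (t • x) :=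
        (((hd' (t • x)).clm_apply (hasFDerivAt_const u _)).clm_apply (hasFDerivAt_const x _)).neg
      have hab := ha.unique (hb.congr_of_eventuallyEq
        (Filter.eventually_of_mem (isOpen_ball.mem_nhds hy) fun y hy => by
          simp only [heq y hy]; exact halt _ (hbig hy) x u))
      simpa using congrArg (fun T : E →L[ℝ] ℝ => T v) hab
    have e3 := hcl _ (hbig hy) u x v
    have e4 : fderiv ℝ w' (t • x) x v u = - fderiv ℝ w' (t • x) x u v := by
      have ha : HasFDerivAt (fun y => w' y v u) _ (t • x) :=
        ((hd' (t • x)).clm_apply (hasFDerivAt_const v _)).clm_apply (hasFDerivAt_const u _)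
      have hb : HasFDerivAt (fun y => - w' y u v) _ (t • x) :=
        (((hd' (t • x)).clm_apply (hasFDerivAt_const u _)).clm_apply (hasFDerivAt_const v _)).neg
      have hab := ha.unique (hb.congr_of_eventuallyEq
        (Filter.eventually_of_mem (isOpen_ball.mem_nhds hy) fun y hy => by
          simp only [heq y hy]; exact halt _ (hbig hy) v u))
      simpa using congrArg (fun T : E →L[ℝ] ℝ => T x) hab
    rw [← hfd _ hy] at e3
    rw [e1, e2]
    rw [e4] at e3
    simp only [Nat.cast_ofNat, Nat.add_one_sub_one, pow_one]
    linear_combination (-2 * t ^ 2) * e3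
  rw [intervalIntegral.integral_eq_sub_of_hasDerivAt hFTC
    (((hci u v).sub (hci v u)).intervalIntegrable _ _)]
  simp [heq x hx]

end Poincare

/-! ### Symplectic linear algebra -/

section LinearAlgebra

variable {E : Type*} [NormedAddCommGroup E] [NormedSpace ℝ E]

/-- An alternating bilinear form whose kernel has codimension at most `2n` is a sum of `n` products
`q_i ∧ p_i` of linear forms. -/
lemma exists_sum_wedge_aux [FiniteDimensional ℝ E] (n : ℕ) :
    ∀ (B : E →ₗ[ℝ] E →ₗ[ℝ] ℝ) (_ : ∀ u, B u u = 0) (K : Submodule ℝ E)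
      (_ : ∀ u ∈ K, ∀ v, B u v = 0) (_ : Module.finrank ℝ E ≤ Module.finrank ℝ K + 2 * n),
      ∃ q p : Fin n → E →ₗ[ℝ] ℝ, ∀ u v, B u v = ∑ i, (q i u * p i v - p i u * q i v) := by
  induction n with
  | zero =>
    intro B _ K hK hd
    have : K = ⊤ := Submodule.eq_top_of_finrank_eq (le_antisymm K.finrank_le (by simpa using hd))
    exact ⟨0, 0, fun u v => by simp [hK u (this ▸ Submodule.mem_top) v]⟩
  | succ n ih =>
    intro B hB K hK hd
    have hanti : ∀ u v, B u v = - B v u := fun u v => by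
      have := hB (u + v)
      simp only [map_add, LinearMap.add_apply, hB] at this
      linarith
    by_cases h0 : ∀ x y, B x y = 0
    · exact ⟨0, 0, fun u v => by simp [h0 u v]⟩
    push Not at h0
    obtain ⟨x, y', hxy'⟩ := h0
    set y := (B x y')⁻¹ • y' with hy
    have hxy : B x y = 1 := by simp [hy, hxy']
    obtain ⟨Q, hQa⟩ : ∃ Q : E →ₗ[ℝ] ℝ, ∀ u, Q u = B u y := ⟨B.flip y, fun _ => rfl⟩
    obtain ⟨P, hP⟩ : ∃ P : E →ₗ[ℝ] ℝ, ∀ u, P u = B x u := ⟨B x, fun _ => rfl⟩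
    obtain ⟨B', hB'a⟩ : ∃ B' : E →ₗ[ℝ] E →ₗ[ℝ] ℝ,
        ∀ u v, B' u v = B u v - (Q u * P v - P u * Q v) :=
      ⟨B - (Q.smulRight P - P.smulRight Q), fun u v => by simp⟩
    have hKd : Disjoint K (Submodule.span ℝ {x, y}) := by
      rw [Submodule.disjoint_def]
      intro z hzK hz
      obtain ⟨a, b, rfl⟩ := Submodule.mem_span_pair.1 hz
      have h1 := hK _ hzK y
      have h2 := hK _ hzK x
      simp only [map_add, map_smul, LinearMap.add_apply, LinearMap.smul_apply, hB, hxy,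
        hanti y x, smul_eq_mul] at h1 h2
      have ha : a = 0 := by linarith
      have hb : b = 0 := by linarith
      simp [ha, hb]
    have hli : LinearIndependent ℝ ![x, y] := by
      rw [LinearIndependent.pair_iff]
      intro a b hab
      have h1 := congrArg (fun z => B z y) hab
      have h2 := congrArg (fun z => B z x) hab
      simp only [map_add, map_smul, LinearMap.add_apply, LinearMap.smul_apply, hB, hxy,
        hanti y x, smul_eq_mul, map_zero, LinearMap.zero_apply] at h1 h2
      exact ⟨by linarith, by linarith⟩
    have hspan : Module.finrank ℝ (Submodule.span ℝ {x, y}) = 2 := by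
      have := finrank_span_eq_card hli
      rwa [Matrix.range_cons, Matrix.range_cons, Matrix.range_empty, Set.union_empty,
        Set.singleton_union, Fintype.card_fin] at this
    have hsup := Submodule.finrank_sup_add_finrank_inf_eq K (Submodule.span ℝ {x, y})
    rw [hKd.eq_bot, finrank_bot, hspan] at hsup
    obtain ⟨q, p, hqp⟩ := ih B' (fun u => by rw [hB'a, hB]; ring)
      (K ⊔ Submodule.span ℝ {x, y}) (by
        intro u hu v
        obtain ⟨k, hk, z, hz, rfl⟩ := Submodule.mem_sup.1 hu
        obtain ⟨a, b, rfl⟩ := Submodule.mem_span_pair.1 hz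
        have e1 := hK k hk v
        have e2 := hK k hk y
        have e3 := hK k hk x
        have e4 := hanti x k
        have e5 := hanti y v
        rw [hB'a]
        simp only [hP, hQa, map_add, map_smul, LinearMap.add_apply, LinearMap.smul_apply, hB, hxy,
          smul_eq_mul, e1, e2, e3, e4, e5]
        ring) (by omega)
    refine ⟨Fin.cons Q q, Fin.cons P p, fun u v => ?_⟩
    have := hqp u v
    rw [hB'a] at this
    simp only [Fin.sum_univ_succ, Fin.cons_zero, Fin.cons_succ, ← this]
    ring

variable (w : E →L[ℝ] E →L[ℝ] ℝ)

lemma exists_sum_wedge [FiniteDimensional ℝ E] (n : ℕ) (hn : Module.finrank ℝ E = 2 * n)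
    (halt : ∀ u, w u u = 0) :
    ∃ q p : Fin n → E →L[ℝ] ℝ, ∀ u v, w u v = ∑ i, (q i u * p i v - p i u * q i v) := by
  obtain ⟨q, p, h⟩ := exists_sum_wedge_aux n
    ((ContinuousLinearMap.coeLM ℝ).comp w.toLinearMap : E →ₗ[ℝ] E →ₗ[ℝ] ℝ) halt ⊥
    (fun u hu v => by simp [(Submodule.mem_bot ℝ).1 hu]) (by simp [hn])
  exact ⟨fun i => LinearMap.toContinuousLinearMap (q i),
    fun i => LinearMap.toContinuousLinearMap (p i), h⟩

variable {w} in
lemma eq_neg_of_alternating (halt : ∀ u, w u u = 0) (u v : E) : w u v = - w v u := by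
  have := halt (u + v)
  simp only [map_add, add_apply, halt] at this
  linarith

variable {w} in
lemma eq_of_forall_form_eq (hnd : ∀ u, (∀ v, w u v = 0) → u = 0) {u v : E}
    (h : ∀ z, w u z = w v z) : u = v :=
  sub_eq_zero.1 (hnd _ fun z => by simp [h z])

variable {w} in
lemma form_bijective [FiniteDimensional ℝ E] (hnd : ∀ u, (∀ v, w u v = 0) → u = 0) :
    Function.Bijective w := by
  have hi : Function.Injective w := fun u v h => eq_of_forall_form_eq hnd fun z => by rw [h]
  refine ⟨hi, ?_⟩
  have hd : Module.finrank ℝ E = Module.finrank ℝ (E →L[ℝ] ℝ) := by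
    rw [← (LinearMap.toContinuousLinearMap (𝕜 := ℝ) (E := E) (F' := ℝ)).finrank_eq,
      Subspace.dual_finrank_eq]
  exact (LinearMap.injective_iff_surjective_of_finrank_eq_finrank
    (f := (w : E →ₗ[ℝ] (E →L[ℝ] ℝ))) hd).1 hi

variable {w} (halt : ∀ u, w u u = 0) (hnd : ∀ u, (∀ v, w u v = 0) → u = 0)

lemma exists_notMem_span_pair (hd : 3 ≤ Module.finrank ℝ E) (x y : E) :
    ∃ z, z ∉ Submodule.span ℝ {x, y} := by
  by_contra! h
  have h1 : Submodule.span ℝ {x, y} = ⊤ := Submodule.eq_top_iff'.2 h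
  classical
  have h2 := finrank_span_finset_le_card (R := ℝ) ({x, y} : Finset E)
  have h3 : ({x, y} : Finset E).card ≤ 2 := Finset.card_le_two
  rw [Finset.coe_insert, Finset.coe_singleton, Set.finrank, h1, finrank_top] at h2
  omega

include hnd in
lemma exists_form_eq_one {x : E} (hx : x ≠ 0) : ∃ y, w x y = 1 := by
  have : ∃ y, w x y ≠ 0 := by
    by_contra! h
    exact hx (hnd x h)
  obtain ⟨y, hy⟩ := this
  exact ⟨(w x y)⁻¹ • y, by simp [hy]⟩

include hnd in
lemma exists_orthogonal_notMem_span (hd : 3 ≤ Module.finrank ℝ E) {x : E} (hx : x ≠ 0) :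
    ∃ y, w x y = 0 ∧ ∀ c : ℝ, y ≠ c • x := by
  obtain ⟨e, he⟩ := exists_form_eq_one hnd hx
  obtain ⟨z, hz⟩ := exists_notMem_span_pair hd x e
  refine ⟨z - w x z • e, by simp [he], fun c hc => hz ?_⟩
  exact Submodule.mem_span_pair.2 ⟨c, w x z, by rw [← hc]; abel⟩

include hnd in
/-- In dimension at least three the orthogonal complement of a vector is not isotropic. -/
lemma exists_orthogonal_pair (hd : 3 ≤ Module.finrank ℝ E) {x : E} (hx : x ≠ 0) :
    ∃ y v, w x y = 0 ∧ w x v = 0 ∧ w y v ≠ 0 := by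
  obtain ⟨y, hy, hyx⟩ := exists_orthogonal_notMem_span hnd hd hx
  obtain ⟨e, he⟩ := exists_form_eq_one hnd hx
  by_contra! h
  refine hyx (w y e) (eq_of_forall_form_eq hnd fun z => ?_)
  have := h y (z - w x z • e) hy (by simp [he])
  simp only [map_sub, map_smul, smul_eq_mul] at this
  simp only [map_smul, smul_apply, smul_eq_mul]
  linarith

/-- A function `a` of two vectors with `a(y, z) x + a(z, x) y + a(x, y) z = 0` vanishes in dimension
at least three; here this is applied to the skew part of the Ricci tensor. -/
lemma eq_zero_of_cyclic_form {a : E → E → ℝ} (hd : 3 ≤ Module.finrank ℝ E)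
    (hnd : ∀ u, (∀ v, w u v = 0) → u = 0)
    (h : ∀ x y z t, w x t * a y z + w y t * a z x + w z t * a x y = 0) (y z : E) : a y z = 0 := by
  obtain ⟨x, hx⟩ := exists_notMem_span_pair hd y z
  have h1 : a y z • x + a z x • y + a x y • z = 0 := hnd _ fun t => by
    have := h x y z t
    simp only [map_add, map_smul, add_apply, smul_apply, smul_eq_mul]
    linarith
  by_contra h0
  refine hx (Submodule.mem_span_pair.2 ⟨-(a y z)⁻¹ * a z x, -(a y z)⁻¹ * a x y, ?_⟩)
  have h2 : x = (a y z)⁻¹ • (a y z • x) := by rw [smul_smul, inv_mul_cancel₀ h0, one_smul]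
  have h3 : a y z • x = -(a z x • y + a x y • z) := by
    rw [eq_neg_iff_add_eq_zero, ← add_assoc]; exact h1
  refine Eq.symm (h2.trans ?_)
  rw [h3]
  module

/-- A quadratic map with `β(x, x)` proportional to `x` for all `x` has the form `k(x) x` with `k`
linear. -/
lemma exists_linear_of_apply_self {β : E →L[ℝ] E →L[ℝ] E}
    (h : ∀ x, ∃ c : ℝ, β x x = c • x) : ∃ k : E →ₗ[ℝ] ℝ, ∀ x, β x x = k x • x := by
  classical
  choose c hc using h
  set k : E → ℝ := fun x => if x = 0 then 0 else c x with hk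
  have hkx : ∀ x, β x x = k x • x := fun x => by
    by_cases hx : x = 0
    · simp [hx]
    · simp [hk, hx, hc x]
  have hsmul : ∀ (r : ℝ) x, k (r • x) = r * k x := by
    intro r x
    by_cases hx : x = 0
    · simp [hk, hx]
    by_cases hr : r = 0
    · simp [hk, hr]
    have h1 := hkx (r • x)
    simp only [map_smul, smul_apply, hkx x, smul_smul] at h1
    have h2 : r * (r * k x) = k (r • x) * r := smul_left_injective ℝ hx h1
    have h3 : r * (k (r • x) - r * k x) = 0 := by
      linarith
    rcases mul_eq_zero.1 h3 with h | h
    · exact absurd h hr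
    · linarith
  refine ⟨{ toFun := k, map_add' := fun x y => ?_, map_smul' := by simpa using hsmul }, hkx⟩
  by_cases hli : LinearIndependent ℝ ![x, y]
  · have h1 := hkx (x + y)
    have h2 := hkx (x - y)
    simp only [map_add, map_sub, add_apply, sub_apply, hkx x, hkx y] at h1 h2
    rw [LinearIndependent.pair_iff] at hli
    have h3 : (k (x + y) + k (x - y) - 2 * k x) • x
        + (k (x + y) - k (x - y) - 2 * k y) • y = 0 := by
      have e : (k (x + y) + k (x - y) - 2 * k x) • x + (k (x + y) - k (x - y) - 2 * k y) • y
        = k (x + y) • (x + y) + k (x - y) • (x - y) - (2 * k x) • x - (2 * k y) • y := by module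
      rw [e, ← h1, ← h2]
      module
    obtain ⟨h4, h5⟩ := hli _ _ h3
    linarith
  · have : ∃ (a b : ℝ) (z : E), x = a • z ∧ y = b • z := by
      by_cases hx : x = 0
      · exact ⟨0, 1, y, by simp [hx], by simp⟩
      · rw [LinearIndependent.pair_iff' hx] at hli
        push Not at hli
        obtain ⟨a, ha⟩ := hli
        exact ⟨1, a, x, by simp, ha.symm⟩
    obtain ⟨a, b, z, rfl, rfl⟩ := this
    rw [← add_smul, hsmul, hsmul, hsmul]
    ring

include halt hnd in
/-- The algebraic part of the second Bianchi identity for connections of Ricci type: it determines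
the covariant derivative `β(v, y) = (∇_v S) y` of the Ricci endomorphism up to one vector. -/
lemma exists_vector_of_bianchi [FiniteDimensional ℝ E] (hd : 3 ≤ Module.finrank ℝ E)
    {β : E →L[ℝ] E →L[ℝ] E}
    (hsymm : ∀ v y z, w (β v y) z = w (β v z) y)
    (hB : ∀ x y v z,
      w x y * w (β v z) z + w y v * w (β x z) z + w v x * w (β y z) z
        + w x z * (w (β v y) z - w (β y v) z) + w y z * (w (β x v) z - w (β v x) z)
        + w v z * (w (β y x) z - w (β x y) z) = 0) :
    ∃ U, ∀ v y, β v y = -(w U y) • v - w v y • U := by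
  have hanti := eq_neg_of_alternating halt
  -- the value on equal arguments vanishes
  have h3 : ∀ x, w (β x x) x = 0 := by
    intro x
    by_cases hx : x = 0
    · simp [hx]
    obtain ⟨y, v, hxy, hxv, hyv⟩ := exists_orthogonal_pair hnd hd hx
    have h1 := hB x y v x
    have h2 := hanti v x
    have h4 := hanti y x
    rw [h2, h4, hxy, hxv, halt] at h1
    have : w y v * w (β x x) x = 0 := by linarith
    exact (mul_eq_zero.1 this).resolve_left hyv
  -- polarization
  have hpol : ∀ x v, w (β v x) x = -2 * w (β x x) v := by
    intro x v
    have e1 := h3 (x + v)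
    have e2 := h3 (x - v)
    have e3 := hsymm x v x
    have e5 := hsymm v v x
    simp only [map_add, map_sub, add_apply, sub_apply, h3] at e1 e2
    linarith
  have hpar : ∀ x, ∃ c : ℝ, β x x = c • x := by
    intro x
    by_cases hx : x = 0
    · exact ⟨0, by simp [hx]⟩
    obtain ⟨y, hy⟩ := exists_form_eq_one hnd hx
    refine ⟨w (β x x) y, eq_of_forall_form_eq hnd fun v => ?_⟩
    have h1 := hB x y v x
    have e1 := hpol x v
    have e2 := hpol x y
    have e3 := hsymm x v x
    have e4 := hsymm x y x
    have e5 := hanti v x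
    have e6 := hanti y x
    rw [e5, e6, hy, h3, halt] at h1
    simp only [map_smul, smul_apply, smul_eq_mul]
    rw [e1, e2, e3, e4] at h1
    linarith
  obtain ⟨k, hk⟩ := exists_linear_of_apply_self hpar
  obtain ⟨U, hU⟩ := (form_bijective hnd).2 (LinearMap.toContinuousLinearMap (-k))
  have hUk : ∀ x, w U x = - k x := fun x => by rw [hU]; simp
  have hsum : ∀ x y, β x y + β y x = k x • y + k y • x := by
    intro x y
    have h1 := hk (x + y)
    simp only [map_add, add_apply, hk x, hk y] at h1
    have : β x y + β y x = (k x • x + β y x + (β x y + k y • y)) - k x • x - k y • y := by abel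
    rw [this, h1]
    module
  refine ⟨U, fun v y => eq_of_forall_form_eq hnd fun z => ?_⟩
  have s1 := congrArg (fun x => w x z) (hsum v y)
  have s2 := congrArg (fun x => w x v) (hsum y z)
  have s3 := congrArg (fun x => w x y) (hsum v z)
  simp only [map_add, map_smul, add_apply, smul_apply, smul_eq_mul] at s1 s2 s3
  simp only [map_sub, map_smul, neg_smul, map_neg, sub_apply, neg_apply, smul_apply, smul_eq_mul,
    hUk]
  have t1 := hsymm v y z
  have t2 := hsymm y v z
  have t3 := hsymm z v y
  have a1 := hanti z y
  have a2 := hanti z v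
  have a3 := hanti y v
  rw [a2, a3] at s2
  rw [a1] at s3
  linarith

include halt hnd in
/-- The algebraic part of the Ricci identity for the Ricci endomorphism. -/
lemma exists_scalar_of_ricci_identity (hd : 3 ≤ Module.finrank ℝ E) {N : E →L[ℝ] E}
    (h : ∀ x y z, -(w (N x) z) • y - w y z • N x + w (N y) z • x + w x z • N y = 0) :
    ∃ f : ℝ, ∀ x, N x = -f • x := by
  have hanti := eq_neg_of_alternating halt
  have hev : ∀ x, ∃ c : ℝ, N x = c • x := by
    intro x
    by_cases hx : x = 0
    · exact ⟨0, by simp [hx]⟩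
    have h0 : w (N x) x = 0 := by
      obtain ⟨y, hy, hyx⟩ := exists_orthogonal_notMem_span hnd hd hx
      have h1 := h x y x
      rw [hanti y x, hy, halt] at h1
      by_contra h0
      refine hyx ((w (N x) x)⁻¹ * w (N y) x) ?_
      have h2 : y = (w (N x) x)⁻¹ • (w (N x) x • y) := by
        rw [smul_smul, inv_mul_cancel₀ h0, one_smul]
      have h3 : w (N x) x • y = w (N y) x • x := by
        have : w (N x) x • y = w (N y) x • x - (-(w (N x) x) • y - (-(0 : ℝ)) • N x
          + w (N y) x • x + (0 : ℝ) • N y) := by module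
        rw [this, h1, sub_zero]
      exact h2.trans (by rw [h3, smul_smul])
    obtain ⟨y, hy⟩ := exists_form_eq_one hnd hx
    have h1 := h x y x
    rw [h0, halt, hanti y x, hy] at h1
    refine ⟨-(w (N y) x), ?_⟩
    have : N x = -(w (N y) x) • x + (-(0 : ℝ) • y - -(1 : ℝ) • N x + w (N y) x • x
      + (0 : ℝ) • N y) := by module
    rw [this, h1, add_zero]
  obtain ⟨a, ha⟩ := LinearMap.exists_eq_smul_id_of_forall_notLinearIndependent
    (f := (N : E →ₗ[ℝ] E)) (fun v => by
      obtain ⟨c, hc⟩ := hev v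
      rw [LinearIndependent.pair_iff]
      push Not
      exact ⟨c, -1, by simp [hc], fun _ => by norm_num⟩)
  refine ⟨-a, fun x => ?_⟩
  have := congrArg (fun T : E →ₗ[ℝ] E => T x) ha
  simpa using this

lemma eq_zero_of_smul_eq_smul (hd : 3 ≤ Module.finrank ℝ E) {g : E → ℝ}
    (h : ∀ x y, g y • x = g x • y) (x : E) : g x = 0 := by
  obtain ⟨y, hy⟩ := exists_notMem_span_pair hd x x
  by_contra h0
  refine hy (Submodule.mem_span_pair.2 ⟨(g x)⁻¹ * g y, 0, ?_⟩)
  rw [zero_smul, add_zero, mul_smul, h x y, smul_smul, inv_mul_cancel₀ h0, one_smul]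

end LinearAlgebra

/-! ### Connections of Ricci type in a chart -/

section Chart

variable {E : Type} [NormedAddCommGroup E] [NormedSpace ℝ E]

/-- The curvature `R(u, v)` at `x` of the connection with Christoffel symbols `Γ` on an open subset
of a vector space. -/
def chartCurv (Γ : E → E →L[ℝ] E →L[ℝ] E) (x u v : E) : E →L[ℝ] E :=
  fderiv ℝ Γ x u v - fderiv ℝ Γ x v u + Γ x u ∘L Γ x v - Γ x v ∘L Γ x u

/-- The map `z ↦ R(u, z) v`, whose trace is the Ricci tensor. -/
def chartCurvMap (Γ : E → E →L[ℝ] E →L[ℝ] E) (x u v : E) : E →L[ℝ] E :=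
  (fderiv ℝ Γ x u).flip v - ((fderiv ℝ Γ x).flip u).flip v + Γ x u ∘L (Γ x).flip v
    - (Γ x).flip (Γ x u v)

lemma chartCurvMap_apply (Γ : E → E →L[ℝ] E →L[ℝ] E) (x u v z : E) :
    chartCurvMap Γ x u v z = chartCurv Γ x u z v := rfl

/-- The Ricci tensor `r(u, v)` of the connection with Christoffel symbols `Γ`. -/
def chartRicci (Γ : E → E →L[ℝ] E →L[ℝ] E) (x u v : E) : ℝ :=
  LinearMap.trace ℝ E (chartCurvMap Γ x u v : E →ₗ[ℝ] E)

/-- A symplectic connection on an open subset `V` of a vector space: a non-degenerate 2-form `w` and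
symmetric Christoffel symbols `Γ` for which `w` is parallel. -/
structure IsSymplecticChart (V : Set E) (Γ : E → E →L[ℝ] E →L[ℝ] E)
    (w : E → E →L[ℝ] E →L[ℝ] ℝ) : Prop where
  isOpen : IsOpen V
  smooth_Γ : ContDiffOn ℝ ∞ Γ V
  smooth_w : ContDiffOn ℝ ∞ w V
  alternating : ∀ x ∈ V, ∀ u, w x u u = 0
  nondegenerate : ∀ x ∈ V, ∀ u, (∀ v, w x u v = 0) → u = 0
  symm : ∀ x ∈ V, ∀ u v, Γ x u v = Γ x v u
  parallel : ∀ x ∈ V, ∀ u v z, fderiv ℝ w x u v z = w x (Γ x u v) z + w x v (Γ x u z)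

/-- The connection is of Ricci type. -/
def IsRicciTypeChart (n : ℕ) (V : Set E) (Γ : E → E →L[ℝ] E →L[ℝ] E)
    (w : E → E →L[ℝ] E →L[ℝ] ℝ) : Prop :=
  ∀ x ∈ V, ∀ u v y z, w x (chartCurv Γ x u v y) z = -(1 / (2 * ((n : ℝ) + 1))) *
    (2 * w x u v * chartRicci Γ x y z + w x u y * chartRicci Γ x v z
      + w x u z * chartRicci Γ x v y - w x v y * chartRicci Γ x u z
      - w x v z * chartRicci Γ x u y)

/-- The curvature tensor of Ricci type built from an endomorphism `S`. -/
def ricciTypeCurv (b : E →L[ℝ] E →L[ℝ] ℝ) (S : E →L[ℝ] E) (u v z : E) : E :=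
  -(2 * b u v) • S z - b (S v) z • u + b v z • S u + b (S u) z • v - b u z • S v

/-- The covariant derivative of an endomorphism field. -/
def covEnd [FiniteDimensional ℝ E] (Γ : E → E →L[ℝ] E →L[ℝ] E) (S : E → E →L[ℝ] E) (x : E) :
    E →L[ℝ] E →L[ℝ] E :=
  (LinearMap.mk₂ ℝ (fun u v => fderiv ℝ S x u v + Γ x u (S x v) - S x (Γ x u v))
    (by intros; simp only [map_add, add_apply]; abel)
    (by intros; simp only [map_smul, smul_apply]; module)
    (by intros; simp only [map_add]; abel)
    (by intros; simp only [map_smul]; module)).toContinuousBilinearMap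

lemma covEnd_apply [FiniteDimensional ℝ E] (Γ : E → E →L[ℝ] E →L[ℝ] E) (S : E → E →L[ℝ] E)
    (x u v : E) : covEnd Γ S x u v = fderiv ℝ S x u v + Γ x u (S x v) - S x (Γ x u v) := rfl

lemma hasDerivAt_line {G : Type*} [NormedAddCommGroup G] [NormedSpace ℝ G] {g : E → G} {x : E}
    (hg : DifferentiableAt ℝ g x) (u : E) :
    HasDerivAt (fun t : ℝ => g (x + t • u)) (fderiv ℝ g x u) 0 :=
  hg.hasFDerivAt.hasLineDerivAt u

lemma hasDerivAt_line_congr {G : Type*} [NormedAddCommGroup G] [NormedSpace ℝ G] {V : Set E}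
    (hV : IsOpen V) {g h : E → G} (hgh : ∀ y ∈ V, g y = h y) {x : E} (hx : x ∈ V) {u : E} {a b : G}
    (hg : HasDerivAt (fun t : ℝ => g (x + t • u)) a 0)
    (hh : HasDerivAt (fun t : ℝ => h (x + t • u)) b 0) : a = b := by
  refine hg.unique (hh.congr_of_eventuallyEq ?_)
  have : ContinuousAt (fun t : ℝ => x + t • u) 0 := by fun_prop
  have h2 : V ∈ 𝓝 (x + (0 : ℝ) • u) := by simpa using hV.mem_nhds hx
  filter_upwards [this.preimage_mem_nhds h2] with t ht using hgh _ ht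

variable {V : Set E} {Γ : E → E →L[ℝ] E →L[ℝ] E} {w : E → E →L[ℝ] E →L[ℝ] ℝ}

lemma differentiableAt_of_smoothOn {G : Type*} [NormedAddCommGroup G] [NormedSpace ℝ G]
    (hV : IsOpen V) {g : E → G} (hg : ContDiffOn ℝ ∞ g V) {x : E} (hx : x ∈ V) :
    DifferentiableAt ℝ g x :=
  (hg.contDiffAt (hV.mem_nhds hx)).differentiableAt (by simp)

lemma smoothOn_fderiv {G : Type*} [NormedAddCommGroup G] [NormedSpace ℝ G]
    (hV : IsOpen V) {g : E → G} (hg : ContDiffOn ℝ ∞ g V) : ContDiffOn ℝ ∞ (fderiv ℝ g) V :=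
  hg.fderiv_of_isOpen hV (by simp)

lemma fderiv_fderiv_symm {G : Type*} [NormedAddCommGroup G] [NormedSpace ℝ G]
    (hV : IsOpen V) {g : E → G} (hg : ContDiffOn ℝ ∞ g V) {x : E} (hx : x ∈ V) (u v : E) :
    fderiv ℝ (fderiv ℝ g) x u v = fderiv ℝ (fderiv ℝ g) x v u :=
  ((contDiffOn_infty.1 hg 2).contDiffAt (hV.mem_nhds hx)).isSymmSndFDerivAt (by simp) u v

/-- The first Bianchi identity. -/
lemma chartCurv_cyclic (hV : IsOpen V) (hΓ : ContDiffOn ℝ ∞ Γ V)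
    (hs : ∀ x ∈ V, ∀ u v, Γ x u v = Γ x v u) {x : E} (hx : x ∈ V) (u v z : E) :
    chartCurv Γ x u v z + chartCurv Γ x v z u + chartCurv Γ x z u v = 0 := by
  have hD : ∀ a b c, fderiv ℝ Γ x a b c = fderiv ℝ Γ x a c b := by
    intro a b c
    have h1 := hasDerivAt_line (differentiableAt_of_smoothOn hV hΓ hx) a
    have h2 := (h1.clm_apply (hasDerivAt_const 0 b)).clm_apply (hasDerivAt_const 0 c)
    have h3 := (h1.clm_apply (hasDerivAt_const 0 c)).clm_apply (hasDerivAt_const 0 b)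
    simpa using hasDerivAt_line_congr (g := fun y => Γ y b c) (h := fun y => Γ y c b) hV
      (fun y hy => hs y hy b c) hx h2 h3
  simp only [chartCurv, add_apply, sub_apply, ContinuousLinearMap.comp_apply]
  rw [hD u v z, hD v z u, hD z u v, hs x hx v z, hs x hx z u, hs x hx u v]
  abel

/-- The second Bianchi identity. -/
lemma fderiv_chartCurv_cyclic (hV : IsOpen V) (hΓ : ContDiffOn ℝ ∞ Γ V) {x : E} (hx : x ∈ V)
    (u v z : E) :
    (fderiv ℝ (fun y => chartCurv Γ y v z) x u + Γ x u ∘L chartCurv Γ x v z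
        - chartCurv Γ x v z ∘L Γ x u)
      + (fderiv ℝ (fun y => chartCurv Γ y z u) x v + Γ x v ∘L chartCurv Γ x z u
        - chartCurv Γ x z u ∘L Γ x v)
      + (fderiv ℝ (fun y => chartCurv Γ y u v) x z + Γ x z ∘L chartCurv Γ x u v
        - chartCurv Γ x u v ∘L Γ x z) = 0 := by
  have hD2 := fderiv_fderiv_symm hV hΓ hx
  have key : ∀ a b c, fderiv ℝ (fun y => chartCurv Γ y b c) x a
      = fderiv ℝ (fderiv ℝ Γ) x a b c - fderiv ℝ (fderiv ℝ Γ) x a c b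
        + (fderiv ℝ Γ x a b ∘L Γ x c + Γ x b ∘L fderiv ℝ Γ x a c)
        - (fderiv ℝ Γ x a c ∘L Γ x b + Γ x c ∘L fderiv ℝ Γ x a b) := by
    intro a b c
    have hd := (differentiableAt_of_smoothOn hV hΓ hx).hasFDerivAt
    have hd1 := (differentiableAt_of_smoothOn hV (smoothOn_fderiv hV hΓ) hx).hasFDerivAt
    have hb := hd.clm_apply (hasFDerivAt_const b x)
    have hc := hd.clm_apply (hasFDerivAt_const c x)
    have h1 := ((hd1.clm_apply (hasFDerivAt_const b x)).clm_apply (hasFDerivAt_const c x)).sub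
      ((hd1.clm_apply (hasFDerivAt_const c x)).clm_apply (hasFDerivAt_const b x))
    have h2 := ((h1.add (hb.clm_comp hc)).sub (hc.clm_comp hb)).fderiv
    have h3 := congrArg (fun T => T a) h2
    refine h3.trans ?_
    ext y
    simp
    abel
  rw [key, key, key, hD2 u v, hD2 v z, hD2 z u]
  ext y
  simp only [chartCurv, add_apply, sub_apply, ContinuousLinearMap.comp_apply, map_add, map_sub,
    zero_apply]
  abel

variable [FiniteDimensional ℝ E]

lemma contDiffOn_clm₂ {G : Type*} [NormedAddCommGroup G] [NormedSpace ℝ G]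
    {g : E → E →L[ℝ] E →L[ℝ] G} (h : ∀ u v, ContDiffOn ℝ ∞ (fun x => g x u v) V) :
    ContDiffOn ℝ ∞ g V :=
  contDiffOn_clm_apply.2 fun u => contDiffOn_clm_apply.2 fun v => h u v

lemma contDiffOn_covEnd (hV : IsOpen V) (hΓ : ContDiffOn ℝ ∞ Γ V) {S : E → E →L[ℝ] E}
    (hS : ContDiffOn ℝ ∞ S V) : ContDiffOn ℝ ∞ (covEnd Γ S) V := by
  refine contDiffOn_clm₂ fun u v => ?_
  have h1 := ((smoothOn_fderiv hV hS).clm_apply (contDiffOn_const (c := u))).clm_apply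
    (contDiffOn_const (c := v))
  have hΓu := hΓ.clm_apply (contDiffOn_const (c := u))
  exact (h1.add (hΓu.clm_apply (hS.clm_apply contDiffOn_const))).sub
    (hS.clm_apply (hΓu.clm_apply contDiffOn_const))

lemma inverse_form_apply {b : E →L[ℝ] E →L[ℝ] ℝ} (hb : ∀ u, (∀ v, b u v = 0) → u = 0)
    (l : E →L[ℝ] ℝ) : b (b.inverse l) = l := by
  let e : E ≃L[ℝ] (E →L[ℝ] ℝ) :=
    (LinearEquiv.ofBijective (b : E →ₗ[ℝ] (E →L[ℝ] ℝ)) (form_bijective hb)).toContinuousLinearEquiv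
  have he : (e : E →L[ℝ] (E →L[ℝ] ℝ)) = b := by ext; rfl
  rw [← he, ContinuousLinearMap.inverse_equiv]
  simp

lemma contDiffOn_inverse_form (hV : IsOpen V) (hw : ContDiffOn ℝ ∞ w V)
    (hnd : ∀ x ∈ V, ∀ u, (∀ v, w x u v = 0) → u = 0) :
    ContDiffOn ℝ ∞ (fun x => (w x).inverse) V := by
  intro x hx
  let e : E ≃L[ℝ] (E →L[ℝ] ℝ) :=
    (LinearEquiv.ofBijective (w x : E →ₗ[ℝ] (E →L[ℝ] ℝ))
      (form_bijective (hnd x hx))).toContinuousLinearEquiv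
  have he : (e : E →L[ℝ] (E →L[ℝ] ℝ)) = w x := by ext; rfl
  have h1 : ContDiffAt ℝ ∞ ContinuousLinearMap.inverse (w x) := he ▸ contDiffAt_map_inverse e
  exact (h1.comp x (hw.contDiffAt (hV.mem_nhds hx))).contDiffWithinAt

variable (E) in
/-- The trace as a continuous linear map. -/
def traceL : (E →L[ℝ] E) →L[ℝ] ℝ :=
  LinearMap.toContinuousLinearMap ((LinearMap.trace ℝ E) ∘ₗ ContinuousLinearMap.coeLM ℝ)

lemma traceL_apply (T : E →L[ℝ] E) : traceL E T = LinearMap.trace ℝ E (T : E →ₗ[ℝ] E) := rfl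

/-- The Ricci tensor as a bilinear form. -/
def chartRicciL (Γ : E → E →L[ℝ] E →L[ℝ] E) (x : E) : E →L[ℝ] E →L[ℝ] ℝ :=
  (LinearMap.mk₂ ℝ (fun u v => traceL E (chartCurvMap Γ x u v))
    (by
      intros
      rw [← map_add]
      congr 1
      ext
      simp only [chartCurvMap_apply, chartCurv, map_add, add_apply, sub_apply,
        ContinuousLinearMap.comp_apply]
      abel)
    (by
      intros
      rw [← map_smul]
      congr 1
      ext
      simp only [chartCurvMap_apply, chartCurv, map_smul, add_apply, sub_apply, smul_apply,
        ContinuousLinearMap.comp_apply]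
      module)
    (by
      intros
      rw [← map_add]
      congr 1
      ext
      simp only [chartCurvMap_apply, map_add, add_apply])
    (by
      intros
      rw [← map_smul]
      congr 1
      ext
      simp only [chartCurvMap_apply, map_smul, smul_apply])).toContinuousBilinearMap

lemma contDiffOn_chartRicciL (hV : IsOpen V) (hΓ : ContDiffOn ℝ ∞ Γ V) :
    ContDiffOn ℝ ∞ (chartRicciL Γ) V := by
  refine contDiffOn_clm₂ fun u v => ?_
  refine (traceL E).contDiff.comp_contDiffOn (contDiffOn_clm_apply.2 fun z => ?_)
  have hd : ∀ a b c : E, ContDiffOn ℝ ∞ (fun x => fderiv ℝ Γ x a b c) V := fun a b c =>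
    (((smoothOn_fderiv hV hΓ).clm_apply contDiffOn_const).clm_apply contDiffOn_const).clm_apply
      contDiffOn_const
  have h2 : ∀ a b c : E, ContDiffOn ℝ ∞ (fun x => Γ x a (Γ x b c)) V := fun a b c =>
    (hΓ.clm_apply contDiffOn_const).clm_apply
      ((hΓ.clm_apply contDiffOn_const).clm_apply contDiffOn_const)
  exact (((hd u z v).sub (hd z u v)).add (h2 u z v)).sub (h2 z u v)

end Chart

section ChartCurvature

variable {E : Type} [NormedAddCommGroup E] [NormedSpace ℝ E]

/-- The covariant derivative `∇_Y Z` of vector fields on a vector space, for the connection with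
Christoffel symbols `Γ`. -/
def chartCov (Γ : E → E →L[ℝ] E →L[ℝ] E) (Y Z : E → E) (x : E) : E :=
  fderiv ℝ Z x (Y x) + Γ x (Y x) (Z x)

lemma fderiv_chartCov {Γ : E → E →L[ℝ] E →L[ℝ] E} {Y Z : E → E} {x : E}
    (hΓ : DifferentiableAt ℝ Γ x) (hY : ContDiffAt ℝ ∞ Y x) (hZ : ContDiffAt ℝ ∞ Z x) (h : E) :
    fderiv ℝ (chartCov Γ Y Z) x h = fderiv ℝ (fderiv ℝ Z) x h (Y x) + fderiv ℝ Z x (fderiv ℝ Y x h)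
      + (fderiv ℝ Γ x h (Y x) (Z x) + Γ x (fderiv ℝ Y x h) (Z x) + Γ x (Y x) (fderiv ℝ Z x h)) := by
  have hY' := (hY.differentiableAt (by simp)).hasFDerivAt
  have hZ' := (hZ.differentiableAt (by simp)).hasFDerivAt
  have hdZ : HasFDerivAt (fderiv ℝ Z) _ x :=
    ((hZ.fderiv_right (m := ∞) (by simp)).differentiableAt (by simp)).hasFDerivAt
  have h1 : HasFDerivAt (chartCov Γ Y Z) _ x :=
    (hdZ.clm_apply hY').add ((hΓ.hasFDerivAt.clm_apply hY').clm_apply hZ')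
  rw [h1.fderiv]
  simp only [add_apply, ContinuousLinearMap.comp_apply, ContinuousLinearMap.flip_apply]
  abel

/-- The curvature as the commutator of covariant derivatives, for arbitrary vector fields of an open
subset of a vector space. -/
lemma chartCov_commutator {Γ : E → E →L[ℝ] E →L[ℝ] E} {X Y Z : E → E} {x : E}
    (hΓ : DifferentiableAt ℝ Γ x) (hX : ContDiffAt ℝ ∞ X x) (hY : ContDiffAt ℝ ∞ Y x)
    (hZ : ContDiffAt ℝ ∞ Z x) :
    chartCov Γ X (chartCov Γ Y Z) x - chartCov Γ Y (chartCov Γ X Z) x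
      - chartCov Γ (fun y => fderiv ℝ Y y (X y) - fderiv ℝ X y (Y y)) Z x
      = chartCurv Γ x (X x) (Y x) (Z x) := by
  have hs : fderiv ℝ (fderiv ℝ Z) x (X x) (Y x) = fderiv ℝ (fderiv ℝ Z) x (Y x) (X x) :=
    (contDiffAt_infty.1 hZ 2).isSymmSndFDerivAt (by simp) _ _
  have e1 : chartCov Γ X (chartCov Γ Y Z) x = _ + _ := rfl
  have e2 : chartCov Γ Y (chartCov Γ X Z) x = _ + _ := rfl
  rw [e1, e2, fderiv_chartCov hΓ hY hZ, fderiv_chartCov hΓ hX hZ, hs]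
  simp only [chartCov, chartCurv, add_apply, sub_apply, ContinuousLinearMap.comp_apply, map_add,
    map_sub]
  abel

end ChartCurvature

section Chart

variable {E : Type} [NormedAddCommGroup E] [NormedSpace ℝ E] {V : Set E}
  {Γ : E → E →L[ℝ] E →L[ℝ] E} {w : E → E →L[ℝ] E →L[ℝ] ℝ}

/-- The Ricci tensor of a Ricci type connection is symmetric; since the connection has no torsion,
this is forced by the first Bianchi identity in dimension at least three. -/
lemma chartRicci_symm {n : ℕ} (hd : 3 ≤ Module.finrank ℝ E) (hs : IsSymplecticChart V Γ w)
    (hr : IsRicciTypeChart n V Γ w) {x : E} (hx : x ∈ V) (u v : E) :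
    chartRicci Γ x u v = chartRicci Γ x v u := by
  have hanti := eq_neg_of_alternating (hs.alternating x hx)
  have := eq_zero_of_cyclic_form (a := fun u v => chartRicci Γ x u v - chartRicci Γ x v u) hd
    (hs.nondegenerate x hx) (fun a b c t => by
      have h1 := congrArg (fun z => w x z t)
        (chartCurv_cyclic hs.isOpen hs.smooth_Γ hs.symm hx a b c)
      simp only [map_add, add_apply, map_zero, zero_apply] at h1
      rw [hr x hx a b c t, hr x hx b c a t, hr x hx c a b t, hanti b a, hanti c b, hanti c a] at h1
      have h2 : (1 / (2 * ((n : ℝ) + 1))) ≠ 0 := by positivity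
      have h3 : (1 / (2 * ((n : ℝ) + 1))) *
        (w x a t * (chartRicci Γ x b c - chartRicci Γ x c b)
          + w x b t * (chartRicci Γ x c a - chartRicci Γ x a c)
          + w x c t * (chartRicci Γ x a b - chartRicci Γ x b a)) = 0 := by
        linear_combination -h1
      exact (mul_eq_zero.1 h3).resolve_left h2) u v
  linarith

variable [FiniteDimensional ℝ E]

/-- The endomorphism `S` with `2(n+1) w(S u, v) = r(u, v)`. -/
lemma exists_ricci_endomorphism {n : ℕ} (hd : 3 ≤ Module.finrank ℝ E)
    (hs : IsSymplecticChart V Γ w) (hr : IsRicciTypeChart n V Γ w) :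
    ∃ S : E → E →L[ℝ] E, ContDiffOn ℝ ∞ S V ∧ (∀ x ∈ V, ∀ u v, w x (S x u) v = w x (S x v) u) ∧
      ∀ x ∈ V, ∀ u v z, chartCurv Γ x u v z = ricciTypeCurv (w x) (S x) u v z := by
  have hSw : ∀ x ∈ V, ∀ u v, w x ((w x).inverse ((1 / (2 * ((n : ℝ) + 1))) • chartRicciL Γ x u)) v
      = (1 / (2 * ((n : ℝ) + 1))) * chartRicci Γ x u v := by
    intro x hx u v
    rw [inverse_form_apply (hs.nondegenerate x hx)]
    rfl
  refine ⟨fun x => (w x).inverse ∘L ((1 / (2 * ((n : ℝ) + 1))) • chartRicciL Γ x), ?_, ?_, ?_⟩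
  · exact (contDiffOn_inverse_form hs.isOpen hs.smooth_w hs.nondegenerate).clm_comp
      ((contDiffOn_chartRicciL hs.isOpen hs.smooth_Γ).const_smul (1 / (2 * ((n : ℝ) + 1))))
  · intro x hx u v
    refine (hSw x hx u v).trans (Eq.trans ?_ (hSw x hx v u).symm)
    rw [chartRicci_symm hd hs hr hx]
  · intro x hx u v z
    refine eq_of_forall_form_eq (hs.nondegenerate x hx) fun t => ?_
    have hanti := eq_neg_of_alternating (hs.alternating x hx)
    have hS : ∀ a b, w x (((w x).inverse ∘L ((1 / (2 * ((n : ℝ) + 1))) • chartRicciL Γ x)) a) b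
      = (1 / (2 * ((n : ℝ) + 1))) * chartRicci Γ x a b := hSw x hx
    simp only [ricciTypeCurv, map_add, map_sub, map_smul, add_apply, sub_apply, smul_apply,
      smul_eq_mul, hS]
    rw [hr x hx u v z t]
    ring

variable {S : E → E →L[ℝ] E}

/-- The symmetry of `w(S ·, ·)` is inherited by the covariant derivative `∇S`, because `w` is
parallel. -/
lemma form_covEnd_symm (hs : IsSymplecticChart V Γ w) (hS : ContDiffOn ℝ ∞ S V)
    (hSs : ∀ x ∈ V, ∀ u v, w x (S x u) v = w x (S x v) u) {x : E} (hx : x ∈ V) (u v z : E) :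
    w x (covEnd Γ S x u v) z = w x (covEnd Γ S x u z) v := by
  have hw := hasDerivAt_line (differentiableAt_of_smoothOn hs.isOpen hs.smooth_w hx) u
  have hSd := hasDerivAt_line (differentiableAt_of_smoothOn hs.isOpen hS hx) u
  have hc : ∀ a b, HasDerivAt (fun t : ℝ => w (x + t • u) (S (x + t • u) a) b) _ 0 := fun a b =>
    (hw.clm_apply (hSd.clm_apply (hasDerivAt_const 0 a))).clm_apply (hasDerivAt_const 0 b)
  have h := hasDerivAt_line_congr (g := fun y => w y (S y v) z) (h := fun y => w y (S y z) v)
    hs.isOpen (fun y hy => hSs y hy v z) hx (hc v z) (hc z v)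
  simp only [zero_smul, add_zero, map_zero, add_apply, hs.parallel x hx] at h
  have hanti := eq_neg_of_alternating (hs.alternating x hx)
  simp only [covEnd_apply, map_add, map_sub, add_apply, sub_apply]
  have e1 := hSs x hx (Γ x u v) z
  have e2 := hSs x hx (Γ x u z) v
  linarith

/-- The second Bianchi identity, in terms of the Ricci endomorphism. -/
lemma covEnd_cyclic (hs : IsSymplecticChart V Γ w) (hS : ContDiffOn ℝ ∞ S V)
    (hR : ∀ x ∈ V, ∀ u v z, chartCurv Γ x u v z = ricciTypeCurv (w x) (S x) u v z)
    {x : E} (hx : x ∈ V) (u v y z : E) :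
    (-(2 * w x v y) • covEnd Γ S x u z - w x (covEnd Γ S x u y) z • v
        + w x y z • covEnd Γ S x u v + w x (covEnd Γ S x u v) z • y
        - w x v z • covEnd Γ S x u y)
      + (-(2 * w x y u) • covEnd Γ S x v z - w x (covEnd Γ S x v u) z • y
        + w x u z • covEnd Γ S x v y + w x (covEnd Γ S x v y) z • u
        - w x y z • covEnd Γ S x v u)
      + (-(2 * w x u v) • covEnd Γ S x y z - w x (covEnd Γ S x y v) z • u
        + w x v z • covEnd Γ S x y u + w x (covEnd Γ S x y u) z • v
        - w x u z • covEnd Γ S x y v) = 0 := by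
  have hanti := eq_neg_of_alternating (hs.alternating x hx)
  have hDS : ∀ a b, fderiv ℝ S x a b = covEnd Γ S x a b - Γ x a (S x b) + S x (Γ x a b) :=
    fun a b => by rw [covEnd_apply]; abel
  have hKd : ∀ a b, DifferentiableAt ℝ (fun y => chartCurv Γ y a b) x := by
    intro a b
    have hd := differentiableAt_of_smoothOn hs.isOpen hs.smooth_Γ hx
    have hd1 := differentiableAt_of_smoothOn hs.isOpen (smoothOn_fderiv hs.isOpen hs.smooth_Γ) hx
    have ha := hd.clm_apply (differentiableAt_const a)
    have hb := hd.clm_apply (differentiableAt_const b)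
    exact ((((hd1.clm_apply (differentiableAt_const a)).clm_apply (differentiableAt_const b)).sub
      ((hd1.clm_apply (differentiableAt_const b)).clm_apply (differentiableAt_const a))).add
      (ha.clm_comp hb)).sub (hb.clm_comp ha)
  have key : ∀ a b c, fderiv ℝ (fun y => chartCurv Γ y b c) x a z
      = -(2 * (w x (Γ x a b) c + w x b (Γ x a c))) • S x z - (2 * w x b c) • fderiv ℝ S x a z
        - (w x (Γ x a (S x c)) z + w x (S x c) (Γ x a z) + w x (fderiv ℝ S x a c) z) • b
        + ((w x (Γ x a c) z + w x c (Γ x a z)) • S x b + w x c z • fderiv ℝ S x a b)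
        + (w x (Γ x a (S x b)) z + w x (S x b) (Γ x a z) + w x (fderiv ℝ S x a b) z) • c
        - ((w x (Γ x a b) z + w x b (Γ x a z)) • S x c + w x b z • fderiv ℝ S x a c) := by
    intro a b c
    have hw := hasDerivAt_line (differentiableAt_of_smoothOn hs.isOpen hs.smooth_w hx) a
    have hSd := hasDerivAt_line (differentiableAt_of_smoothOn hs.isOpen hS hx) a
    have hwc : ∀ p q, HasDerivAt (fun t : ℝ => w (x + t • a) p q) _ 0 := fun p q =>
      (hw.clm_apply (hasDerivAt_const 0 p)).clm_apply (hasDerivAt_const 0 q)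
    have hSc : ∀ p, HasDerivAt (fun t : ℝ => S (x + t • a) p) _ 0 := fun p =>
      hSd.clm_apply (hasDerivAt_const 0 p)
    have hwS : ∀ p q, HasDerivAt (fun t : ℝ => w (x + t • a) (S (x + t • a) p) q) _ 0 := fun p q =>
      (hw.clm_apply (hSc p)).clm_apply (hasDerivAt_const 0 q)
    have h1 : HasDerivAt (fun t : ℝ => chartCurv Γ (x + t • a) b c z) _ 0 :=
      (hasDerivAt_line (hKd b c) a).clm_apply (hasDerivAt_const 0 z)
    have h2 : HasDerivAt (fun t : ℝ => ricciTypeCurv (w (x + t • a)) (S (x + t • a)) b c z) _ 0 :=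
      ((((((hwc b c).const_mul 2).neg.smul (hSc z)).sub ((hwS c z).smul_const b)).add
        ((hwc c z).smul (hSc b))).add ((hwS b z).smul_const c)).sub ((hwc b z).smul (hSc c))
    have h3 := hasDerivAt_line_congr (g := fun y => chartCurv Γ y b c z)
      (h := fun y => ricciTypeCurv (w y) (S y) b c z)
      hs.isOpen (fun y hy => hR y hy b c z) hx h1 h2
    simp only [zero_smul, add_zero, map_zero, add_apply,
      hs.parallel x hx, Pi.neg_apply] at h3
    rw [h3]
    module
  have hB := congrArg (fun T : E →L[ℝ] E => T z)
    (fderiv_chartCurv_cyclic hs.isOpen hs.smooth_Γ hx u v y)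
  simp only [add_apply, sub_apply, ContinuousLinearMap.comp_apply, zero_apply, hR x hx, key,
    hDS] at hB
  rw [← hB]
  simp only [ricciTypeCurv, map_add, map_sub, map_smul, add_apply, sub_apply]
  rw [hs.symm x hx y u, hs.symm x hx y v, hs.symm x hx v u, hanti (Γ x u y) v,
    hanti (Γ x v y) u, hanti (Γ x u v) y]
  module

end Chart

section Chart

variable {E : Type} [NormedAddCommGroup E] [NormedSpace ℝ E] [FiniteDimensional ℝ E]
  {V : Set E} {Γ : E → E →L[ℝ] E →L[ℝ] E} {w : E → E →L[ℝ] E →L[ℝ] ℝ} {S : E → E →L[ℝ] E}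

/-- The differential consequences of Ricci type: the curvature is given by an endomorphism `S`, the
covariant derivative of `S` by a vector field `U`, that of `U` by a function `f`, and the
differential of `f` by `S` and `U` again, so that the system is closed. -/
structure IsRicciTypeData (V : Set E) (Γ : E → E →L[ℝ] E →L[ℝ] E) (w : E → E →L[ℝ] E →L[ℝ] ℝ)
    (S : E → E →L[ℝ] E) (U : E → E) (f : E → ℝ) : Prop extends IsSymplecticChart V Γ w where
  smooth_S : ContDiffOn ℝ ∞ S V
  smooth_U : ContDiffOn ℝ ∞ U V
  smooth_f : ContDiffOn ℝ ∞ f V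
  form_S : ∀ x ∈ V, ∀ u v, w x (S x u) v = w x (S x v) u
  curv : ∀ x ∈ V, ∀ u v z, chartCurv Γ x u v z = ricciTypeCurv (w x) (S x) u v z
  fderiv_S : ∀ x ∈ V, ∀ u v, fderiv ℝ S x u v
    = -(w x (U x) v) • u - w x u v • U x - Γ x u (S x v) + S x (Γ x u v)
  fderiv_U : ∀ x ∈ V, ∀ u, fderiv ℝ U x u = S x (S x u) - f x • u - Γ x u (U x)
  fderiv_f : ∀ x ∈ V, ∀ u, fderiv ℝ f x u = 2 * w x (U x) (S x u)

/-- The second Bianchi identity for a curvature of Ricci type forces `∇S` to be determined by a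
vector field `U`. Contracting the asserted formula shows that `w(U, ·)` must be a multiple of `X ↦
Tr(Y ↦ (∇_Y S) X)`, and this is how `U` is found. -/
lemma exists_vector_covEnd (hd : 3 ≤ Module.finrank ℝ E) (hs : IsSymplecticChart V Γ w)
    (hS : ContDiffOn ℝ ∞ S V) (hSs : ∀ x ∈ V, ∀ u v, w x (S x u) v = w x (S x v) u)
    (hR : ∀ x ∈ V, ∀ u v z, chartCurv Γ x u v z = ricciTypeCurv (w x) (S x) u v z) :
    ∃ U : E → E, ContDiffOn ℝ ∞ U V ∧ ∀ x ∈ V, ∀ u v,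
      covEnd Γ S x u v = -(w x (U x) v) • u - w x u v • U x := by
  set d : ℝ := (Module.finrank ℝ E : ℝ) with hdd
  refine ⟨fun x => (w x).inverse ((-(1 / (d + 1))) • (traceL E ∘L (covEnd Γ S x).flip)), ?_, ?_⟩
  · refine (contDiffOn_inverse_form hs.isOpen hs.smooth_w hs.nondegenerate).clm_apply
      (ContDiffOn.const_smul _ (contDiffOn_const.clm_comp ?_))
    exact (ContinuousLinearMap.flipₗᵢ ℝ E E E).contDiff.comp_contDiffOn
      (contDiffOn_covEnd hs.isOpen hs.smooth_Γ hS)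
  · intro x hx
    have hanti := eq_neg_of_alternating (hs.alternating x hx)
    obtain ⟨U, hU⟩ := exists_vector_of_bianchi (β := covEnd Γ S x) (hs.alternating x hx)
      (hs.nondegenerate x hx) hd (form_covEnd_symm hs hS hSs hx) (fun u y v z => by
        have h := congrArg (fun p => w x p z) (covEnd_cyclic hs hS hR hx u y v z)
        simp only [map_add, map_sub, map_smul, add_apply, sub_apply, smul_apply, smul_eq_mul,
          map_zero, zero_apply] at h
        linear_combination (-1 / 2) * h)
    have hUx : (w x).inverse ((-(1 / (d + 1))) • (traceL E ∘L (covEnd Γ S x).flip)) = U := by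
      refine eq_of_forall_form_eq (hs.nondegenerate x hx) fun y => ?_
      rw [inverse_form_apply (hs.nondegenerate x hx)]
      have h1 : (covEnd Γ S x).flip y = -(w x U y) • ContinuousLinearMap.id ℝ E
          - ((w x).flip y).smulRight U := by
        ext v
        simp [hU v y]
      have h2 : traceL E (((w x).flip y).smulRight U) = w x U y := by
        rw [traceL_apply]
        exact LinearMap.trace_smulRight _ _
      have h3 : traceL E (ContinuousLinearMap.id ℝ E) = d := LinearMap.trace_id ℝ E
      simp only [smul_apply, ContinuousLinearMap.comp_apply, h1, map_sub, map_smul, h2, h3,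
        smul_eq_mul]
      have : d + 1 ≠ 0 := by positivity
      field_simp
      ring
    intro u v
    simp only [hUx]
    exact hU u v

variable {U : E → E}

/-- The covariant derivative of `U`, up to the term `S²`. -/
lemma exists_scalar_fderiv (hd : 3 ≤ Module.finrank ℝ E) (hs : IsSymplecticChart V Γ w)
    (hS : ContDiffOn ℝ ∞ S V) (hU : ContDiffOn ℝ ∞ U V)
    (hR : ∀ x ∈ V, ∀ u v z, chartCurv Γ x u v z = ricciTypeCurv (w x) (S x) u v z)
    (hSs : ∀ x ∈ V, ∀ u v, w x (S x u) v = w x (S x v) u)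
    (hDS : ∀ x ∈ V, ∀ u v, fderiv ℝ S x u v
      = -(w x (U x) v) • u - w x u v • U x - Γ x u (S x v) + S x (Γ x u v)) :
    ∃ f : E → ℝ, ContDiffOn ℝ ∞ f V ∧ ∀ x ∈ V, ∀ u,
      fderiv ℝ U x u = S x (S x u) - f x • u - Γ x u (U x) := by
  set d : ℝ := (Module.finrank ℝ E : ℝ) with hdd
  set N : E → E →L[ℝ] E := fun x => fderiv ℝ U x + (Γ x).flip (U x) - S x ∘L S x with hN
  refine ⟨fun x => -(1 / d) * traceL E (N x), ?_, ?_⟩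
  · refine contDiffOn_const.mul ((traceL E).contDiff.comp_contDiffOn ?_)
    refine ((smoothOn_fderiv hs.isOpen hU).add ?_).sub (hS.clm_comp hS)
    exact ((ContinuousLinearMap.flipₗᵢ ℝ E E E).contDiff.comp_contDiffOn hs.smooth_Γ).clm_apply hU
  · intro x hx
    have hanti := eq_neg_of_alternating (hs.alternating x hx)
    have hNa : ∀ u, fderiv ℝ U x u = N x u - Γ x u (U x) + S x (S x u) := fun u => by
      simp only [hN, add_apply, sub_apply, ContinuousLinearMap.flip_apply,
        ContinuousLinearMap.comp_apply]
      abel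
    have key : ∀ u v z, fderiv ℝ (fderiv ℝ S) x u v z
        = -(w x (Γ x u (U x)) z + w x (U x) (Γ x u z) + w x (fderiv ℝ U x u) z) • v
          - ((w x (Γ x u v) z + w x v (Γ x u z)) • U x + w x v z • fderiv ℝ U x u)
          - (fderiv ℝ Γ x u v (S x z) + Γ x v (fderiv ℝ S x u z))
          + (fderiv ℝ S x u (Γ x v z) + S x (fderiv ℝ Γ x u v z)) := by
      intro u v z
      have hw := hasDerivAt_line (differentiableAt_of_smoothOn hs.isOpen hs.smooth_w hx) u
      have hSd := hasDerivAt_line (differentiableAt_of_smoothOn hs.isOpen hS hx) u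
      have hUd := hasDerivAt_line (differentiableAt_of_smoothOn hs.isOpen hU hx) u
      have hΓd := hasDerivAt_line (differentiableAt_of_smoothOn hs.isOpen hs.smooth_Γ hx) u
      have hDd := hasDerivAt_line (differentiableAt_of_smoothOn hs.isOpen
        (smoothOn_fderiv hs.isOpen hS) hx) u
      have hz := hasDerivAt_const (0 : ℝ) z
      have hv := hasDerivAt_const (0 : ℝ) v
      have h1 := (hDd.clm_apply hv).clm_apply hz
      have hΓv := hΓd.clm_apply hv
      have hm : HasDerivAt (fun t : ℝ => -(w (x + t • u) (U (x + t • u)) z)) _ 0 :=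
        ((hw.clm_apply hUd).clm_apply hz).neg
      have h2 := (((hm.smul_const v).sub (((hw.clm_apply hv).clm_apply hz).smul hUd)).sub
        (hΓv.clm_apply (hSd.clm_apply hz))).add (hSd.clm_apply (hΓv.clm_apply hz))
      have h3 := hasDerivAt_line_congr (g := fun y => fderiv ℝ S y v z)
        (h := fun y => -(w y (U y) z) • v - w y v z • U y - Γ y v (S y z) + S y (Γ y v z))
        hs.isOpen (fun y hy => hDS y hy v z) hx h1 h2
      simp only [zero_smul, add_zero, map_zero, add_apply, hs.parallel x hx] at h3
      rw [h3]
      module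
    obtain ⟨c, hc⟩ := exists_scalar_of_ricci_identity (N := N x) (hs.alternating x hx)
      (hs.nondegenerate x hx) hd (by
        intro u v z
        have h0 : fderiv ℝ (fderiv ℝ S) x u v z - fderiv ℝ (fderiv ℝ S) x v u z = 0 := by
          rw [fderiv_fderiv_symm hs.isOpen hS hx u v, sub_self]
        have hDΓ : ∀ y, fderiv ℝ Γ x u v y = fderiv ℝ Γ x v u y - Γ x u (Γ x v y)
            + Γ x v (Γ x u y) + ricciTypeCurv (w x) (S x) u v y := fun y => by
          rw [← hR x hx]
          simp only [chartCurv, add_apply, sub_apply, ContinuousLinearMap.comp_apply]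
          abel
        rw [key, key, hDΓ, hDΓ, hDS x hx, hDS x hx, hDS x hx, hDS x hx, hNa, hNa] at h0
        rw [← h0]
        have hSz : ∀ a, w x a (S x z) = -w x (S x a) z := fun a => by rw [hanti, hSs x hx]
        simp only [ricciTypeCurv, map_add, map_sub, map_smul, add_apply, sub_apply, hSz]
        rw [hs.symm x hx v u]
        module)
    have hNc : N x = -c • ContinuousLinearMap.id ℝ E := by
      ext u
      simp [hc u]
    have h3 : traceL E (ContinuousLinearMap.id ℝ E) = d := LinearMap.trace_id ℝ E
    have hd0 : d ≠ 0 := by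
      rw [hdd]; norm_cast; omega
    intro u
    have h4 : -(1 / d) * traceL E (N x) = c := by
      rw [hNc, map_smul, h3, smul_eq_mul]
      field_simp
    simp only [h4]
    rw [hNa, hc u]
    module

omit [FiniteDimensional ℝ E] in
/-- The differential of `f`, from the Ricci identity for `U`: the curvature acts on `U` as the
commutator of second covariant derivatives, which are known from `hDS` and `hDU`. -/
lemma fderiv_scalar_eq {f : E → ℝ} (hd : 3 ≤ Module.finrank ℝ E) (hs : IsSymplecticChart V Γ w)
    (hS : ContDiffOn ℝ ∞ S V) (hU : ContDiffOn ℝ ∞ U V) (hf : ContDiffOn ℝ ∞ f V)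
    (hR : ∀ x ∈ V, ∀ u v z, chartCurv Γ x u v z = ricciTypeCurv (w x) (S x) u v z)
    (hSs : ∀ x ∈ V, ∀ u v, w x (S x u) v = w x (S x v) u)
    (hDS : ∀ x ∈ V, ∀ u v, fderiv ℝ S x u v
      = -(w x (U x) v) • u - w x u v • U x - Γ x u (S x v) + S x (Γ x u v))
    (hDU : ∀ x ∈ V, ∀ u, fderiv ℝ U x u = S x (S x u) - f x • u - Γ x u (U x))
    {x : E} (hx : x ∈ V) (u : E) : fderiv ℝ f x u = 2 * w x (U x) (S x u) := by
  have hanti := eq_neg_of_alternating (hs.alternating x hx)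
  have key : ∀ u v, fderiv ℝ (fderiv ℝ U) x u v
      = fderiv ℝ S x u (S x v) + S x (fderiv ℝ S x u v) - fderiv ℝ f x u • v
        - (fderiv ℝ Γ x u v (U x) + Γ x v (fderiv ℝ U x u)) := by
    intro u v
    have hSd := hasDerivAt_line (differentiableAt_of_smoothOn hs.isOpen hS hx) u
    have hUd := hasDerivAt_line (differentiableAt_of_smoothOn hs.isOpen hU hx) u
    have hfd := hasDerivAt_line (differentiableAt_of_smoothOn hs.isOpen hf hx) u
    have hΓd := hasDerivAt_line (differentiableAt_of_smoothOn hs.isOpen hs.smooth_Γ hx) u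
    have hDd := hasDerivAt_line (differentiableAt_of_smoothOn hs.isOpen
      (smoothOn_fderiv hs.isOpen hU) hx) u
    have hv := hasDerivAt_const (0 : ℝ) v
    have h3 := hasDerivAt_line_congr (g := fun y => fderiv ℝ U y v)
      (h := fun y => S y (S y v) - f y • v - Γ y v (U y))
      hs.isOpen (fun y hy => hDU y hy v) hx (hDd.clm_apply hv)
      (((hSd.clm_apply (hSd.clm_apply hv)).sub (hfd.smul_const v)).sub
        ((hΓd.clm_apply hv).clm_apply hUd))
    simp only [zero_smul, add_zero, map_zero] at h3
    exact h3
  have := eq_zero_of_smul_eq_smul (g := fun u => fderiv ℝ f x u - 2 * w x (U x) (S x u)) hd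
    (fun u v => by
      have h0 : fderiv ℝ (fderiv ℝ U) x u v - fderiv ℝ (fderiv ℝ U) x v u = 0 := by
        rw [fderiv_fderiv_symm hs.isOpen hU hx u v, sub_self]
      have hDΓ : ∀ y, fderiv ℝ Γ x u v y = fderiv ℝ Γ x v u y - Γ x u (Γ x v y)
          + Γ x v (Γ x u y) + ricciTypeCurv (w x) (S x) u v y := fun y => by
        rw [← hR x hx]
        simp only [chartCurv, add_apply, sub_apply, ContinuousLinearMap.comp_apply]
        abel
      rw [← sub_eq_zero, ← h0, key, key, hDΓ, hDU x hx, hDU x hx]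
      simp only [hDS x hx, ricciTypeCurv, map_add, map_sub, map_smul]
      rw [hs.symm x hx v u, hanti (S x u) (U x), hanti (S x v) (U x),
        hanti u (S x v), hanti v (S x u), hSs x hx v u,
        hanti u (U x), hanti v (U x), hanti v u]
      module) u
  linarith

/-- A chart of Ricci type carries the closed system for `S`, `U`, `f`: each step of the prolongation
is an integrability condition of the previous one, and with `f` the system closes up. -/
theorem exists_ricciTypeData {n : ℕ} (hd : 3 ≤ Module.finrank ℝ E) (hs : IsSymplecticChart V Γ w)
    (hr : IsRicciTypeChart n V Γ w) : ∃ S U f, IsRicciTypeData V Γ w S U f := by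
  obtain ⟨S, hS, hSs, hR⟩ := exists_ricci_endomorphism hd hs hr
  obtain ⟨U, hU, hUS⟩ := exists_vector_covEnd hd hs hS hSs hR
  have hDS : ∀ x ∈ V, ∀ u v, fderiv ℝ S x u v
      = -(w x (U x) v) • u - w x u v • U x - Γ x u (S x v) + S x (Γ x u v) := by
    intro x hx u v
    rw [← hUS x hx, covEnd_apply]
    abel
  obtain ⟨f, hf, hDU⟩ := exists_scalar_fderiv hd hs hS hU hR hSs hDS
  exact ⟨S, U, f, hs, hS, hU, hf, hSs, hR, hDS, hDU, fun x hx u =>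
    fderiv_scalar_eq hd hs hS hU hf hR hSs hDS hDU hx u⟩

end Chart

/-! ### The parallel bundle of rank `2n + 2` -/

section Bundle

variable {E : Type} [NormedAddCommGroup E] [NormedSpace ℝ E] [FiniteDimensional ℝ E]
  {V : Set E} {Γ : E → E →L[ℝ] E →L[ℝ] E} {w : E → E →L[ℝ] E →L[ℝ] ℝ} {S : E → E →L[ℝ] E}
  {U : E → E} {f : E → ℝ}

/-- The fibre of the rank `2n + 2` bundle `ℝ ⊕ TM ⊕ ℝ` over a chart. -/
abbrev Fibre (E : Type) := ℝ × E × ℝ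

/-- The endomorphism `(a, Z, b) ↦ (w(U, Z) + f b, S Z + b U, a)` of the bundle `ℝ ⊕ TM ⊕ ℝ`. -/
def fibreEnd (w : E → E →L[ℝ] E →L[ℝ] ℝ) (S : E → E →L[ℝ] E) (U : E → E) (f : E → ℝ) (x : E) :
    Fibre E →L[ℝ] Fibre E :=
  LinearMap.toContinuousLinearMap
    { toFun := fun s => (w x (U x) s.2.1 + f x * s.2.2, S x s.2.1 + s.2.2 • U x, s.1)
      map_add' := fun s t => by
        ext <;> simp only [Prod.fst_add, Prod.snd_add, map_add]
        · ring
        · module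
      map_smul' := fun c s => by
        ext <;> simp only [Prod.smul_fst, Prod.smul_snd, map_smul, smul_eq_mul, RingHom.id_apply]
        · ring
        · module }

lemma fibreEnd_apply (x : E) (s : Fibre E) :
    fibreEnd w S U f x s = (w x (U x) s.2.1 + f x * s.2.2, S x s.2.1 + s.2.2 • U x, s.1) := rfl

/-- The connection form `X ↦ ((a, Z, b) ↦ (w(SX, Z) + b w(U, X), a X + Γ_X Z + b SX, -w(X, Z)))` of
the bundle `ℝ ⊕ TM ⊕ ℝ`. -/
def fibreConn (Γ : E → E →L[ℝ] E →L[ℝ] E) (w : E → E →L[ℝ] E →L[ℝ] ℝ) (S : E → E →L[ℝ] E)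
    (U : E → E) (x : E) : E →L[ℝ] Fibre E →L[ℝ] Fibre E :=
  (LinearMap.mk₂ ℝ (fun (X : E) (s : Fibre E) => ((w x (S x X) s.2.1 + s.2.2 * w x (U x) X,
      s.1 • X + Γ x X s.2.1 + s.2.2 • S x X, -w x X s.2.1) : Fibre E))
    (fun X Y s => by
      ext <;> simp only [Prod.fst_add, Prod.snd_add, map_add, add_apply]
      · ring
      · module
      · ring)
    (fun c X s => by
      ext <;> simp only [Prod.smul_fst, Prod.smul_snd, map_smul, smul_apply, smul_eq_mul]
      · ring
      · module
      · ring)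
    (fun X s t => by
      ext <;> simp only [Prod.fst_add, Prod.snd_add, map_add]
      · ring
      · module
      · ring)
    (fun c X s => by
      ext <;> simp only [Prod.smul_fst, Prod.smul_snd, map_smul, smul_eq_mul]
      · ring
      · module
      · ring)).toContinuousBilinearMap

lemma fibreConn_apply (x X : E) (s : Fibre E) :
    fibreConn Γ w S U x X s = (w x (S x X) s.2.1 + s.2.2 * w x (U x) X,
      s.1 • X + Γ x X s.2.1 + s.2.2 • S x X, -w x X s.2.1) := rfl

/-- The symplectic form `a b' - b a' + w(Z, Z')` on the fibres of `ℝ ⊕ TM ⊕ ℝ`. -/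
def fibreForm (w : E → E →L[ℝ] E →L[ℝ] ℝ) (x : E) : Fibre E →L[ℝ] Fibre E →L[ℝ] ℝ :=
  (LinearMap.mk₂ ℝ (fun s t : Fibre E => s.1 * t.2.2 - s.2.2 * t.1 + w x s.2.1 t.2.1)
    (fun s s' t => by
      simp only [Prod.fst_add, Prod.snd_add, map_add, add_apply]; ring)
    (fun c s t => by
      simp only [Prod.smul_fst, Prod.smul_snd, map_smul, smul_apply, smul_eq_mul]; ring)
    (fun s t t' => by simp only [Prod.fst_add, Prod.snd_add, map_add]; ring)
    (fun c s t => by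
      simp only [Prod.smul_fst, Prod.smul_snd, map_smul, smul_eq_mul]
      ring)).toContinuousBilinearMap

lemma fibreForm_apply (x : E) (s t : Fibre E) :
    fibreForm w x s t = s.1 * t.2.2 - s.2.2 * t.1 + w x s.2.1 t.2.1 := rfl

namespace IsRicciTypeData

variable (h : IsRicciTypeData V Γ w S U f)
include h

lemma contDiffOn_fibreEnd : ContDiffOn ℝ ∞ (fibreEnd w S U f) V :=
  contDiffOn_clm_apply.2 fun _ =>
    ((((h.smooth_w.clm_apply h.smooth_U).clm_apply contDiffOn_const).add
      (h.smooth_f.mul contDiffOn_const)).prodMk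
      (((h.smooth_S.clm_apply contDiffOn_const).add
        (contDiffOn_const.smul h.smooth_U)).prodMk contDiffOn_const))

lemma contDiffOn_fibreConn : ContDiffOn ℝ ∞ (fibreConn Γ w S U) V := by
  refine contDiffOn_clm_apply.2 fun X => contDiffOn_clm_apply.2 fun s => ?_
  have hSX := h.smooth_S.clm_apply (contDiffOn_const (c := X))
  exact ((((h.smooth_w.clm_apply hSX).clm_apply contDiffOn_const).add
      (contDiffOn_const.mul ((h.smooth_w.clm_apply h.smooth_U).clm_apply contDiffOn_const))).prodMk
      (((contDiffOn_const.add ((h.smooth_Γ.clm_apply contDiffOn_const).clm_apply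
        contDiffOn_const)).add (contDiffOn_const.smul hSX)).prodMk
        ((h.smooth_w.clm_apply contDiffOn_const).clm_apply contDiffOn_const).neg))

lemma contDiffOn_fibreForm : ContDiffOn ℝ ∞ (fibreForm w) V :=
  contDiffOn_clm_apply.2 fun _ => contDiffOn_clm_apply.2 fun _ =>
    contDiffOn_const.add ((h.smooth_w.clm_apply contDiffOn_const).clm_apply contDiffOn_const)

lemma fderiv_fibreForm {x : E} (hx : x ∈ V) (X : E) (s t : Fibre E) :
    fderiv ℝ (fibreForm w) x X s t = fibreForm w x (fibreConn Γ w S U x X s) t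
      + fibreForm w x s (fibreConn Γ w S U x X t) := by
  have hanti := eq_neg_of_alternating (h.alternating x hx)
  have hw := hasDerivAt_line (differentiableAt_of_smoothOn h.isOpen h.smooth_w hx) X
  have h1 := ((hasDerivAt_line (differentiableAt_of_smoothOn h.isOpen h.contDiffOn_fibreForm hx)
    X).clm_apply (hasDerivAt_const 0 s)).clm_apply (hasDerivAt_const 0 t)
  have h2 := hasDerivAt_line_congr (h := fun y => s.1 * t.2.2 - s.2.2 * t.1 + w y s.2.1 t.2.1)
    h.isOpen (fun y hy => fibreForm_apply y s t) hx h1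
    (((hw.clm_apply (hasDerivAt_const 0 s.2.1)).clm_apply
      (hasDerivAt_const 0 t.2.1)).const_add (s.1 * t.2.2 - s.2.2 * t.1))
  simp only [zero_smul, add_zero, map_zero, h.parallel x hx] at h2
  rw [h2]
  simp only [fibreForm_apply, fibreConn_apply, map_add, map_smul, add_apply, smul_apply,
    smul_eq_mul]
  rw [hanti s.2.1 X, hanti s.2.1 (S x X)]
  ring

/-- The endomorphism is parallel. -/
lemma fderiv_fibreEnd {x : E} (hx : x ∈ V) (X : E) :
    fderiv ℝ (fibreEnd w S U f) x X = fibreEnd w S U f x ∘L fibreConn Γ w S U x X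
      - fibreConn Γ w S U x X ∘L fibreEnd w S U f x := by
  have hanti := eq_neg_of_alternating (h.alternating x hx)
  refine ContinuousLinearMap.ext fun s => ?_
  obtain ⟨a, Z, b⟩ := s
  have hw := hasDerivAt_line (differentiableAt_of_smoothOn h.isOpen h.smooth_w hx) X
  have hS := hasDerivAt_line (differentiableAt_of_smoothOn h.isOpen h.smooth_S hx) X
  have hU := hasDerivAt_line (differentiableAt_of_smoothOn h.isOpen h.smooth_U hx) X
  have hf := hasDerivAt_line (differentiableAt_of_smoothOn h.isOpen h.smooth_f hx) X
  have h1 := ((hasDerivAt_line (differentiableAt_of_smoothOn h.isOpen h.contDiffOn_fibreEnd hx)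
    X).clm_apply (hasDerivAt_const 0 (a, Z, b)))
  have hZ := hasDerivAt_const (0 : ℝ) Z
  have h2 := hasDerivAt_line_congr (h := fun y => (w y (U y) Z + f y * b, S y Z + b • U y, a))
    h.isOpen (fun y hy => fibreEnd_apply y (a, Z, b)) hx h1
    ((((hw.clm_apply hU).clm_apply hZ).add (hf.mul_const b)).prodMk
      (((hS.clm_apply hZ).add (hU.const_smul b)).prodMk (hasDerivAt_const 0 a)))
  simp only [zero_smul, add_zero, map_zero, add_apply, h.parallel x hx, h.fderiv_S x hx,
    h.fderiv_U x hx, h.fderiv_f x hx] at h2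
  rw [h2]
  simp only [fibreEnd_apply, fibreConn_apply, sub_apply, ContinuousLinearMap.comp_apply]
  have hSS : w x (S x (S x X)) Z = - w x (S x X) (S x Z) := by
    rw [hanti (S x X), h.form_S x hx]; ring
  ext
  · simp only [map_add, map_sub, map_smul, sub_apply, smul_apply, smul_eq_mul,
      Prod.fst_sub]
    rw [hSS, hanti (S x X) (U x)]
    ring
  · simp only [map_add, map_smul, Prod.fst_sub, Prod.snd_sub]
    rw [hanti X Z]
    module
  · simp only [map_add, map_smul, Prod.snd_sub, smul_eq_mul]
    have : w x (S x X) Z = - w x X (S x Z) := by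
      rw [hanti X, h.form_S x hx]; ring
    rw [hanti X (U x)]
    linarith

/-- The curvature of the connection `fibreConn` is `-2 w` times the parallel endomorphism. -/
lemma fibreConn_curvature {x : E} (hx : x ∈ V) (u v : E) :
    fderiv ℝ (fibreConn Γ w S U) x u v - fderiv ℝ (fibreConn Γ w S U) x v u
      + fibreConn Γ w S U x u ∘L fibreConn Γ w S U x v
      - fibreConn Γ w S U x v ∘L fibreConn Γ w S U x u = -(2 * w x u v) • fibreEnd w S U f x := by
  have hanti := eq_neg_of_alternating (h.alternating x hx)
  refine ContinuousLinearMap.ext fun s => ?_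
  obtain ⟨a, Z, b⟩ := s
  have key : ∀ u v, fderiv ℝ (fibreConn Γ w S U) x u v (a, Z, b)
      = (w x (Γ x u (S x v)) Z + w x (S x v) (Γ x u Z) + w x (fderiv ℝ S x u v) Z
          + b * (w x (Γ x u (U x)) v + w x (U x) (Γ x u v) + w x (fderiv ℝ U x u) v),
        fderiv ℝ Γ x u v Z + b • fderiv ℝ S x u v,
        -(w x (Γ x u v) Z + w x v (Γ x u Z))) := by
    intro u v
    have hw := hasDerivAt_line (differentiableAt_of_smoothOn h.isOpen h.smooth_w hx) u
    have hS := hasDerivAt_line (differentiableAt_of_smoothOn h.isOpen h.smooth_S hx) u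
    have hU := hasDerivAt_line (differentiableAt_of_smoothOn h.isOpen h.smooth_U hx) u
    have hΓ := hasDerivAt_line (differentiableAt_of_smoothOn h.isOpen h.smooth_Γ hx) u
    have h1 := (((hasDerivAt_line (differentiableAt_of_smoothOn h.isOpen h.contDiffOn_fibreConn hx)
      u).clm_apply (hasDerivAt_const 0 v)).clm_apply (hasDerivAt_const 0 (a, Z, b)))
    have hZ := hasDerivAt_const (0 : ℝ) Z
    have hv := hasDerivAt_const (0 : ℝ) v
    have hSv := hS.clm_apply hv
    have h2 := hasDerivAt_line_congr (h := fun y => (w y (S y v) Z + b * w y (U y) v,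
        a • v + Γ y v Z + b • S y v, -w y v Z))
      h.isOpen (fun y hy => fibreConn_apply y v (a, Z, b)) hx h1
      ((((hw.clm_apply hSv).clm_apply hZ).add (((hw.clm_apply hU).clm_apply hv).const_mul b)).prodMk
        (((((hΓ.clm_apply hv).clm_apply hZ).const_add (a • v)).add (hSv.const_smul b)).prodMk
          ((hw.clm_apply hv).clm_apply hZ).neg))
    simp only [zero_smul, add_zero, map_zero, add_apply, h.parallel x hx] at h2
    exact h2
  have hDΓ : ∀ y, fderiv ℝ Γ x u v y = fderiv ℝ Γ x v u y - Γ x u (Γ x v y)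
      + Γ x v (Γ x u y) + ricciTypeCurv (w x) (S x) u v y := fun y => by
    rw [← h.curv x hx]
    simp only [chartCurv, add_apply, sub_apply, ContinuousLinearMap.comp_apply]
    abel
  have hSv : ∀ a b, w x a (S x b) = -w x (S x a) b := fun a b => by
    rw [hanti, h.form_S x hx]
  simp only [add_apply, sub_apply, smul_apply, ContinuousLinearMap.comp_apply, key,
    h.fderiv_S x hx, h.fderiv_U x hx, hDΓ, fibreConn_apply, fibreEnd_apply]
  ext
  · simp only [map_add, map_sub, map_smul, add_apply, sub_apply, smul_apply, smul_eq_mul, hSv,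
      Prod.fst_sub, Prod.fst_add, Prod.smul_fst]
    rw [h.symm x hx v u, h.form_S x hx v u, hanti v u]
    ring
  · simp only [map_add, map_sub, map_smul, Prod.fst_sub, Prod.fst_add, Prod.smul_fst,
      Prod.snd_sub, Prod.snd_add, Prod.smul_snd, ricciTypeCurv]
    rw [h.symm x hx v u, hanti v u]
    module
  · simp only [map_add, map_smul, Prod.snd_sub, Prod.snd_add, Prod.smul_snd, smul_eq_mul, hSv]
    rw [h.symm x hx v u, h.form_S x hx v u, hanti v u]
    ring

omit h in
lemma fibreEnd_fibreForm {x : E} (halt : ∀ u, w x u u = 0)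
    (hS : ∀ u v, w x (S x u) v = w x (S x v) u) (s t : Fibre E) :
    fibreForm w x (fibreEnd w S U f x s) t + fibreForm w x s (fibreEnd w S U f x t) = 0 := by
  have hanti := eq_neg_of_alternating halt
  simp only [fibreForm_apply, fibreEnd_apply, map_add, map_smul, add_apply, smul_apply,
    smul_eq_mul]
  rw [hS, hanti s.2.1 (S x t.2.1), hanti s.2.1 (U x)]
  ring

end IsRicciTypeData

end Bundle

/-! ### Developments into the standard symplectic space -/

section Development

open Metric Set

/-- A map `Φ` of an open subset `V` of a vector space into the constraint surface of `A`, together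
with a frame `B` of the symplectic orthogonal of `Φ` and `AΦ` along `Φ`, in which the reduced form
and the reduced connection are `w` and `Γ`. The 1-form `α` is the component of `DΦ` along `AΦ`. -/
structure IsDevelopment {n : ℕ} {E : Type} [NormedAddCommGroup E] [NormedSpace ℝ E]
    (A : BigSpace n →L[ℝ] BigSpace n) (V : Set E) (Γ : E → E →L[ℝ] E →L[ℝ] E)
    (w : E → E →L[ℝ] E →L[ℝ] ℝ) (Φ : E → BigSpace n) (B : E → E →L[ℝ] BigSpace n)
    (α : E → E →L[ℝ] ℝ) : Prop where
  isOpen : IsOpen V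
  smooth_Φ : ContDiffOn ℝ ∞ Φ V
  smooth_B : ContDiffOn ℝ ∞ B V
  smooth_α : ContDiffOn ℝ ∞ α V
  omega_A : ∀ x ∈ V, Omega (Φ x) (A (Φ x)) = 1
  omega_B : ∀ x ∈ V, ∀ u, Omega (Φ x) (B x u) = 0
  omega_A_B : ∀ x ∈ V, ∀ u, Omega (A (Φ x)) (B x u) = 0
  omega_B_B : ∀ x ∈ V, ∀ u v, Omega (B x u) (B x v) = w x u v
  fderiv_Φ : ∀ x ∈ V, ∀ u, fderiv ℝ Φ x u = B x u + α x u • A (Φ x)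
  fderiv_B : ∀ x ∈ V, ∀ u v, fderiv ℝ B x u v = Omega (A (B x u)) (B x v) • Φ x
    + B x (Γ x u v) - w x u v • A (Φ x) + α x u • A (B x v)

variable {n : ℕ} {E : Type}

section

variable [NormedAddCommGroup E] [NormedSpace ℝ E] [FiniteDimensional ℝ E]
  {w : E → E →L[ℝ] E →L[ℝ] ℝ}

/-- A symplectic frame of the fibre over `x`. -/
lemma exists_symplectic_frame {x : E} (hdim : Module.finrank ℝ E = 2 * n)
    (halt : ∀ u, w x u u = 0) :
    ∃ F : Fibre E →L[ℝ] BigSpace n, F (1, 0, 0) = e0 n ∧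
      ∀ s t, Omega (F s) (F t) = fibreForm w x s t := by
  obtain ⟨q, p, hqp⟩ := exists_sum_wedge (w x) n hdim halt
  let F : Fibre E →ₗ[ℝ] BigSpace n :=
    { toFun := fun s => WithLp.toLp 2 (Sum.elim (Fin.cons s.1 fun i => q i s.2.1)
        (Fin.cons s.2.2 fun i => p i s.2.1))
      map_add' := fun s t => by
        ext i
        rcases i with i | i <;> refine Fin.cases ?_ (fun j => ?_) i <;> simp
      map_smul' := fun c s => by
        ext i
        rcases i with i | i <;> refine Fin.cases ?_ (fun j => ?_) i <;> simp }
  refine ⟨F.toContinuousLinearMap, ?_, fun s t => ?_⟩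
  · ext i
    rcases i with i | i <;> refine Fin.cases ?_ (fun j => ?_) i <;> simp [F, e0]
  · simp [Omega, F, Fin.sum_univ_succ, fibreForm_apply, hqp]
    ring

omit [FiniteDimensional ℝ E] in
/-- A torsion-free connection with `∇w = 0` makes `w` closed. -/
lemma form_closed {V : Set E} {Γ : E → E →L[ℝ] E →L[ℝ] E} (hs : IsSymplecticChart V Γ w) {x : E}
    (hx : x ∈ V) (u v z : E) :
    fderiv ℝ w x u v z + fderiv ℝ w x v z u + fderiv ℝ w x z u v = 0 := by
  have hanti := eq_neg_of_alternating (hs.alternating x hx)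
  simp only [hs.parallel x hx]
  rw [hanti v (Γ x u z), hanti z (Γ x v u), hanti u (Γ x z v), hs.symm x hx v u,
    hs.symm x hx z u, hs.symm x hx z v]
  ring

variable {V : Set E} {Γ : E → E →L[ℝ] E →L[ℝ] E} {S : E → E →L[ℝ] E}
  {U : E → E} {f : E → ℝ} {α : E → E →L[ℝ] ℝ} {r : ℝ}

omit [FiniteDimensional ℝ E] in
lemma exists_norm_le_on_segment {G : Type*} [NormedAddCommGroup G] [NormedSpace ℝ G]
    {g : E → E →L[ℝ] G} (hg : ContinuousOn g (ball 0 r)) {x : E} (hx : x ∈ ball (0 : E) r) :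
    ∃ K : ℝ, ∀ t ∈ Icc (0 : ℝ) 1, ‖g (t • x) x‖ ≤ K := by
  have hc : ContinuousOn (fun t : ℝ => g (t • x) x) (Icc 0 1) := by
    refine ContinuousOn.clm_apply (hg.comp (by fun_prop) fun t ht => ?_) continuousOn_const
    rw [mem_ball_zero_iff] at hx ⊢
    rw [norm_smul, Real.norm_of_nonneg ht.1]
    exact (mul_le_of_le_one_left (norm_nonneg x) ht.2).trans_lt hx
  exact isCompact_Icc.exists_bound_of_continuousOn hc

omit [FiniteDimensional ℝ E] in
lemma smul_mem_ball {x : E} (hx : x ∈ ball (0 : E) r) {t : ℝ} (ht : t ∈ Icc (0 : ℝ) 1) :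
    t • x ∈ ball (0 : E) r := by
  rw [mem_ball_zero_iff] at hx ⊢
  rw [norm_smul, Real.norm_of_nonneg ht.1]
  exact (mul_le_of_le_one_left (norm_nonneg x) ht.2).trans_lt hx

/-- The connection `fibreConn + α ⊗ fibreEnd`, which is flat if `dα = 2 w`. -/
def flatConn (Γ : E → E →L[ℝ] E →L[ℝ] E) (w : E → E →L[ℝ] E →L[ℝ] ℝ) (S : E → E →L[ℝ] E)
    (U : E → E) (f : E → ℝ) (α : E → E →L[ℝ] ℝ) (x : E) : E →L[ℝ] Fibre E →L[ℝ] Fibre E :=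
  fibreConn Γ w S U x + (α x).smulRight (fibreEnd w S U f x)

lemma flatConn_apply (x u : E) :
    flatConn Γ w S U f α x u = fibreConn Γ w S U x u + α x u • fibreEnd w S U f x := rfl

namespace IsRicciTypeData

variable (h : IsRicciTypeData V Γ w S U f)
include h

lemma contDiffOn_flatConn (hα : ContDiffOn ℝ ∞ α V) :
    ContDiffOn ℝ ∞ (flatConn Γ w S U f α) V :=
  h.contDiffOn_fibreConn.add (contDiffOn_clm_apply.2 fun _ =>
    (hα.clm_apply contDiffOn_const).smul h.contDiffOn_fibreEnd)

lemma fderiv_flatConn (hα : ContDiffOn ℝ ∞ α V) {x : E} (hx : x ∈ V) (u v : E) :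
    fderiv ℝ (flatConn Γ w S U f α) x u v = fderiv ℝ (fibreConn Γ w S U) x u v
      + (α x v • fderiv ℝ (fibreEnd w S U f) x u + fderiv ℝ α x u v • fibreEnd w S U f x) := by
  have h1 := (hasDerivAt_line (differentiableAt_of_smoothOn h.isOpen
    (h.contDiffOn_flatConn hα) hx) u).clm_apply (hasDerivAt_const 0 v)
  have h2 := hasDerivAt_line (differentiableAt_of_smoothOn h.isOpen h.contDiffOn_fibreConn hx) u
  have h3 := hasDerivAt_line (differentiableAt_of_smoothOn h.isOpen h.contDiffOn_fibreEnd hx) u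
  have h4 := hasDerivAt_line (differentiableAt_of_smoothOn h.isOpen hα hx) u
  have h5 := hasDerivAt_line_congr h.isOpen
    (fun y _ => flatConn_apply (Γ := Γ) (w := w) (S := S) (U := U) (f := f) (α := α) y v) hx h1
    ((h2.clm_apply (hasDerivAt_const 0 v)).add ((h4.clm_apply (hasDerivAt_const 0 v)).smul h3))
  simpa only [zero_smul, add_zero, map_zero] using h5

/-- The curvature `-2 w ⊗ fibreEnd` of `fibreConn` is compensated by `dα ⊗ fibreEnd`, as `fibreEnd`
is parallel and commutes with itself. -/
lemma flatConn_flat (hα : ContDiffOn ℝ ∞ α V)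
    (hdα : ∀ x ∈ V, ∀ u v, fderiv ℝ α x u v - fderiv ℝ α x v u = 2 * w x u v)
    {x : E} (hx : x ∈ V) (u v : E) :
    fderiv ℝ (flatConn Γ w S U f α) x u v + flatConn Γ w S U f α x u ∘L flatConn Γ w S U f α x v
      = fderiv ℝ (flatConn Γ w S U f α) x v u
        + flatConn Γ w S U f α x v ∘L flatConn Γ w S U f α x u := by
  have hR := h.fibreConn_curvature hx u v
  rw [h.fderiv_flatConn hα hx, h.fderiv_flatConn hα hx, flatConn_apply, flatConn_apply,
    h.fderiv_fibreEnd hx, h.fderiv_fibreEnd hx]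
  have hdα' : fderiv ℝ α x u v = fderiv ℝ α x v u + 2 * w x u v := by linarith [hdα x hx u v]
  have hR' : fderiv ℝ (fibreConn Γ w S U) x u v = fderiv ℝ (fibreConn Γ w S U) x v u
      - fibreConn Γ w S U x u ∘L fibreConn Γ w S U x v
      + fibreConn Γ w S U x v ∘L fibreConn Γ w S U x u - (2 * w x u v) • fibreEnd w S U f x := by
    rw [← sub_eq_zero] at hR ⊢
    rw [← hR]
    module
  rw [hR', hdα']
  simp only [ContinuousLinearMap.add_comp, ContinuousLinearMap.comp_add,
    ContinuousLinearMap.smul_comp, ContinuousLinearMap.comp_smul]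
  module

end IsRicciTypeData

/-- A flat connection has a local trivialisation by parallel sections: this is the integrable total
differential equation `dF = F ∘ θ` for `F` with values in a space of linear maps. -/
lemma exists_parallel_frame {G H : Type*} [NormedAddCommGroup G] [NormedSpace ℝ G]
    [NormedAddCommGroup H] [NormedSpace ℝ H] [CompleteSpace H] (hr : 0 < r)
    {θ : E → E →L[ℝ] G →L[ℝ] G} (hθ : ContDiffOn ℝ ∞ θ (ball 0 r))
    (hflat : ∀ x ∈ ball (0 : E) r, ∀ u v, fderiv ℝ θ x u v + θ x u ∘L θ x v
      = fderiv ℝ θ x v u + θ x v ∘L θ x u) (F₀ : G →L[ℝ] H) :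
    ∃ ρ, 0 < ρ ∧ ρ ≤ r ∧ ∃ F : E → G →L[ℝ] H, F 0 = F₀ ∧
      ContDiffOn ℝ ∞ F (ball 0 ρ) ∧ ∀ x ∈ ball (0 : E) ρ, ∀ u, fderiv ℝ F x u = F x ∘L θ x u := by
  set Θ : E → E →L[ℝ] (G →L[ℝ] H) →L[ℝ] (G →L[ℝ] H) := fun x =>
    (ContinuousLinearMap.compL ℝ G G H).flip ∘L θ x with hΘ
  have hΘa : ∀ x u F, Θ x u F = F ∘L θ x u := fun x u F => rfl
  have hΘs : ContDiffOn ℝ ∞ Θ (ball 0 r) := contDiffOn_const.clm_comp hθ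
  have hΘd : ∀ x ∈ ball (0 : E) r, ∀ u v,
      fderiv ℝ Θ x u v = (ContinuousLinearMap.compL ℝ G G H).flip (fderiv ℝ θ x u v) := by
    intro x hx u v
    have h1 : HasFDerivAt Θ _ x := (hasFDerivAt_const
      (ContinuousLinearMap.compL ℝ G G H).flip x).clm_comp
      (differentiableAt_of_smoothOn isOpen_ball hθ hx).hasFDerivAt
    rw [h1.fderiv]
    simp
  obtain ⟨ρ, hρ, hρr, F, hF0, hFd⟩ := exists_solution_of_integrable hr Θ hΘs
    (fun x hx u v => by
      refine ContinuousLinearMap.ext fun T => ?_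
      rw [hΘd x hx, hΘd x hx]
      simp only [add_apply, ContinuousLinearMap.comp_apply, hΘa, ContinuousLinearMap.flip_apply,
        ContinuousLinearMap.compL_apply]
      rw [ContinuousLinearMap.comp_assoc, ContinuousLinearMap.comp_assoc,
        ← ContinuousLinearMap.comp_add, ← ContinuousLinearMap.comp_add, hflat x hx]) F₀
  refine ⟨ρ, hρ, hρr, F, hF0, contDiffOn_of_hasFDerivAt_flip isOpen_ball
    (hΘs.mono (ball_subset_ball hρr)) hFd, fun x hx u => ?_⟩
  rw [(hFd x hx).fderiv]
  rfl

section Frame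

variable {F : E → Fibre E →L[ℝ] BigSpace n} (h : IsRicciTypeData (ball 0 r) Γ w S U f)
  (hα : ContDiffOn ℝ ∞ α (ball 0 r)) (hFs : ContDiffOn ℝ ∞ F (ball 0 r))
  (hFf : ∀ x ∈ ball (0 : E) r, ∀ u, fderiv ℝ F x u = F x ∘L flatConn Γ w S U f α x u)
include h hα hFs hFf

/-- A parallel frame which is symplectic at the origin is symplectic. -/
lemma omega_parallel_frame (hF0 : ∀ s t, Omega (F 0 s) (F 0 t) = fibreForm w 0 s t) {x : E}
    (hx : x ∈ ball (0 : E) r) (s t : Fibre E) : Omega (F x s) (F x t) = fibreForm w x s t := by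
  set Q : E → Fibre E →L[ℝ] Fibre E →L[ℝ] ℝ := fun x =>
    omegaCLM.bilinearComp (F x) (F x) - fibreForm w x with hQ
  have hQa : ∀ x s t, Q x s t = omegaCLM (F x s) (F x t) - fibreForm w x s t := fun x s t => rfl
  have hQs : ContDiffOn ℝ ∞ Q (ball 0 r) := by
    refine contDiffOn_clm_apply.2 fun s => contDiffOn_clm_apply.2 fun t => ?_
    have h1 : ContDiffOn ℝ ∞ (fun x => omegaCLM (F x s) (F x t)) (ball 0 r) :=
      (contDiffOn_const.clm_apply (hFs.clm_apply contDiffOn_const)).clm_apply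
        (hFs.clm_apply contDiffOn_const)
    exact h1.sub ((h.contDiffOn_fibreForm.clm_apply contDiffOn_const).clm_apply contDiffOn_const)
  have hQd : ∀ x ∈ ball (0 : E) r, ∀ u, fderiv ℝ Q x u
      = Q x ∘L flatConn Γ w S U f α x u + ((Q x).flip ∘L flatConn Γ w S U f α x u).flip := by
    intro x hx u
    refine ContinuousLinearMap.ext fun s => ContinuousLinearMap.ext fun t => ?_
    have h1 := ((hasDerivAt_line (differentiableAt_of_smoothOn isOpen_ball hQs hx) u).clm_apply
      (hasDerivAt_const 0 s)).clm_apply (hasDerivAt_const 0 t)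
    have h2 := hasDerivAt_line (differentiableAt_of_smoothOn isOpen_ball hFs hx) u
    have h3 := ((hasDerivAt_line (differentiableAt_of_smoothOn h.isOpen h.contDiffOn_fibreForm
      hx) u).clm_apply (hasDerivAt_const 0 s)).clm_apply (hasDerivAt_const 0 t)
    have h4 := hasDerivAt_line_congr isOpen_ball (fun y _ => hQa y s t) hx h1
      ((((hasDerivAt_const (0 : ℝ) (omegaCLM (n := n))).clm_apply
        (h2.clm_apply (hasDerivAt_const 0 s))).clm_apply
        (h2.clm_apply (hasDerivAt_const 0 t))).sub h3)
    simp only [zero_smul, add_zero, map_zero, zero_add, zero_apply, hFf x hx,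
      h.fderiv_fibreForm hx] at h4
    rw [h4]
    have h5 := IsRicciTypeData.fibreEnd_fibreForm (f := f) (U := U) (h.alternating x hx)
      (h.form_S x hx) s t
    simp only [hQa, add_apply, ContinuousLinearMap.comp_apply, ContinuousLinearMap.flip_apply,
      flatConn_apply, map_add, map_smul, smul_apply, smul_eq_mul]
    linear_combination (α x u) * h5
  have hQ0 : Q 0 = 0 := by
    refine ContinuousLinearMap.ext fun s => ContinuousLinearMap.ext fun t => ?_
    rw [hQa, omegaCLM_apply, hF0, sub_self]
    rfl
  have := eq_zero_of_hasFDerivAt_of_le (G := Q) (G' := fderiv ℝ Q)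
    (fun x hx => (differentiableAt_of_smoothOn isOpen_ball hQs hx).hasFDerivAt) hQ0
    (fun x hx => by
      obtain ⟨K, hK⟩ := exists_norm_le_on_segment (h.contDiffOn_flatConn hα).continuousOn hx
      refine ⟨2 * K, fun t ht => ?_⟩
      rw [hQd _ (smul_mem_ball hx ht)]
      have e1 := (Q (t • x)).opNorm_comp_le (flatConn Γ w S U f α (t • x) x)
      have e2 := (Q (t • x)).flip.opNorm_comp_le (flatConn Γ w S U f α (t • x) x)
      rw [ContinuousLinearMap.opNorm_flip] at e2
      have e3 := norm_add_le (Q (t • x) ∘L flatConn Γ w S U f α (t • x) x)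
        ((Q (t • x)).flip ∘L flatConn Γ w S U f α (t • x) x).flip
      rw [ContinuousLinearMap.opNorm_flip] at e3
      have e4 := mul_le_mul_of_nonneg_left (hK t ht) (norm_nonneg (Q (t • x)))
      linarith) hx
  have h6 := congrArg (fun T => T s t) this
  simp only [hQa, zero_apply] at h6
  exact sub_eq_zero.1 h6

/-- In a parallel frame the parallel endomorphism is a constant matrix. -/
lemma end_parallel_frame {A : BigSpace n →L[ℝ] BigSpace n}
    (hA : ∀ s, A (F 0 s) = F 0 (fibreEnd w S U f 0 s)) {x : E}
    (hx : x ∈ ball (0 : E) r) (s : Fibre E) : A (F x s) = F x (fibreEnd w S U f x s) := by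
  have hEs := h.contDiffOn_fibreEnd
  have hGd : ∀ x ∈ ball (0 : E) r, ∃ T : E →L[ℝ] Fibre E →L[ℝ] BigSpace n,
      HasFDerivAt (fun x => A ∘L F x - F x ∘L fibreEnd w S U f x) T x ∧
      ∀ u, T u = (A ∘L F x - F x ∘L fibreEnd w S U f x) ∘L flatConn Γ w S U f α x u := by
    intro x hx
    have h1 := (differentiableAt_of_smoothOn isOpen_ball hFs hx).hasFDerivAt
    have h2 := (differentiableAt_of_smoothOn isOpen_ball hEs hx).hasFDerivAt
    refine ⟨_, ((hasFDerivAt_const A x).clm_comp h1).sub (h1.clm_comp h2), fun u => ?_⟩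
    simp only [sub_apply, add_apply, ContinuousLinearMap.comp_apply,
      ContinuousLinearMap.compL_apply, ContinuousLinearMap.flip_apply, hFf x hx, zero_apply,
      map_zero, h.fderiv_fibreEnd hx, flatConn_apply]
    refine ContinuousLinearMap.ext fun s => ?_
    simp only [sub_apply, add_apply, smul_apply, ContinuousLinearMap.comp_apply, map_add, map_sub,
      map_smul, zero_apply]
    module
  choose! T hT hTu using hGd
  have := eq_zero_of_hasFDerivAt_of_le hT (sub_eq_zero.2 (ContinuousLinearMap.ext hA))
    (fun x hx => by
      obtain ⟨K, hK⟩ := exists_norm_le_on_segment (h.contDiffOn_flatConn hα).continuousOn hx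
      refine ⟨K, fun t ht => ?_⟩
      rw [hTu _ (smul_mem_ball hx ht), mul_comm]
      exact (ContinuousLinearMap.opNorm_comp_le _ _).trans
        (mul_le_mul_of_nonneg_left (hK t ht) (norm_nonneg _))) hx
  exact congrArg (fun T => T s) (sub_eq_zero.1 this)

end Frame

/-- A symplectic isomorphism of a fibre with the standard space carries an infinitesimally
symplectic endomorphism of the fibre to an element of `sp`. -/
lemma exists_matrix_of_symplectic_frame (hdim : Module.finrank ℝ E = 2 * n)
    {x : E} (hnd : ∀ u, (∀ v, w x u v = 0) → u = 0) {F : Fibre E →L[ℝ] BigSpace n}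
    (hF : ∀ s t, Omega (F s) (F t) = fibreForm w x s t) (T : Fibre E →L[ℝ] Fibre E)
    (hT : ∀ s t, fibreForm w x (T s) t + fibreForm w x s (T t) = 0) :
    ∃ A : BigSpace n →L[ℝ] BigSpace n, InSp A ∧ ∀ s, A (F s) = F (T s) := by
  have hinj : Function.Injective F := by
    rw [injective_iff_map_eq_zero]
    intro s hs
    have h1 : ∀ t, fibreForm w x s t = 0 := fun t => by
      rw [← hF, hs, ← omegaCLM_apply, map_zero, zero_apply]
    have e1 := h1 (0, 0, 1)
    have e2 := h1 (1, 0, 0)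
    have e3 := hnd s.2.1 fun v => by simpa [fibreForm_apply] using h1 (0, v, 0)
    simp only [fibreForm_apply, map_zero] at e1 e2
    ext
    · simpa using e1
    · exact e3
    · simpa using e2
  have hfin : Module.finrank ℝ (Fibre E) = Module.finrank ℝ (BigSpace n) := by
    simp [hdim]; ring
  let e : Fibre E ≃L[ℝ] BigSpace n :=
    (LinearEquiv.ofInjectiveOfFinrankEq (F : Fibre E →ₗ[ℝ] BigSpace n) hinj
      hfin).toContinuousLinearEquiv
  have hea : ∀ s, e s = F s := fun s => rfl
  have hA : ∀ s, (F ∘L T ∘L (e.symm : BigSpace n →L[ℝ] Fibre E)) (F s) = F (T s) := fun s => by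
    rw [← hea s]
    simp
  refine ⟨_, fun x y => ?_, hA⟩
  obtain ⟨s, rfl⟩ := e.surjective x
  obtain ⟨t, rfl⟩ := e.surjective y
  rw [hea, hea, hA, hA, hF, hF]
  exact hT s t

/-- In a parallel symplectic frame `F` the section `(1, 0, 0)` becomes a development: `fibreEnd`
maps `(1, 0, 0)` to `(0, 0, 1)`, and the subbundle `TM` is the orthogonal of these two vectors. -/
lemma isDevelopment_of_parallel_frame {F : E → Fibre E →L[ℝ] BigSpace n}
    {A : BigSpace n →L[ℝ] BigSpace n} (h : IsRicciTypeData V Γ w S U f)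
    (hα : ContDiffOn ℝ ∞ α V) (hFs : ContDiffOn ℝ ∞ F V)
    (hFf : ∀ x ∈ V, ∀ u, fderiv ℝ F x u = F x ∘L flatConn Γ w S U f α x u)
    (hω : ∀ x ∈ V, ∀ s t, Omega (F x s) (F x t) = fibreForm w x s t)
    (hA : ∀ x ∈ V, ∀ s, A (F x s) = F x (fibreEnd w S U f x s)) :
    IsDevelopment A V Γ w (fun x => F x (1, 0, 0))
      (fun x => F x ∘L (ContinuousLinearMap.inr ℝ ℝ (E × ℝ) ∘L ContinuousLinearMap.inl ℝ E ℝ))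
      α := by
  have hBa : ∀ x Z, (F x ∘L (ContinuousLinearMap.inr ℝ ℝ (E × ℝ) ∘L
    ContinuousLinearMap.inl ℝ E ℝ)) Z = F x (0, Z, 0) := fun x Z => rfl
  have hAΦ : ∀ x ∈ V, A (F x (1, 0, 0)) = F x (0, 0, 1) := fun x hx => by
    simp [hA x hx, fibreEnd_apply]
  have hdec : ∀ x a Z b, F x (a, Z, b) = a • F x (1, 0, 0) + F x (0, Z, 0) + b • F x (0, 0, 1) := by
    intro x a Z b
    rw [← map_smul, ← map_smul, ← map_add, ← map_add]
    simp
  refine ⟨h.isOpen, hFs.clm_apply contDiffOn_const, hFs.clm_comp contDiffOn_const, hα,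
    fun x hx => ?_, fun x hx u => ?_, fun x hx u => ?_, fun x hx u v => ?_, fun x hx u => ?_,
    fun x hx u v => ?_⟩
  · simp [hAΦ x hx, hω x hx, fibreForm_apply]
  · simp [hBa, hω x hx, fibreForm_apply]
  · simp [hBa, hAΦ x hx, hω x hx, fibreForm_apply]
  · simp [hBa, hω x hx, fibreForm_apply]
  · have h1 := ((differentiableAt_of_smoothOn h.isOpen hFs hx).hasFDerivAt.clm_apply
      (hasFDerivAt_const ((1, 0, 0) : Fibre E) x)).fderiv
    rw [h1]
    simp only [add_apply, ContinuousLinearMap.comp_apply, ContinuousLinearMap.flip_apply,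
      zero_apply, map_zero, zero_add, hFf x hx, flatConn_apply, fibreConn_apply, fibreEnd_apply,
      smul_apply, map_add, map_smul, hBa, hAΦ x hx]
    simp
  · have h1 := ((differentiableAt_of_smoothOn h.isOpen hFs hx).hasFDerivAt.clm_comp
      (hasFDerivAt_const (ContinuousLinearMap.inr ℝ ℝ (E × ℝ) ∘L
        ContinuousLinearMap.inl ℝ E ℝ) x)).fderiv
    have h2 : fderiv ℝ (fun y => F y ∘L (ContinuousLinearMap.inr ℝ ℝ (E × ℝ) ∘L
        ContinuousLinearMap.inl ℝ E ℝ)) x u v = F x (flatConn Γ w S U f α x u (0, v, 0)) := by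
      rw [h1, ← ContinuousLinearMap.comp_apply (F x), ← hFf x hx]
      simp
    rw [h2, hBa, hBa, hBa, hAΦ x hx, hA x hx, hω x hx, hA x hx]
    simp only [flatConn_apply, fibreConn_apply, fibreEnd_apply, add_apply, smul_apply, map_add,
      map_smul, fibreForm_apply]
    rw [hdec x (w x (S x u) v + _), hdec x (w x (U x) v + _) (S x v + _)]
    simp
    module

end

end Development

section Existence

open Metric Set

variable {n : ℕ} {E : Type} [NormedAddCommGroup E]

section

variable [NormedSpace ℝ E] {V : Set E} {Γ : E → E →L[ℝ] E →L[ℝ] E}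
  {w : E → E →L[ℝ] E →L[ℝ] ℝ} {S : E → E →L[ℝ] E}
  {U : E → E} {f : E → ℝ}

lemma IsRicciTypeData.mono {V' : Set E} (h : IsRicciTypeData V Γ w S U f) (hV' : IsOpen V')
    (hsub : V' ⊆ V) : IsRicciTypeData V' Γ w S U f where
  isOpen := hV'
  smooth_Γ := h.smooth_Γ.mono hsub
  smooth_w := h.smooth_w.mono hsub
  alternating x hx := h.alternating x (hsub hx)
  nondegenerate x hx := h.nondegenerate x (hsub hx)
  symm x hx := h.symm x (hsub hx)
  parallel x hx := h.parallel x (hsub hx)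
  smooth_S := h.smooth_S.mono hsub
  smooth_U := h.smooth_U.mono hsub
  smooth_f := h.smooth_f.mono hsub
  form_S x hx := h.form_S x (hsub hx)
  curv x hx := h.curv x (hsub hx)
  fderiv_S x hx := h.fderiv_S x (hsub hx)
  fderiv_U x hx := h.fderiv_U x (hsub hx)
  fderiv_f x hx := h.fderiv_f x (hsub hx)

lemma IsRicciTypeData.translate (h : IsRicciTypeData V Γ w S U f) (c : E) :
    IsRicciTypeData ((· + c) ⁻¹' V) (fun x => Γ (x + c)) (fun x => w (x + c)) (fun x => S (x + c))
      (fun x => U (x + c)) (fun x => f (x + c)) where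
  isOpen := h.isOpen.preimage (by fun_prop)
  smooth_Γ := h.smooth_Γ.comp (by fun_prop) fun _ hx => hx
  smooth_w := h.smooth_w.comp (by fun_prop) fun _ hx => hx
  alternating x hx := h.alternating _ hx
  nondegenerate x hx := h.nondegenerate _ hx
  symm x hx := h.symm _ hx
  parallel x hx := by
    have e : fderiv ℝ (fun y => w (y + c)) x = fderiv ℝ w (x + c) := fderiv_comp_add_right c
    rw [e]
    exact h.parallel _ hx
  smooth_S := h.smooth_S.comp (by fun_prop) fun _ hx => hx
  smooth_U := h.smooth_U.comp (by fun_prop) fun _ hx => hx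
  smooth_f := h.smooth_f.comp (by fun_prop) fun _ hx => hx
  form_S x hx := h.form_S _ hx
  curv x hx u v z := by
    have e : fderiv ℝ (fun y => Γ (y + c)) x = fderiv ℝ Γ (x + c) := fderiv_comp_add_right c
    rw [chartCurv, e]
    exact h.curv _ hx u v z
  fderiv_S x hx := by simpa only [fderiv_comp_add_right] using h.fderiv_S _ hx
  fderiv_U x hx := by simpa only [fderiv_comp_add_right] using h.fderiv_U _ hx
  fderiv_f x hx := by simpa only [fderiv_comp_add_right] using h.fderiv_f _ hx

lemma IsDevelopment.translate {A : BigSpace n →L[ℝ] BigSpace n} {Φ : E → BigSpace n}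
    {B : E → E →L[ℝ] BigSpace n} {α : E → E →L[ℝ] ℝ} (h : IsDevelopment A V Γ w Φ B α) (c : E) :
    IsDevelopment A ((· + c) ⁻¹' V) (fun x => Γ (x + c)) (fun x => w (x + c)) (fun x => Φ (x + c))
      (fun x => B (x + c)) (fun x => α (x + c)) where
  isOpen := h.isOpen.preimage (by fun_prop)
  smooth_Φ := h.smooth_Φ.comp (by fun_prop) fun _ hx => hx
  smooth_B := h.smooth_B.comp (by fun_prop) fun _ hx => hx
  smooth_α := h.smooth_α.comp (by fun_prop) fun _ hx => hx
  omega_A x hx := h.omega_A _ hx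
  omega_B x hx := h.omega_B _ hx
  omega_A_B x hx := h.omega_A_B _ hx
  omega_B_B x hx := h.omega_B_B _ hx
  fderiv_Φ x hx := by simpa only [fderiv_comp_add_right] using h.fderiv_Φ _ hx
  fderiv_B x hx := by simpa only [fderiv_comp_add_right] using h.fderiv_B _ hx

end

variable [InnerProductSpace ℝ E] [FiniteDimensional ℝ E] {V : Set E}
  {Γ : E → E →L[ℝ] E →L[ℝ] E} {w : E → E →L[ℝ] E →L[ℝ] ℝ} {S : E → E →L[ℝ] E}
  {U : E → E} {f : E → ℝ}

theorem IsRicciTypeData.exists_development_zero (h : IsRicciTypeData V Γ w S U f)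
    (hdim : Module.finrank ℝ E = 2 * n) (h0 : 0 ∈ V) :
    ∃ V', 0 ∈ V' ∧ ∃ A : BigSpace n →L[ℝ] BigSpace n, InSp A ∧ ∃ Φ B α,
      IsDevelopment A V' Γ w Φ B α ∧ V' ⊆ V ∧ Φ 0 = e0 n := by
  obtain ⟨r, hr, hrV⟩ := Metric.isOpen_iff.1 h.isOpen 0 h0
  have hb := h.mono isOpen_ball hrV
  obtain ⟨ρ₁, hρ₁, hρ₁r, α, hα, hdα⟩ := exists_primitive_of_closed hr hb.smooth_w
    (fun x hx => eq_neg_of_alternating (hb.alternating x hx))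
    (fun x hx => form_closed hb.toIsSymplecticChart hx)
  have hb₁ := hb.mono isOpen_ball (ball_subset_ball hρ₁r)
  obtain ⟨F₀, hF₀, hF₀w⟩ := exists_symplectic_frame (n := n) hdim (h.alternating 0 h0)
  obtain ⟨ρ, hρ, hρρ₁, F, hF0, hFs, hFf⟩ := exists_parallel_frame hρ₁
    (hb₁.contDiffOn_flatConn hα.contDiffOn)
    (fun x hx => hb₁.flatConn_flat hα.contDiffOn hdα hx) F₀
  have hb₂ := hb₁.mono isOpen_ball (ball_subset_ball hρρ₁)
  obtain ⟨A, hA, hAF⟩ := exists_matrix_of_symplectic_frame hdim (h.nondegenerate 0 h0) hF₀w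
    (fibreEnd w S U f 0) (IsRicciTypeData.fibreEnd_fibreForm (h.alternating 0 h0) (h.form_S 0 h0))
  refine ⟨ball 0 ρ, mem_ball_self hρ, A, hA, _, _, α, isDevelopment_of_parallel_frame hb₂
    hα.contDiffOn hFs hFf
    (fun x hx => omega_parallel_frame hb₂ hα.contDiffOn hFs hFf (by rwa [hF0]) hx)
    (fun x hx => end_parallel_frame hb₂ hα.contDiffOn hFs hFf (by rwa [hF0]) hx),
    (ball_subset_ball (hρρ₁.trans hρ₁r)).trans hrV, by rw [hF0, hF₀]⟩

/-- Developments exist near every point of the chart, with prescribed value `e0 n` at the point. -/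
theorem IsRicciTypeData.exists_development (h : IsRicciTypeData V Γ w S U f)
    (hdim : Module.finrank ℝ E = 2 * n) {c : E} (hc : c ∈ V) :
    ∃ V', c ∈ V' ∧ ∃ A : BigSpace n →L[ℝ] BigSpace n, InSp A ∧ ∃ Φ B α,
      IsDevelopment A V' Γ w Φ B α ∧ V' ⊆ V ∧ Φ c = e0 n := by
  obtain ⟨V', hV', A, hA, Φ, B, α, hd, hsub, hΦ⟩ :=
    (h.translate c).exists_development_zero hdim (by simpa using hc)
  refine ⟨_, ?_, A, hA, _, _, _, by simpa using hd.translate (-c), ?_, by simpa using hΦ⟩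
  · simpa using hV'
  · intro x hx
    simpa using hsub hx

end Existence

/-! ### The flow of the Hamiltonian and changes of gauge -/

section Flow

open Metric Set

variable {n : ℕ} {A : BigSpace n →L[ℝ] BigSpace n}

lemma hasDerivAt_exp_smul_apply (A : BigSpace n →L[ℝ] BigSpace n) (x : BigSpace n) (t : ℝ) :
    HasDerivAt (fun s : ℝ => NormedSpace.exp (s • A) x) (A (NormedSpace.exp (t • A) x)) t :=
  (ContinuousLinearMap.apply ℝ (BigSpace n) x).hasFDerivAt.comp_hasDerivAt t
    (hasDerivAt_exp_smul_const' (𝕂 := ℝ) A t)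

lemma contDiff_exp_smul (A : BigSpace n →L[ℝ] BigSpace n) :
    ContDiff ℝ ∞ fun t : ℝ => NormedSpace.exp (t • A) :=
  (contDiff_iff_contDiffAt.2 fun x => (NormedSpace.exp_analytic (𝕂 := ℝ) x).contDiffAt).comp
    (contDiff_id.smul contDiff_const)

lemma exp_apply_comm (A : BigSpace n →L[ℝ] BigSpace n) (t : ℝ) (x : BigSpace n) :
    A (NormedSpace.exp (t • A) x) = NormedSpace.exp (t • A) (A x) := by
  have h : Commute A (NormedSpace.exp (t • A)) := ((Commute.refl A).smul_right t).exp_right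
  exact congrArg (fun T : BigSpace n →L[ℝ] BigSpace n => T x) h.eq

lemma exp_add_apply (A : BigSpace n →L[ℝ] BigSpace n) (s t : ℝ) (x : BigSpace n) :
    NormedSpace.exp ((s + t) • A) x = NormedSpace.exp (s • A) (NormedSpace.exp (t • A) x) := by
  let _ : NormedAlgebra ℚ (BigSpace n →L[ℝ] BigSpace n) := NormedAlgebra.restrictScalars ℚ ℝ _
  rw [add_smul, NormedSpace.exp_add_of_commute (((Commute.refl A).smul_right t).smul_left s)]
  rfl

lemma exp_zero_apply (A : BigSpace n →L[ℝ] BigSpace n) (x : BigSpace n) :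
    NormedSpace.exp ((0 : ℝ) • A) x = x := by
  rw [zero_smul, NormedSpace.exp_zero]
  rfl

lemma exp_neg_apply (A : BigSpace n →L[ℝ] BigSpace n) (t : ℝ) (x : BigSpace n) :
    NormedSpace.exp (t • A) (NormedSpace.exp ((-t) • A) x) = x := by
  rw [← exp_add_apply, add_neg_cancel, exp_zero_apply]

/-- The exponential of an element of `sp` is symplectic. -/
lemma omega_exp (hA : InSp A) (t : ℝ) (x y : BigSpace n) :
    Omega (NormedSpace.exp (t • A) x) (NormedSpace.exp (t • A) y) = Omega x y := by
  have hd : ∀ s, HasDerivAt (fun s : ℝ => omegaCLM (NormedSpace.exp (s • A) x)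
      (NormedSpace.exp (s • A) y)) 0 s := by
    intro s
    have h1 := ((hasDerivAt_const s (omegaCLM (n := n))).clm_apply
      (hasDerivAt_exp_smul_apply A x s)).clm_apply (hasDerivAt_exp_smul_apply A y s)
    rw [zero_apply, zero_add] at h1
    rwa [show (0 : ℝ) = _ from (hA _ _).symm]
  have h := is_const_of_deriv_eq_zero (fun s => (hd s).differentiableAt) (fun s => (hd s).deriv) t 0
  simp only [exp_zero_apply, omegaCLM_apply] at h
  exact h

/-- Moving a development along the flow of `A` by a function `t` gives a development of the same
data, with `α` replaced by `α + dt`. -/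
lemma IsDevelopment.gauge {E : Type} [NormedAddCommGroup E] [NormedSpace ℝ E]
    [FiniteDimensional ℝ E] {V V' : Set E}
    {Γ : E → E →L[ℝ] E →L[ℝ] E} {w : E → E →L[ℝ] E →L[ℝ] ℝ} {Φ : E → BigSpace n}
    {B : E → E →L[ℝ] BigSpace n} {α : E → E →L[ℝ] ℝ} (hA : InSp A)
    (h : IsDevelopment A V Γ w Φ B α) (hV' : IsOpen V') (hsub : V' ⊆ V) {t : E → ℝ}
    (ht : ContDiffOn ℝ ∞ t V') :
    IsDevelopment A V' Γ w (fun x => NormedSpace.exp (t x • A) (Φ x))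
      (fun x => NormedSpace.exp (t x • A) ∘L B x) (fun x => α x + fderiv ℝ t x) := by
  have he : ContDiffOn ℝ ∞ (fun x => NormedSpace.exp (t x • A)) V' :=
    (contDiff_exp_smul A).comp_contDiffOn ht
  have hde : ∀ x ∈ V', ∀ (g : E → BigSpace n) (u : E), DifferentiableAt ℝ g x →
      fderiv ℝ (fun x => NormedSpace.exp (t x • A) (g x)) x u
        = NormedSpace.exp (t x • A) (fderiv ℝ g x u)
          + fderiv ℝ t x u • A (NormedSpace.exp (t x • A) (g x)) := by
    intro x hx g u hg
    have h1 : HasFDerivAt (fun x => NormedSpace.exp (t x • A)) _ x :=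
      HasFDerivAt.comp (g := fun t : ℝ => NormedSpace.exp (t • A)) x
        (hasDerivAt_exp_smul_const' (𝕂 := ℝ) A (t x)).hasFDerivAt
        (differentiableAt_of_smoothOn hV' ht hx).hasFDerivAt
    rw [(h1.clm_apply hg.hasFDerivAt).fderiv]
    simp
  refine ⟨hV', he.clm_apply (h.smooth_Φ.mono hsub), he.clm_comp (h.smooth_B.mono hsub),
    (h.smooth_α.mono hsub).add (smoothOn_fderiv hV' ht), fun x hx => ?_, fun x hx u => ?_,
    fun x hx u => ?_, fun x hx u v => ?_, fun x hx u => ?_, fun x hx u v => ?_⟩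
  · rw [exp_apply_comm, omega_exp hA, h.omega_A x (hsub hx)]
  · rw [ContinuousLinearMap.comp_apply, omega_exp hA, h.omega_B x (hsub hx)]
  · rw [ContinuousLinearMap.comp_apply, exp_apply_comm, omega_exp hA, h.omega_A_B x (hsub hx)]
  · rw [ContinuousLinearMap.comp_apply, ContinuousLinearMap.comp_apply, omega_exp hA,
      h.omega_B_B x (hsub hx)]
  · rw [hde x hx _ _ (differentiableAt_of_smoothOn h.isOpen h.smooth_Φ (hsub hx)),
      h.fderiv_Φ x (hsub hx)]
    simp only [map_add, map_smul, add_apply, ContinuousLinearMap.comp_apply, exp_apply_comm]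
    module
  · have hB := differentiableAt_of_smoothOn h.isOpen h.smooth_B (hsub hx)
    have hBv := hB.clm_apply (differentiableAt_const v)
    have h1 : fderiv ℝ (fun x => NormedSpace.exp (t x • A) ∘L B x) x u v
        = fderiv ℝ (fun x => NormedSpace.exp (t x • A) (B x v)) x u := by
      have h2 := (differentiableAt_of_smoothOn hV' (he.clm_comp (h.smooth_B.mono hsub))
        hx).hasFDerivAt.clm_apply (hasFDerivAt_const v x)
      have h3 := h2.fderiv
      simp only [ContinuousLinearMap.comp_apply] at h3
      rw [h3]
      simp
    have h4 : fderiv ℝ (fun x => B x v) x u = fderiv ℝ B x u v := by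
      rw [(hB.hasFDerivAt.clm_apply (hasFDerivAt_const v x)).fderiv]
      simp
    rw [h1, hde x hx _ _ hBv, h4, h.fderiv_B x (hsub hx)]
    simp only [map_add, map_sub, map_smul, add_apply, ContinuousLinearMap.comp_apply,
      exp_apply_comm, omega_exp hA]
    module

end Flow

/-! ### The inverse function theorem -/

section Inverse

variable {E F : Type*} [NormedAddCommGroup E] [NormedSpace ℝ E] [CompleteSpace E]
  [NormedAddCommGroup F] [NormedSpace ℝ F]

/-- A version of the inverse function theorem which provides smoothness of the local inverse on its
whole domain. -/
lemma exists_local_diffeo {f : E → F} {V : Set E} (hV : IsOpen V) (hf : ContDiffOn ℝ ∞ f V) {c : E}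
    (hc : c ∈ V) {e : E ≃L[ℝ] F} (he : fderiv ℝ f c = e) :
    ∃ φ : OpenPartialHomeomorph E F, c ∈ φ.source ∧ φ.source ⊆ V ∧ ⇑φ = f ∧
      ContDiffOn ℝ ∞ φ.symm φ.target := by
  have hfc := hf.contDiffAt (hV.mem_nhds hc)
  have hs : HasStrictFDerivAt f (e : E →L[ℝ] F) c := by
    rw [← he]
    exact hfc.hasStrictFDerivAt (by simp)
  set φ₀ := hs.toOpenPartialHomeomorph f with hφ₀
  have hW : IsOpen (V ∩ fderiv ℝ f ⁻¹' Set.range ((↑) : (E ≃L[ℝ] F) → E →L[ℝ] F)) :=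
    (hf.continuousOn_fderiv_of_isOpen hV (by simp)).isOpen_inter_preimage hV
      ContinuousLinearEquiv.isOpen
  refine ⟨φ₀.restrOpen _ hW, ⟨hs.mem_toOpenPartialHomeomorph_source, hc, e, he.symm⟩,
    fun x hx => hx.2.1, rfl, fun y hy => ?_⟩
  have hx := (φ₀.restrOpen _ hW).map_target hy
  obtain ⟨e', he'⟩ := hx.2.2
  have hd := hf.contDiffAt (hV.mem_nhds hx.2.1)
  refine (OpenPartialHomeomorph.contDiffAt_symm (φ₀.restrOpen _ hW) hy (f₀' := e') ?_
    hd).contDiffWithinAt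
  rw [he']
  exact (hd.differentiableAt (by simp)).hasFDerivAt

end Inverse

/-! ### Local reductions -/

section LocalReductions

open Metric Set

variable {n : ℕ} {A : BigSpace n →L[ℝ] BigSpace n}

lemma mem_constraintSurface_iff {x : BigSpace n} :
    x ∈ constraintSurface A ↔ Omega x (A x) = 1 := by
  simp only [constraintSurface, hamiltonian, Set.mem_ofPred_eq]
  constructor <;> intro h <;> linarith

/-- Coordinates on `ℝ^{2n+2}` adapted to a point `x₀` and the vector field `A`. -/
lemma exists_slice_coordinates {x₀ v₀ : BigSpace n} (h : Omega x₀ v₀ = 1) :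
    ∃ (ι : EuclideanSpace ℝ (Fin (2 * n)) →L[ℝ] BigSpace n)
      (e : (EuclideanSpace ℝ (Fin (2 * n)) × ℝ × ℝ) ≃L[ℝ] BigSpace n),
      ∀ y t r, e (y, t, r) = ι y - t • v₀ + r • x₀ := by
  have hself : ∀ x : BigSpace n, Omega x x = 0 := fun x => by linarith [omega_neg x x]
  have hli : LinearIndependent ℝ ![x₀, v₀] := by
    rw [LinearIndependent.pair_iff]
    intro a b hab
    have h1 := congrArg (fun z => omegaCLM z v₀) hab
    have h2 := congrArg (fun z => omegaCLM z x₀) hab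
    simp only [map_add, map_smul, add_apply, smul_apply, omegaCLM_apply, hself, h,
      omega_neg v₀ x₀, smul_eq_mul, map_zero, zero_apply] at h1 h2
    exact ⟨by linarith, by linarith⟩
  have hspan : Module.finrank ℝ (Submodule.span ℝ {x₀, v₀}) = 2 := by
    have := finrank_span_eq_card hli
    rwa [Matrix.range_cons, Matrix.range_cons, Matrix.range_empty, Set.union_empty,
      Set.singleton_union, Fintype.card_fin] at this
  obtain ⟨N, hN⟩ := Submodule.exists_isCompl (Submodule.span ℝ {x₀, v₀})
  have hNd : Module.finrank ℝ N = 2 * n := by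
    have := Submodule.finrank_add_eq_of_isCompl hN
    rw [hspan] at this
    simp at this
    omega
  let g : EuclideanSpace ℝ (Fin (2 * n)) ≃ₗ[ℝ] N := LinearEquiv.ofFinrankEq _ _ (by simp [hNd])
  let ι : EuclideanSpace ℝ (Fin (2 * n)) →ₗ[ℝ] BigSpace n := N.subtype ∘ₗ g
  let T : (EuclideanSpace ℝ (Fin (2 * n)) × ℝ × ℝ) →ₗ[ℝ] BigSpace n :=
    { toFun := fun q => ι q.1 - q.2.1 • v₀ + q.2.2 • x₀
      map_add' := fun p q => by simp only [Prod.fst_add, Prod.snd_add, map_add]; module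
      map_smul' := fun c q => by
        simp only [Prod.smul_fst, Prod.smul_snd, map_smul, smul_eq_mul, RingHom.id_apply]; module }
  have hT : Function.Injective T := by
    rw [injective_iff_map_eq_zero]
    rintro ⟨y, t, r⟩ hq
    have hq' : ι y - t • v₀ + r • x₀ = 0 := hq
    have h1 : ι y ∈ Submodule.span ℝ {x₀, v₀} :=
      Submodule.mem_span_pair.2 ⟨-r, t, by
        rw [← sub_eq_zero, ← neg_eq_zero, ← hq']; module⟩
    have h2 : ι y = 0 := (Submodule.disjoint_def.1 hN.disjoint) _ h1 (g y).2
    have h3 : y = 0 := by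
      have : g y = 0 := Subtype.ext h2
      simpa using this
    rw [h2] at hq'
    have h4 := LinearIndependent.pair_iff.1 hli r (-t) (by rw [← hq']; module)
    simp [h3, h4.1, neg_eq_zero.1 h4.2]
  refine ⟨ι.toContinuousLinearMap, (LinearEquiv.ofInjectiveOfFinrankEq T hT
    (by simp; ring)).toContinuousLinearEquiv, fun y t r => rfl⟩

/-- Local reductions exist: the flow of `A` out of a slice, rescaled so as to lie in the constraint
surface, is a local diffeomorphism by the inverse function theorem. -/
theorem nonempty_localReduction (hA : InSp A) {x₀ : BigSpace n} (h0 : x₀ ∈ constraintSurface A) :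
    Nonempty (LocalReduction A x₀) := by
  rw [mem_constraintSurface_iff] at h0
  obtain ⟨ι, e, he⟩ := exists_slice_coordinates h0
  set z : EuclideanSpace ℝ (Fin (2 * n)) → BigSpace n := fun y => x₀ + ι y with hz
  set h : EuclideanSpace ℝ (Fin (2 * n)) → ℝ := fun y => Omega (z y) (A (z y)) with hh
  set Ψ : EuclideanSpace ℝ (Fin (2 * n)) × ℝ × ℝ → BigSpace n :=
    fun q => q.2.2 • NormedSpace.exp ((-q.2.1) • A) (z q.1) with hΨ
  have hzs : ContDiff ℝ ∞ z := contDiff_const.add ι.contDiff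
  have hhs : ContDiff ℝ ∞ h :=
    (contDiff_const (c := omegaCLM (n := n))).clm_apply hzs |>.clm_apply (A.contDiff.comp hzs)
  have hΨs : ContDiff ℝ ∞ Ψ := by
    have h1 : ContDiff ℝ ∞ fun q : EuclideanSpace ℝ (Fin (2 * n)) × ℝ × ℝ =>
      NormedSpace.exp ((-q.2.1) • A) := (contDiff_exp_smul A).comp (contDiff_snd.fst.neg)
    exact contDiff_snd.snd.smul (h1.clm_apply (hzs.comp contDiff_fst))
  have hz0 : z 0 = x₀ := by simp [hz]
  have hh0 : h 0 = 1 := by simp [hh, hz0, h0]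
  have hc : fderiv ℝ Ψ (0, 0, 1) = e := by
    have h1 : HasFDerivAt (fun q : EuclideanSpace ℝ (Fin (2 * n)) × ℝ × ℝ =>
        NormedSpace.exp ((-q.2.1) • A)) _ (0, 0, 1) :=
      HasFDerivAt.comp (g := fun t : ℝ => NormedSpace.exp (t • A))
        (f := fun q : EuclideanSpace ℝ (Fin (2 * n)) × ℝ × ℝ => -q.2.1) (0, 0, 1)
        (hasDerivAt_exp_smul_const' (𝕂 := ℝ) A (-0)).hasFDerivAt
        (hasFDerivAt_snd (𝕜 := ℝ)
          (p := ((0 : EuclideanSpace ℝ (Fin (2 * n))), (0 : ℝ), (1 : ℝ)))).fst.neg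
    have h2 : HasFDerivAt (fun q : EuclideanSpace ℝ (Fin (2 * n)) × ℝ × ℝ => z q.1)
        (ι ∘L ContinuousLinearMap.fst ℝ _ _) (0, 0, 1) :=
      ((ι.hasFDerivAt.comp _ hasFDerivAt_fst).const_add x₀)
    have h3 : HasFDerivAt (fun q : EuclideanSpace ℝ (Fin (2 * n)) × ℝ × ℝ => q.2.2) _ (0, 0, 1) :=
      (hasFDerivAt_snd (𝕜 := ℝ)
        (p := ((0 : EuclideanSpace ℝ (Fin (2 * n))), (0 : ℝ), (1 : ℝ)))).snd
    have h4 : HasFDerivAt Ψ _ (0, 0, 1) := h3.smul (h1.clm_apply h2)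
    rw [h4.fderiv]
    refine ContinuousLinearMap.ext fun ⟨y, t, r⟩ => ?_
    simp [he, hz0]
    abel
  obtain ⟨φ, hφ0, -, hφ, hφs⟩ := exists_local_diffeo isOpen_univ hΨs.contDiffOn (mem_univ _) hc
  -- a product neighbourhood on which `h > 0` and the rescaled slice stays in the chart
  have hP : IsOpen {q : EuclideanSpace ℝ (Fin (2 * n)) × ℝ | 0 < h q.1} :=
    isOpen_lt continuous_const (hhs.continuous.comp continuous_fst)
  set j : EuclideanSpace ℝ (Fin (2 * n)) × ℝ → EuclideanSpace ℝ (Fin (2 * n)) × ℝ × ℝ :=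
    fun q => (q.1, q.2, (Real.sqrt (h q.1))⁻¹) with hj
  have hjs : ContDiffOn ℝ ∞ j {q | 0 < h q.1} := by
    have h1 : ContDiffOn ℝ ∞ (fun q : EuclideanSpace ℝ (Fin (2 * n)) × ℝ => h q.1)
      {q | 0 < h q.1} := (hhs.comp contDiff_fst).contDiffOn
    exact contDiff_fst.contDiffOn.prodMk (contDiff_snd.contDiffOn.prodMk
      ((h1.sqrt fun q hq => (ne_of_gt hq)).inv fun q hq => (Real.sqrt_pos.2 hq).ne'))
  have hW : IsOpen ({q | 0 < h q.1} ∩ j ⁻¹' φ.source) :=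
    hjs.continuousOn.isOpen_inter_preimage hP φ.open_source
  have h0W : ((0 : EuclideanSpace ℝ (Fin (2 * n))), (0 : ℝ)) ∈
      {q : EuclideanSpace ℝ (Fin (2 * n)) × ℝ | 0 < h q.1} ∩ j ⁻¹' φ.source := by
    refine ⟨by simp [hh0], ?_⟩
    simpa [hj, hh0] using hφ0
  obtain ⟨ρ, hρ, hρW⟩ := Metric.isOpen_iff.1 hW _ h0W
  have hsub : ∀ q ∈ ball (0 : EuclideanSpace ℝ (Fin (2 * n))) ρ ×ˢ Ioo (-ρ) ρ,
      0 < h q.1 ∧ j q ∈ φ.source := by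
    intro q hq
    apply hρW
    rw [mem_ball, Prod.dist_eq, max_lt_iff]
    exact ⟨hq.1, by rw [Real.dist_eq, sub_zero, abs_lt]; exact hq.2⟩
  have hBo : IsOpen (ball (0 : EuclideanSpace ℝ (Fin (2 * n))) ρ ×ˢ Ioo (-ρ) ρ) :=
    isOpen_ball.prod isOpen_Ioo
  have hΨω : ∀ q, Omega (Ψ q) (A (Ψ q)) = q.2.2 ^ 2 * h q.1 := by
    intro q
    simp only [hΨ, map_smul, exp_apply_comm, hh]
    rw [← omegaCLM_apply, map_smul, map_smul, smul_apply, omegaCLM_apply, omega_exp hA]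
    simp only [smul_eq_mul]
    ring
  have hjΨ : ∀ q ∈ ball (0 : EuclideanSpace ℝ (Fin (2 * n))) ρ ×ˢ Ioo (-ρ) ρ,
      φ.symm (Ψ (j q)) = j q := fun q hq => by
    rw [← hφ]; exact φ.left_inv (hsub q hq).2
  refine ⟨{
    radius := ρ
    eps := ρ
    radius_pos := hρ
    eps_pos := hρ
    chi := fun q => Ψ (j q)
    O := φ.target ∩ φ.symm ⁻¹' {q | (q.1, q.2.1) ∈
      ball (0 : EuclideanSpace ℝ (Fin (2 * n))) ρ ×ˢ Ioo (-ρ) ρ ∧ 0 < q.2.2}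
    psi := fun x => ((φ.symm x).1, (φ.symm x).2.1)
    isOpen_O := φ.symm.continuousOn.isOpen_inter_preimage φ.open_target
      ((hBo.preimage (continuous_fst.prodMk continuous_snd.fst)).inter
        (isOpen_lt continuous_const continuous_snd.snd))
    chi_smooth := hΨs.comp_contDiffOn (hjs.mono fun q hq => (hsub q hq).1)
    psi_smooth := by
      have h1 := hφs.mono (inter_subset_left : φ.target ∩ φ.symm ⁻¹' {q | (q.1, q.2.1) ∈
        ball (0 : EuclideanSpace ℝ (Fin (2 * n))) ρ ×ˢ Ioo (-ρ) ρ ∧ 0 < q.2.2} ⊆ φ.target)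
      exact h1.fst.prodMk h1.snd.fst
    image_chi := ?_
    psi_chi := fun q hq => by
      rw [hjΨ q hq]
    chi_zero := by simp [hΨ, hj, hh0, hz0]
    chi_flow := fun y hy t ht => by
      simp only [hΨ, hj, map_smul, neg_zero, zero_smul, NormedSpace.exp_zero]
      rfl }⟩
  ext x
  constructor
  · rintro ⟨q, hq, rfl⟩
    have hpos := (hsub q hq).1
    refine ⟨⟨?_, ?_⟩, ?_⟩
    · rw [← hφ]; exact φ.map_source (hsub q hq).2
    · simp only [mem_preimage, hjΨ q hq]
      exact ⟨hq, inv_pos.2 (Real.sqrt_pos.2 hpos)⟩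
    · rw [mem_constraintSurface_iff, hΨω]
      simp only [hj, inv_pow, Real.sq_sqrt hpos.le]
      exact inv_mul_cancel₀ hpos.ne'
  · rintro ⟨⟨hx, hxB, hr⟩, hxA⟩
    have hx' : Ψ (φ.symm x) = x := by rw [← hφ]; exact φ.right_inv hx
    refine ⟨_, hxB, ?_⟩
    rw [mem_constraintSurface_iff, ← hx', hΨω] at hxA
    have hpos := (hsub _ hxB).1
    have h1 : (Real.sqrt (h (φ.symm x).1))⁻¹ = (φ.symm x).2.2 := by
      rw [inv_eq_iff_eq_inv, Real.sqrt_eq_iff_mul_self_eq hpos.le (inv_pos.2 hr).le]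
      field_simp
      linarith
    simp only [hj, h1]
    exact hx'

namespace LocalReduction

variable {x₀ : BigSpace n} (L : LocalReduction A x₀)

/-- The domain `D × I` of the parametrization. -/
abbrev dom : Set (EuclideanSpace ℝ (Fin (2 * n)) × ℝ) :=
  ball 0 L.radius ×ˢ Ioo (-L.eps) L.eps

lemma isOpen_dom : IsOpen L.dom := isOpen_ball.prod isOpen_Ioo

lemma zero_mem_I : (0 : ℝ) ∈ Ioo (-L.eps) L.eps := ⟨by linarith [L.eps_pos], L.eps_pos⟩

lemma slice_mem_dom {y : EuclideanSpace ℝ (Fin (2 * n))} (hy : y ∈ L.D) : (y, (0 : ℝ)) ∈ L.dom :=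
  ⟨hy, L.zero_mem_I⟩

lemma chi_mem {q : EuclideanSpace ℝ (Fin (2 * n)) × ℝ} (hq : q ∈ L.dom) :
    L.chi q ∈ L.O ∩ constraintSurface A := L.image_chi ▸ mem_image_of_mem _ hq

lemma psi_slice {y : EuclideanSpace ℝ (Fin (2 * n))} (hy : y ∈ L.D) :
    L.psi (L.slice y) = (y, 0) := L.psi_chi _ (L.slice_mem_dom hy)

lemma psi_mem {x : BigSpace n} (hx : x ∈ L.O ∩ constraintSurface A) :
    L.psi x ∈ L.dom ∧ L.chi (L.psi x) = x := by
  rw [← L.image_chi] at hx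
  obtain ⟨q, hq, rfl⟩ := hx
  rw [L.psi_chi q hq]
  exact ⟨hq, rfl⟩

lemma differentiableAt_chi {q : EuclideanSpace ℝ (Fin (2 * n)) × ℝ} (hq : q ∈ L.dom) :
    DifferentiableAt ℝ L.chi q := differentiableAt_of_smoothOn L.isOpen_dom L.chi_smooth hq

lemma chi_eq_exp {y : EuclideanSpace ℝ (Fin (2 * n))} {t : ℝ} (h : (y, t) ∈ L.dom) :
    L.chi (y, t) = NormedSpace.exp ((-t) • A) (L.slice y) := L.chi_flow y h.1 t h.2

lemma fderiv_chi {y : EuclideanSpace ℝ (Fin (2 * n))} {t : ℝ} (h : (y, t) ∈ L.dom)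
    (v : EuclideanSpace ℝ (Fin (2 * n))) (s : ℝ) :
    fderiv ℝ L.chi (y, t) (v, s) = NormedSpace.exp ((-t) • A) (fderiv ℝ L.slice y v)
      - s • A (L.chi (y, t)) := by
  have h1 := (L.differentiableAt_chi h).hasFDerivAt
  have hsl : HasFDerivAt L.slice _ y :=
    HasFDerivAt.comp (g := L.chi) y (L.differentiableAt_chi (L.slice_mem_dom h.1)).hasFDerivAt
      ((hasFDerivAt_id y).prodMk (hasFDerivAt_const (0 : ℝ) y))
  have h2 : HasFDerivAt (fun q : EuclideanSpace ℝ (Fin (2 * n)) × ℝ =>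
      NormedSpace.exp ((-q.2) • A)) _ (y, t) :=
    HasFDerivAt.comp (g := fun t : ℝ => NormedSpace.exp (t • A))
      (f := fun q : EuclideanSpace ℝ (Fin (2 * n)) × ℝ => -q.2) (y, t)
      (hasDerivAt_exp_smul_const' (𝕂 := ℝ) A (-t)).hasFDerivAt hasFDerivAt_snd.neg
  have h3 := (h2.clm_apply (HasFDerivAt.comp (y, t) hsl hasFDerivAt_fst)).congr_of_eventuallyEq
    (Filter.eventually_of_mem (L.isOpen_dom.mem_nhds h) fun q hq => L.chi_eq_exp (y := q.1)
      (t := q.2) hq)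
  rw [h1.unique h3, L.chi_eq_exp h, hsl.fderiv]
  simp
  abel

lemma differentiableAt_slice {y : EuclideanSpace ℝ (Fin (2 * n))} (hy : y ∈ L.D) :
    DifferentiableAt ℝ L.slice y :=
  ((L.differentiableAt_chi (L.slice_mem_dom hy)).hasFDerivAt.comp (g := L.chi) y
    ((hasFDerivAt_id y).prodMk (hasFDerivAt_const (0 : ℝ) y))).differentiableAt

/-- The horizontal lift is equivariant under the flow of `A`. -/
lemma lift_exp (hA : InSp A) {y : EuclideanSpace ℝ (Fin (2 * n))} {t : ℝ} (h : (y, t) ∈ L.dom)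
    (v : EuclideanSpace ℝ (Fin (2 * n))) :
    L.lift (L.chi (y, t)) v = NormedSpace.exp ((-t) • A) (L.lift (L.slice y) v) := by
  have h0 := L.slice_mem_dom (y := y) h.1
  have hsl : L.chi (y, 0) = L.slice y := rfl
  rw [lift, lift, L.psi_chi _ h, L.psi_slice h.1, L.fderiv_chi h, L.fderiv_chi h0,
    L.fderiv_chi h, L.fderiv_chi h0, hsl, L.chi_eq_exp h]
  simp only [zero_smul, sub_zero, neg_zero, omega_exp hA, map_sub, map_smul,
    exp_apply_comm]
  simp

/-- On the slice `t = 0` the horizontal lift is the derivative of the slice, corrected by a multiple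
of the direction `A x` of the flow. -/
lemma lift_slice {y : EuclideanSpace ℝ (Fin (2 * n))} (hy : y ∈ L.D)
    (v : EuclideanSpace ℝ (Fin (2 * n))) :
    L.lift (L.slice y) v = fderiv ℝ L.slice y v
      - Omega (L.slice y) (fderiv ℝ L.slice y v) • A (L.slice y) := by
  have h0 := L.slice_mem_dom (y := y) hy
  have hsl : L.chi (y, 0) = L.slice y := rfl
  rw [lift, L.psi_slice hy, L.fderiv_chi h0, L.fderiv_chi h0, hsl]
  simp

lemma differentiableAt_liftField {x : BigSpace n} (hx : x ∈ L.O ∩ constraintSurface A)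
    {Y : EuclideanSpace ℝ (Fin (2 * n)) → EuclideanSpace ℝ (Fin (2 * n))}
    (hY : DifferentiableAt ℝ Y (L.proj x)) : DifferentiableAt ℝ (L.liftField Y) x := by
  have hp := differentiableAt_of_smoothOn L.isOpen_O L.psi_smooth hx.1
  have hYp : DifferentiableAt ℝ (fun x => Y (L.proj x)) x := hY.comp x hp.fst
  have hc : DifferentiableAt ℝ (fun x => fderiv ℝ L.chi (L.psi x)) x :=
    (differentiableAt_of_smoothOn L.isOpen_dom (smoothOn_fderiv L.isOpen_dom L.chi_smooth)
      (L.psi_mem hx).1).comp x hp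
  have h1 : DifferentiableAt ℝ (fun x => omegaCLM x (fderiv ℝ L.chi (L.psi x)
      (Y (L.proj x), 0))) x :=
    ((omegaCLM (n := n)).differentiableAt.clm_apply
      (hc.clm_apply (hYp.prodMk (differentiableAt_const 0))))
  exact hc.clm_apply (hYp.prodMk h1)

end LocalReduction

end LocalReductions

/-! ### Developments and reduced data -/

section Transfer

open Metric Set

variable {n : ℕ} {A : BigSpace n →L[ℝ] BigSpace n} {x₀ : BigSpace n} (L : LocalReduction A x₀)
  {V : Set (EuclideanSpace ℝ (Fin (2 * n)))}
  {Γ : EuclideanSpace ℝ (Fin (2 * n)) → EuclideanSpace ℝ (Fin (2 * n)) →L[ℝ]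
    EuclideanSpace ℝ (Fin (2 * n)) →L[ℝ] EuclideanSpace ℝ (Fin (2 * n))}
  {w : EuclideanSpace ℝ (Fin (2 * n)) → EuclideanSpace ℝ (Fin (2 * n)) →L[ℝ]
    EuclideanSpace ℝ (Fin (2 * n)) →L[ℝ] ℝ}
  {Φ : EuclideanSpace ℝ (Fin (2 * n)) → BigSpace n}
  {B : EuclideanSpace ℝ (Fin (2 * n)) → EuclideanSpace ℝ (Fin (2 * n)) →L[ℝ] BigSpace n}
  {α : EuclideanSpace ℝ (Fin (2 * n)) → EuclideanSpace ℝ (Fin (2 * n)) →L[ℝ] ℝ}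
  {g : EuclideanSpace ℝ (Fin (2 * n)) → EuclideanSpace ℝ (Fin (2 * n))}

namespace IsDevelopment

variable (h : IsDevelopment A V Γ w Φ B α) (hg : ContDiffOn ℝ ∞ g V)
  (hgD : ∀ x ∈ V, g x ∈ L.D) (hgΦ : ∀ x ∈ V, L.slice (g x) = Φ x)
include h hg hgD hgΦ

/-- The frame `B` consists of the horizontal lifts. -/
lemma lift_fderiv {x : EuclideanSpace ℝ (Fin (2 * n))} (hx : x ∈ V)
    (X : EuclideanSpace ℝ (Fin (2 * n))) : L.lift (Φ x) (fderiv ℝ g x X) = B x X := by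
  have h1 : fderiv ℝ L.slice (g x) (fderiv ℝ g x X) = B x X + α x X • A (Φ x) := by
    rw [← h.fderiv_Φ x hx]
    have h2 := ((L.differentiableAt_slice (hgD x hx)).hasFDerivAt.comp x
      (differentiableAt_of_smoothOn h.isOpen hg hx).hasFDerivAt).congr_of_eventuallyEq
      (Filter.eventually_of_mem (h.isOpen.mem_nhds hx) fun y hy => (hgΦ y hy).symm)
    rw [h2.fderiv]
    rfl
  rw [← hgΦ x hx, L.lift_slice (hgD x hx), h1, hgΦ x hx, ← omegaCLM_apply, map_add, map_smul,
    omegaCLM_apply, omegaCLM_apply, h.omega_A x hx, h.omega_B x hx]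
  simp

lemma reducedForm_eq {x : EuclideanSpace ℝ (Fin (2 * n))} (hx : x ∈ V)
    (X Y : EuclideanSpace ℝ (Fin (2 * n))) :
    L.reducedForm (g x) (fderiv ℝ g x X) (fderiv ℝ g x Y) = w x X Y := by
  rw [LocalReduction.reducedForm, hgΦ x hx, h.lift_fderiv L hg hgD hgΦ hx,
    h.lift_fderiv L hg hgD hgΦ hx, h.omega_B_B x hx]

lemma fderiv_injective (hnd : ∀ x ∈ V, ∀ u, (∀ v, w x u v = 0) → u = 0)
    {x : EuclideanSpace ℝ (Fin (2 * n))} (hx : x ∈ V) :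
    Function.Injective (fderiv ℝ g x) := by
  rw [injective_iff_map_eq_zero]
  intro X hX
  refine hnd x hx X fun Y => ?_
  rw [← h.omega_B_B x hx, ← h.lift_fderiv L hg hgD hgΦ hx X, hX, ← hgΦ x hx,
    L.lift_slice (hgD x hx), map_zero, ← omegaCLM_apply, ← omegaCLM_apply, map_zero]
  simp

/-- The reduced connection is the connection with Christoffel symbols `Γ`. The derivative of the
lifted field along the horizontal vector `B X = DΦ(X) - α(X) AΦ` is computed along the image of `Φ`,
where the lifted field is `B Y`, and along the flow of `A`, under which it is equivariant. -/
lemma reducedConnection_eq (hA : InSp A) {x : EuclideanSpace ℝ (Fin (2 * n))} (hx : x ∈ V)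
    (X : EuclideanSpace ℝ (Fin (2 * n)))
    {Y Y' : EuclideanSpace ℝ (Fin (2 * n)) → EuclideanSpace ℝ (Fin (2 * n))}
    (hY : DifferentiableAt ℝ Y x) (hY' : DifferentiableAt ℝ Y' (g x))
    (hYY' : ∀ᶠ z in 𝓝 x, Y' (g z) = fderiv ℝ g z (Y z)) :
    L.reducedConnection (fderiv ℝ g x X) Y' (g x)
      = fderiv ℝ g x (fderiv ℝ Y x X + Γ x X (Y x)) := by
  have hxD := hgD x hx
  have hmem : Φ x ∈ L.O ∩ constraintSurface A := by
    rw [← hgΦ x hx]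
    exact L.chi_mem (L.slice_mem_dom hxD)
  have hproj : ∀ z ∈ V, L.proj (Φ z) = g z := fun z hz => by
    rw [← hgΦ z hz, LocalReduction.proj, L.psi_slice (hgD z hz)]
  have hd : DifferentiableAt ℝ (L.liftField Y') (Φ x) :=
    L.differentiableAt_liftField hmem (by rwa [hproj x hx])
  have hval : ∀ᶠ z in 𝓝 x, L.liftField Y' (Φ z) = B z (Y z) := by
    filter_upwards [hYY', h.isOpen.mem_nhds hx] with z hz hzV
    rw [LocalReduction.liftField, hproj z hzV, hz, h.lift_fderiv L hg hgD hgΦ hzV]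
  -- along the image of `Φ`
  have h1 : fderiv ℝ (L.liftField Y') (Φ x) (fderiv ℝ Φ x X)
      = fderiv ℝ B x X (Y x) + B x (fderiv ℝ Y x X) := by
    have e1 := hd.hasFDerivAt.comp x
      (differentiableAt_of_smoothOn h.isOpen h.smooth_Φ hx).hasFDerivAt
    have e2 := ((differentiableAt_of_smoothOn h.isOpen h.smooth_B hx).hasFDerivAt.clm_apply
      hY.hasFDerivAt).congr_of_eventuallyEq hval
    have e3 := congrArg (fun T => T X) (e1.unique e2)
    simp only [ContinuousLinearMap.comp_apply, add_apply, ContinuousLinearMap.flip_apply] at e3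
    rw [e3, add_comm]
  -- along the flow of `A`
  have h2 : fderiv ℝ (L.liftField Y') (Φ x) (A (Φ x)) = A (B x (Y x)) := by
    have e0 := hasDerivAt_exp_smul_apply A (Φ x) 0
    have e1 := HasFDerivAt.comp_hasDerivAt (l := L.liftField Y') (0 : ℝ)
      (by rw [exp_zero_apply]; exact hd.hasFDerivAt) e0
    have e2 := hasDerivAt_exp_smul_apply A (B x (Y x)) 0
    have e3 : (fun s : ℝ => L.liftField Y' (NormedSpace.exp (s • A) (Φ x)))
        =ᶠ[𝓝 0] fun s => NormedSpace.exp (s • A) (B x (Y x)) := by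
      filter_upwards [isOpen_Ioo.mem_nhds L.zero_mem_I] with s hs
      have hs' : (g x, -s) ∈ L.dom := ⟨hxD, by constructor <;> linarith [hs.1, hs.2]⟩
      have hchi : NormedSpace.exp (s • A) (Φ x) = L.chi (g x, -s) := by
        rw [L.chi_eq_exp hs', neg_neg, hgΦ x hx]
      rw [hchi, LocalReduction.liftField, LocalReduction.proj, L.psi_chi _ hs', L.lift_exp hA hs',
        neg_neg, hgΦ x hx, hYY'.self_of_nhds, h.lift_fderiv L hg hgD hgΦ hx]
    have e4 := e1.unique (e2.congr_of_eventuallyEq e3)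
    simpa only [exp_zero_apply] using e4
  have h3 : fderiv ℝ (L.liftField Y') (Φ x) (B x X)
      = fderiv ℝ B x X (Y x) + B x (fderiv ℝ Y x X) - α x X • A (B x (Y x)) := by
    have : B x X = fderiv ℝ Φ x X - α x X • A (Φ x) := by rw [h.fderiv_Φ x hx]; abel
    rw [this, map_sub, map_smul, h1, h2]
  have h4 : L.reducedConnection (fderiv ℝ g x X) Y' (g x) = fderiv ℝ L.proj (Φ x)
      (B x (fderiv ℝ Y x X + Γ x X (Y x))) := by
    rw [LocalReduction.reducedConnection, hgΦ x hx]
    simp only [h.lift_fderiv L hg hgD hgΦ hx, hval.self_of_nhds, h3, h.fderiv_B x hx,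
      h.omega_B_B x hx]
    congr 1
    rw [map_add]
    module
  rw [h4, ← h.lift_fderiv L hg hgD hgΦ hx]
  exact (L.lift_spec hA _ hmem _).1

end IsDevelopment

/-- A development provides a local isomorphism onto a neighbourhood of the centre of any local
reduction: project along the flow of `A`. -/
theorem IsDevelopment.exists_local_iso (hA : InSp A) (h : IsDevelopment A V Γ w Φ B α)
    (hnd : ∀ x ∈ V, ∀ u, (∀ v, w x u v = 0) → u = 0) {c : EuclideanSpace ℝ (Fin (2 * n))}
    (hc : c ∈ V) (hΦ : Φ c = x₀) :
    ∃ φ : OpenPartialHomeomorph (EuclideanSpace ℝ (Fin (2 * n))) (EuclideanSpace ℝ (Fin (2 * n))),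
      c ∈ φ.source ∧ φ.source ⊆ V ∧ φ c = 0 ∧ φ.target ⊆ L.D ∧ ContDiffOn ℝ ∞ φ φ.source ∧
      ContDiffOn ℝ ∞ φ.symm φ.target ∧
      (∀ x ∈ φ.source, ∀ X Y, L.reducedForm (φ x) (fderiv ℝ φ x X) (fderiv ℝ φ x Y) = w x X Y) ∧
      ∀ x ∈ φ.source, ∀ X, ∀ Y Y', DifferentiableAt ℝ Y x →
        (∀ z ∈ φ.source, Y' (φ z) = fderiv ℝ φ z (Y z)) →
        L.reducedConnection (fderiv ℝ φ x X) Y' (φ x)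
          = fderiv ℝ φ x (fderiv ℝ Y x X + Γ x X (Y x)) := by
  set V' := V ∩ Φ ⁻¹' L.O with hV'
  have hV'o : IsOpen V' := h.smooth_Φ.continuousOn.isOpen_inter_preimage h.isOpen L.isOpen_O
  have hmem : ∀ x ∈ V', Φ x ∈ L.O ∩ constraintSurface A := fun x hx =>
    ⟨hx.2, mem_constraintSurface_iff.2 (h.omega_A x hx.1)⟩
  have hψ : ContDiffOn ℝ ∞ (fun x => L.psi (Φ x)) V' :=
    L.psi_smooth.comp (h.smooth_Φ.mono inter_subset_left) fun x hx => hx.2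
  set g : EuclideanSpace ℝ (Fin (2 * n)) → EuclideanSpace ℝ (Fin (2 * n)) :=
    fun x => (L.psi (Φ x)).1 with hgdef
  have hg : ContDiffOn ℝ ∞ g V' := hψ.fst
  have hgD : ∀ x ∈ V', g x ∈ L.D := fun x hx => (L.psi_mem (hmem x hx)).1.1
  have h' := h.gauge hA hV'o inter_subset_left (t := fun x => (L.psi (Φ x)).2) hψ.snd
  have hgΦ : ∀ x ∈ V', L.slice (g x) = NormedSpace.exp ((L.psi (Φ x)).2 • A) (Φ x) := by
    intro x hx
    have h1 := L.psi_mem (hmem x hx)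
    have h2 : NormedSpace.exp ((-(L.psi (Φ x)).2) • A) (L.slice (g x)) = Φ x := by
      rw [← L.chi_eq_exp h1.1]
      exact h1.2
    have h3 := exp_neg_apply A (L.psi (Φ x)).2 (L.slice (g x))
    rw [h2] at h3
    exact h3.symm
  have hnd' : ∀ x ∈ V', ∀ u, (∀ v, w x u v = 0) → u = 0 := fun x hx => hnd x hx.1
  have h0D : (0 : EuclideanSpace ℝ (Fin (2 * n))) ∈ L.D := mem_ball_self L.radius_pos
  have hx₀ : x₀ = L.slice 0 := L.chi_zero.symm
  have hcV' : c ∈ V' := ⟨hc, by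
    rw [mem_preimage, hΦ.trans hx₀]
    exact (L.chi_mem (L.slice_mem_dom h0D)).1⟩
  let e := (LinearEquiv.ofInjectiveEndo (fderiv ℝ g c :
    EuclideanSpace ℝ (Fin (2 * n)) →ₗ[ℝ] EuclideanSpace ℝ (Fin (2 * n)))
    (h'.fderiv_injective L hg hgD hgΦ hnd' hcV')).toContinuousLinearEquiv
  obtain ⟨φ, hφc, hφV, hφ, hφs⟩ := exists_local_diffeo hV'o hg hcV' (e := e) (by ext; rfl)
  refine ⟨φ, hφc, hφV.trans inter_subset_left, ?_, ?_, ?_, hφs, ?_, ?_⟩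
  · rw [hφ, hgdef]
    simp only [hΦ.trans hx₀, L.psi_slice h0D]
  · intro y hy
    rw [← φ.right_inv hy, hφ]
    exact hgD _ (hφV (φ.map_target hy))
  · rw [hφ]; exact hg.mono hφV
  · intro x hx X Y
    rw [hφ]
    exact h'.reducedForm_eq L hg hgD hgΦ (hφV hx) X Y
  · intro x hx X Y Y' hY hYY'
    have hY' : DifferentiableAt ℝ Y' (φ x) := by
      have hs := differentiableAt_of_smoothOn φ.open_target hφs (φ.map_source hx)
      have h1 : DifferentiableAt ℝ (fun y => fderiv ℝ g (φ.symm y) (Y (φ.symm y))) (φ x) := by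
        have e1 := differentiableAt_of_smoothOn hV'o (smoothOn_fderiv hV'o hg) (hφV hx)
        have e2 : φ.symm (φ x) = x := φ.left_inv hx
        refine DifferentiableAt.clm_apply ?_ ?_
        · exact DifferentiableAt.comp (g := fderiv ℝ g) _ (by rwa [e2]) hs
        · exact DifferentiableAt.comp (g := Y) _ (by rwa [e2]) hs
      refine h1.congr_of_eventuallyEq (Filter.eventually_of_mem
        (φ.open_target.mem_nhds (φ.map_source hx)) fun y hy => ?_)
      have := hYY' _ (φ.map_target hy)
      rwa [φ.right_inv hy, hφ] at this
    rw [hφ] at hY' hYY' ⊢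
    exact h'.reducedConnection_eq L hg hgD hgΦ hA (hφV hx) X hY hY'
      (Filter.eventually_of_mem (φ.open_source.mem_nhds hx) hYY')

end Transfer

/-! ### Vector fields in a chart -/

section Manifold

variable {n : ℕ} {M : Type*} [TopologicalSpace M]
  [ChartedSpace (EuclideanSpace ℝ (Fin (2 * n))) M] [IsManifold (𝓡 (2 * n)) ∞ M]

/-- The isomorphism `T_q M → ℝ^{2n}` given by the chart at `p`, for `q` in the domain of this
chart. For other `q` it is zero, as for its inverse `ofCoord p q`. -/
def toCoord (p q : M) : TangentSpace (𝓡 (2 * n)) q →L[ℝ] EuclideanSpace ℝ (Fin (2 * n)) :=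
  (trivializationAt (EuclideanSpace ℝ (Fin (2 * n)))
    (TangentSpace (𝓡 (2 * n)) : M → Type _) p).continuousLinearMapAt ℝ q

/-- The inverse isomorphism of `toCoord p q`. -/
def ofCoord (p q : M) : EuclideanSpace ℝ (Fin (2 * n)) →L[ℝ] TangentSpace (𝓡 (2 * n)) q :=
  (trivializationAt (EuclideanSpace ℝ (Fin (2 * n)))
    (TangentSpace (𝓡 (2 * n)) : M → Type _) p).symmL ℝ q

/-- The expression of a vector field in the chart at `p`. -/
def coordField (p : M) (Y : VField n M) (x : EuclideanSpace ℝ (Fin (2 * n))) :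
    EuclideanSpace ℝ (Fin (2 * n)) :=
  toCoord p ((chartAt (EuclideanSpace ℝ (Fin (2 * n))) p).symm x)
    (Y ((chartAt (EuclideanSpace ℝ (Fin (2 * n))) p).symm x))

local notation "𝓔" => EuclideanSpace ℝ (Fin (2 * n))

variable {p q : M}

lemma mem_baseSet_iff :
    q ∈ (trivializationAt 𝓔 (TangentSpace (𝓡 (2 * n)) : M → Type _) p).baseSet ↔
      q ∈ (chartAt 𝓔 p).source := by
  rw [TangentBundle.trivializationAt_baseSet]

lemma toCoord_ofCoord (hq : q ∈ (chartAt 𝓔 p).source) (v : 𝓔) :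
    toCoord p q (ofCoord p q v) = v :=
  Bundle.Trivialization.continuousLinearMapAt_symmL _ (mem_baseSet_iff.2 hq) v

lemma ofCoord_toCoord (hq : q ∈ (chartAt 𝓔 p).source) (v : TangentSpace (𝓡 (2 * n)) q) :
    ofCoord p q (toCoord p q v) = v :=
  Bundle.Trivialization.symmL_continuousLinearMapAt _ (mem_baseSet_iff.2 hq) v

lemma toCoord_eq (hq : q ∈ (chartAt 𝓔 p).source) (v : TangentSpace (𝓡 (2 * n)) q) :
    toCoord p q v =
      (trivializationAt 𝓔 (TangentSpace (𝓡 (2 * n)) : M → Type _) p ⟨q, v⟩).2 := by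
  rw [toCoord, Bundle.Trivialization.continuousLinearMapAt_apply,
    Bundle.Trivialization.coe_linearMapAt_of_mem _ (mem_baseSet_iff.2 hq)]

lemma mfderiv_chartAt (hq : q ∈ (chartAt 𝓔 p).source) :
    mfderiv (𝓡 (2 * n)) (𝓡 (2 * n)) (chartAt 𝓔 p) q = toCoord p q :=
  (TangentBundle.continuousLinearMapAt_trivializationAt hq).symm

omit [IsManifold (𝓡 (2 * n)) ∞ M] in
lemma eventually_mem_chart_source (hq : q ∈ (chartAt 𝓔 p).source) :
    ∀ᶠ y in 𝓝 q, y ∈ (chartAt 𝓔 p).source :=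
  (chartAt 𝓔 p).open_source.mem_nhds hq

lemma coordField_chart (hq : q ∈ (chartAt 𝓔 p).source) (Y : VField n M) :
    coordField p Y (chartAt 𝓔 p q) = toCoord p q (Y q) := by
  simp only [coordField]
  rw [(chartAt 𝓔 p).left_inv hq]

lemma mdifferentiableAt_iff_comp_chart_symm {F : Type*} [NormedAddCommGroup F] [NormedSpace ℝ F]
    (hq : q ∈ (chartAt 𝓔 p).source) (g : M → F) :
    MDifferentiableAt (𝓡 (2 * n)) 𝓘(ℝ, F) g q ↔
      DifferentiableAt ℝ (g ∘ (chartAt 𝓔 p).symm) (chartAt 𝓔 p q) := by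
  have h1 : MDifferentiableAt (𝓡 (2 * n)) (𝓡 (2 * n)) (chartAt 𝓔 p) q :=
    mdifferentiableAt_atlas (chart_mem_atlas 𝓔 p) hq
  have h2 : MDifferentiableAt (𝓡 (2 * n)) (𝓡 (2 * n)) (chartAt 𝓔 p).symm (chartAt 𝓔 p q) :=
    mdifferentiableAt_atlas_symm (chart_mem_atlas 𝓔 p) ((chartAt 𝓔 p).map_source hq)
  rw [← mdifferentiableAt_iff_differentiableAt]
  constructor
  · intro h
    refine MDifferentiableAt.comp _ ?_ h2
    rwa [(chartAt 𝓔 p).left_inv hq]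
  · intro h
    refine (MDifferentiableAt.comp q h h1).congr_of_eventuallyEq ?_
    filter_upwards [eventually_mem_chart_source hq] with y hy
    simp [(chartAt 𝓔 p).left_inv hy]

lemma contMDiffAt_iff_comp_chart_symm {F : Type*} [NormedAddCommGroup F] [NormedSpace ℝ F]
    (hq : q ∈ (chartAt 𝓔 p).source) (g : M → F) :
    ContMDiffAt (𝓡 (2 * n)) 𝓘(ℝ, F) ∞ g q ↔
      ContDiffAt ℝ ∞ (g ∘ (chartAt 𝓔 p).symm) (chartAt 𝓔 p q) := by
  have h1 : ContMDiffAt (𝓡 (2 * n)) (𝓡 (2 * n)) ∞ (chartAt 𝓔 p) q :=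
    (contMDiffOn_chart (x := p)).contMDiffAt (eventually_mem_chart_source hq)
  have h2 : ContMDiffAt (𝓡 (2 * n)) (𝓡 (2 * n)) ∞ (chartAt 𝓔 p).symm (chartAt 𝓔 p q) :=
    (contMDiffOn_chart_symm (x := p)).contMDiffAt
      ((chartAt 𝓔 p).open_target.mem_nhds ((chartAt 𝓔 p).map_source hq))
  rw [← contMDiffAt_iff_contDiffAt]
  constructor
  · intro h
    refine ContMDiffAt.comp _ ?_ h2
    rwa [(chartAt 𝓔 p).left_inv hq]
  · intro h
    refine (ContMDiffAt.comp q h h1).congr_of_eventuallyEq ?_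
    filter_upwards [eventually_mem_chart_source hq] with y hy
    simp [(chartAt 𝓔 p).left_inv hy]

lemma mvfderiv_eq_fderiv_comp_chart_symm {F : Type*} [NormedAddCommGroup F] [NormedSpace ℝ F]
    (hq : q ∈ (chartAt 𝓔 p).source) {g : M → F}
    (hg : MDifferentiableAt (𝓡 (2 * n)) 𝓘(ℝ, F) g q) (u : TangentSpace (𝓡 (2 * n)) q) :
    mvfderiv (𝓡 (2 * n)) g q u =
      fderiv ℝ (g ∘ (chartAt 𝓔 p).symm) (chartAt 𝓔 p q) (toCoord p q u) := by
  have h1 : MDifferentiableAt (𝓡 (2 * n)) (𝓡 (2 * n)) (chartAt 𝓔 p) q :=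
    mdifferentiableAt_atlas (chart_mem_atlas 𝓔 p) hq
  have h2 := (mdifferentiableAt_iff_comp_chart_symm hq g).1 hg
  have h3 : mfderiv (𝓡 (2 * n)) 𝓘(ℝ, F) g q =
      mfderiv (𝓡 (2 * n)) 𝓘(ℝ, F) ((g ∘ (chartAt 𝓔 p).symm) ∘ chartAt 𝓔 p) q := by
    refine Filter.EventuallyEq.mfderiv_eq ?_
    filter_upwards [eventually_mem_chart_source hq] with y hy
    simp [(chartAt 𝓔 p).left_inv hy]
  have h4 := mfderiv_comp q h2.mdifferentiableAt h1
  rw [mfderiv_chartAt hq, mfderiv_eq_fderiv] at h4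
  rw [mvfderiv]
  exact congrArg (fun T => T u) (h3.trans h4)

lemma VField.diffAt_iff (hq : q ∈ (chartAt 𝓔 p).source) (Y : VField n M) :
    Y.DiffAt q ↔ DifferentiableAt ℝ (coordField p Y) (chartAt 𝓔 p q) := by
  refine ((trivializationAt 𝓔 (TangentSpace (𝓡 (2 * n)) : M → Type _)
    p).mdifferentiableAt_section_iff (𝓡 (2 * n)) Y (mem_baseSet_iff.2 hq)).trans ?_
  rw [Filter.EventuallyEq.mdifferentiableAt_iff (f := fun y => toCoord p y (Y y)),
    mdifferentiableAt_iff_comp_chart_symm hq]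
  · rfl
  · filter_upwards [eventually_mem_chart_source hq] with y hy
    rw [toCoord_eq hy]

/-- A vector field is smooth at a point if and only if its expression in a chart is. -/
lemma contMDiffAt_vField_iff (hq : q ∈ (chartAt 𝓔 p).source) (Y : VField n M) :
    ContMDiffAt (𝓡 (2 * n)) (𝓡 (2 * n)).tangent ∞
      (fun x => (⟨x, Y x⟩ : TangentBundle (𝓡 (2 * n)) M)) q ↔
      ContDiffAt ℝ ∞ (coordField p Y) (chartAt 𝓔 p q) := by
  refine ((trivializationAt 𝓔 (TangentSpace (𝓡 (2 * n)) : M → Type _)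
    p).contMDiffAt_section_iff (n := ∞) (IB := 𝓡 (2 * n)) (mem_baseSet_iff.2 hq)).trans ?_
  rw [Filter.EventuallyEq.contMDiffAt_iff (f := fun y => toCoord p y (Y y)),
    contMDiffAt_iff_comp_chart_symm hq]
  · rfl
  · filter_upwards [eventually_mem_chart_source hq] with y hy
    rw [toCoord_eq hy]

/-- The vector field with constant components in the chart at `p`. -/
def constField (p : M) (v : 𝓔) : VField n M := fun y => ofCoord p y v

lemma coordField_constField (v x : 𝓔) (hx : x ∈ (chartAt 𝓔 p).target) :
    coordField p (constField p v) x = v :=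
  toCoord_ofCoord ((chartAt 𝓔 p).map_target hx) v

lemma constField_contMDiffAt (hq : q ∈ (chartAt 𝓔 p).source) (v : 𝓔) :
    ContMDiffAt (𝓡 (2 * n)) (𝓡 (2 * n)).tangent ∞
      (fun x => (⟨x, constField p v x⟩ : TangentBundle (𝓡 (2 * n)) M)) q := by
  rw [contMDiffAt_vField_iff hq]
  refine (contDiffAt_const (c := v)).congr_of_eventuallyEq ?_
  filter_upwards [(chartAt 𝓔 p).open_target.mem_nhds ((chartAt 𝓔 p).map_source hq)] with x hx
  exact coordField_constField v x hx

lemma constField_diffAt (hq : q ∈ (chartAt 𝓔 p).source) (v : 𝓔) :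
    (constField p v).DiffAt q :=
  (constField_contMDiffAt hq v).mdifferentiableAt (by simp)

/-- A vector field which is smooth near `q` agrees near `q` with a smooth vector field. -/
lemma exists_smooth_vField_eventuallyEq [T2Space M] {Y : VField n M} {u : Set M} (hu : u ∈ 𝓝 q)
    (hY : ∀ y ∈ u, ContMDiffAt (𝓡 (2 * n)) (𝓡 (2 * n)).tangent ∞
      (fun x => (⟨x, Y x⟩ : TangentBundle (𝓡 (2 * n)) M)) y) :
    ∃ Y' : VField n M, Y'.Smooth ∧ ∀ᶠ y in 𝓝 q, Y' y = Y y := by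
  obtain ⟨v, hvu, hv, hqv⟩ := mem_nhds_iff.1 hu
  obtain ⟨f, -, hf⟩ := (SmoothBumpFunction.nhds_basis_tsupport (I := 𝓡 (2 * n)) q).mem_iff.1
    (hv.mem_nhds hqv)
  refine ⟨(f : M → ℝ) • Y, ?_, ?_⟩
  · refine ContMDiffOn.smul_section_of_tsupport (u := v) ?_ hv hf ?_
    · exact f.contMDiff.contMDiffOn
    · exact fun y hy => (hY y (hvu hy)).contMDiffWithinAt
  · filter_upwards [f.eventuallyEq_one] with y hy
    simp [hy]

/-! ### Connection and symplectic form in a chart -/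

/-- The flat connection on the domain of the chart at `p`, which differentiates the components of
vector fields in this chart. -/
def flatCov (p : M) (Y : VField n M) (q : M) :
    TangentSpace (𝓡 (2 * n)) q →L[ℝ] TangentSpace (𝓡 (2 * n)) q :=
  (ofCoord p q).comp ((fderiv ℝ (coordField p Y) (chartAt 𝓔 p q)).comp (toCoord p q))

/-- The differentiation of components is a covariant derivative on the domain of the chart. Outside
it, `toCoord` and `ofCoord` take junk values. -/
lemma isCovariantDerivativeOn_flatCov (p : M) :
    IsCovariantDerivativeOn 𝓔 (flatCov (n := n) p) (chartAt 𝓔 p).source where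
  add {Y Y' q} hY hY' hq := by
    have h1 := (VField.diffAt_iff hq Y).1 hY
    have h2 := (VField.diffAt_iff hq Y').1 hY'
    have h3 : coordField p (Y + Y') = coordField p Y + coordField p Y' := by
      funext x
      exact map_add (toCoord p _) _ _
    refine ContinuousLinearMap.ext fun u => ?_
    change ofCoord p q (fderiv ℝ (coordField p (Y + Y')) (chartAt 𝓔 p q) (toCoord p q u)) =
      ofCoord p q (fderiv ℝ (coordField p Y) (chartAt 𝓔 p q) (toCoord p q u)) +
      ofCoord p q (fderiv ℝ (coordField p Y') (chartAt 𝓔 p q) (toCoord p q u))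
    rw [h3, fderiv_add h1 h2, ← map_add]
    rfl
  leibniz {Y g q} hY hg hq := by
    have h1 := (VField.diffAt_iff hq Y).1 hY
    have h2 := (mdifferentiableAt_iff_comp_chart_symm hq g).1 hg
    have h3 : coordField p (g • Y) =
        (g ∘ (chartAt 𝓔 p).symm) • coordField p Y := by
      funext x
      exact map_smul (toCoord p _) _ _
    refine ContinuousLinearMap.ext fun u => ?_
    change ofCoord p q (fderiv ℝ (coordField p (g • Y)) (chartAt 𝓔 p q) (toCoord p q u)) =
      g q • ofCoord p q (fderiv ℝ (coordField p Y) (chartAt 𝓔 p q) (toCoord p q u)) +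
      mvfderiv (𝓡 (2 * n)) g q u • Y q
    have h5 : fderiv ℝ ((g ∘ (chartAt 𝓔 p).symm) • coordField p Y) (chartAt 𝓔 p q)
        (toCoord p q u) = g q • fderiv ℝ (coordField p Y) (chartAt 𝓔 p q) (toCoord p q u) +
        mvfderiv (𝓡 (2 * n)) g q u • toCoord p q (Y q) := by
      rw [fderiv_smul h2 h1, mvfderiv_eq_fderiv_comp_chart_symm hq hg, ← coordField_chart hq Y]
      simp [(chartAt 𝓔 p).left_inv hq]
    rw [h3, h5, map_add, map_smul, map_smul, ofCoord_toCoord hq]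

/-- The Christoffel symbols `Γ_u v` of a connection in the chart at `p`: the
difference of the connection and of the flat connection of the chart. -/
def christoffel (nabla : LinearConnection n M) (p : M) (x : 𝓔) : 𝓔 →L[ℝ] 𝓔 →L[ℝ] 𝓔 :=
  let q := (chartAt 𝓔 p).symm x
  let D : 𝓔 →L[ℝ] 𝓔 →L[ℝ] 𝓔 := IsCovariantDerivativeOn.difference
    (nabla.isCovariantDerivativeOn (s := (chartAt 𝓔 p).source))
    (isCovariantDerivativeOn_flatCov p) q
  let T : 𝓔 →L[ℝ] 𝓔 := toCoord p q
  let S : 𝓔 →L[ℝ] 𝓔 := ofCoord p q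
  ((ContinuousLinearMap.compL ℝ 𝓔 𝓔 𝓔 T).comp (D.bilinearComp S S)).flip

/-- The connection in the chart at `p`: `∇_u Y = D_u Y + Γ_u Y`. -/
lemma toCoord_nabla (nabla : LinearConnection n M) (hq : q ∈ (chartAt 𝓔 p).source)
    {Y : VField n M} (hY : Y.DiffAt q) (u : TangentSpace (𝓡 (2 * n)) q) :
    toCoord p q (nabla Y q u) = fderiv ℝ (coordField p Y) (chartAt 𝓔 p q) (toCoord p q u) +
      christoffel nabla p (chartAt 𝓔 p q) (toCoord p q u) (toCoord p q (Y q)) := by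
  have h1 := IsCovariantDerivativeOn.difference_apply
    (nabla.isCovariantDerivativeOn (s := (chartAt 𝓔 p).source)) (isCovariantDerivativeOn_flatCov p)
    hq hY
  have h2 : christoffel nabla p (chartAt 𝓔 p q) (toCoord p q u) (toCoord p q (Y q)) =
      toCoord p q (IsCovariantDerivativeOn.difference
    (nabla.isCovariantDerivativeOn (s := (chartAt 𝓔 p).source)) (isCovariantDerivativeOn_flatCov p)
    q (ofCoord p q (toCoord p q (Y q))) (ofCoord p q (toCoord p q u))) := by
    have h3 : ∀ q', q' = q → ∀ a b : 𝓔, toCoord p q' (IsCovariantDerivativeOn.difference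
      (nabla.isCovariantDerivativeOn (s := (chartAt 𝓔 p).source))
      (isCovariantDerivativeOn_flatCov p) q' (ofCoord p q' a) (ofCoord p q' b)) =
      toCoord p q (IsCovariantDerivativeOn.difference
      (nabla.isCovariantDerivativeOn (s := (chartAt 𝓔 p).source))
      (isCovariantDerivativeOn_flatCov p) q (ofCoord p q a) (ofCoord p q b)) := by
      rintro q' rfl a b
      rfl
    exact h3 _ ((chartAt 𝓔 p).left_inv hq) _ _
  rw [h2, ofCoord_toCoord hq, ofCoord_toCoord hq, h1]
  have h4 : toCoord p q ((nabla Y q - flatCov p Y q) u) =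
      toCoord p q (nabla Y q u) - toCoord p q (flatCov p Y q u) := map_sub (toCoord p q) _ _
  have h5 : toCoord p q (flatCov p Y q u) =
      fderiv ℝ (coordField p Y) (chartAt 𝓔 p q) (toCoord p q u) := toCoord_ofCoord hq _
  rw [h4, h5]
  abel

lemma fderiv_coordField_constField (hq : q ∈ (chartAt 𝓔 p).source) (v : 𝓔) :
    fderiv ℝ (coordField p (constField p v)) (chartAt 𝓔 p q) = 0 := by
  have : coordField p (constField p v) =ᶠ[𝓝 (chartAt 𝓔 p q)] fun _ => v := by
    filter_upwards [(chartAt 𝓔 p).open_target.mem_nhds ((chartAt 𝓔 p).map_source hq)] with x hx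
    exact coordField_constField v x hx
  rw [this.fderiv_eq, fderiv_fun_const]
  rfl

/-- The tensorial definition of `christoffel` agrees with the classical one, as the components of
the covariant derivatives of coordinate vector fields. -/
lemma christoffel_eq (nabla : LinearConnection n M) (hq : q ∈ (chartAt 𝓔 p).source) (u v : 𝓔) :
    christoffel nabla p (chartAt 𝓔 p q) u v =
      toCoord p q (covDeriv nabla (constField p u) (constField p v) q) := by
  rw [covDeriv, toCoord_nabla nabla hq (constField_diffAt hq v), fderiv_coordField_constField hq]
  simp [constField, toCoord_ofCoord hq]

lemma eventually_constField_contMDiffAt (hq : q ∈ (chartAt 𝓔 p).source) (v : 𝓔) :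
    ∀ᶠ y in 𝓝 q, ContMDiffAt (𝓡 (2 * n)) (𝓡 (2 * n)).tangent ∞
      (fun x => (⟨x, constField p v x⟩ : TangentBundle (𝓡 (2 * n)) M)) y := by
  filter_upwards [eventually_mem_chart_source hq] with y hy
  exact constField_contMDiffAt hy v

section Smooth

variable [T2Space M]

/-- The smoothness of a connection, for vector fields which are only defined near a point. -/
lemma covDeriv_contMDiffAt {nabla : LinearConnection n M}
    (hn : nabla.ContMDiffCovariantDerivative ∞) {X Y : VField n M}
    (hX : ContMDiffAt (𝓡 (2 * n)) (𝓡 (2 * n)).tangent ∞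
      (fun x => (⟨x, X x⟩ : TangentBundle (𝓡 (2 * n)) M)) q)
    (hY : ∀ᶠ y in 𝓝 q, ContMDiffAt (𝓡 (2 * n)) (𝓡 (2 * n)).tangent ∞
      (fun x => (⟨x, Y x⟩ : TangentBundle (𝓡 (2 * n)) M)) y) :
    ContMDiffAt (𝓡 (2 * n)) (𝓡 (2 * n)).tangent ∞
      (fun x => (⟨x, covDeriv nabla X Y x⟩ : TangentBundle (𝓡 (2 * n)) M)) q := by
  obtain ⟨Y', hY', he⟩ := exists_smooth_vField_eventuallyEq hY (fun y hy => hy)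
  have h1 := (hn.contMDiff.contMDiff (σ := Y') hY'.contMDiffOn).contMDiffAt
    (Filter.univ_mem (f := 𝓝 q))
  refine (ContMDiffAt.clm_bundle_apply h1 hX).congr_of_eventuallyEq ?_
  filter_upwards [he.eventually_nhds, hY] with y hy hy'
  have h2 : nabla Y y = nabla Y' y :=
    nabla.isCovariantDerivativeOn.congr_of_eventuallyEq (hy'.mdifferentiableAt (by simp))
      ((hY' y).mdifferentiableAt (by simp)) Filter.univ_mem (hy.mono fun _ h => h.symm)
  simp only [covDeriv, h2]

lemma christoffel_smooth {nabla : LinearConnection n M}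
    (hn : nabla.ContMDiffCovariantDerivative ∞) (p : M) :
    ContDiffOn ℝ ∞ (christoffel nabla p) (chartAt 𝓔 p).target := by
  refine contDiffOn_clm₂ fun u v => ?_
  have hc : ∀ x ∈ (chartAt 𝓔 p).target, christoffel nabla p x u v =
      coordField p (covDeriv nabla (constField p u) (constField p v)) x := by
    intro x hx
    have := christoffel_eq nabla ((chartAt 𝓔 p).map_target hx) u v
    rwa [(chartAt 𝓔 p).right_inv hx] at this
  refine ContDiffOn.congr (fun x hx => ?_) hc
  have hq := (chartAt 𝓔 p).map_target hx
  have h := (contMDiffAt_vField_iff hq _).1 (covDeriv_contMDiffAt hn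
    (constField_contMDiffAt hq u) (eventually_constField_contMDiffAt hq v))
  rw [(chartAt 𝓔 p).right_inv hx] at h
  exact h.contDiffWithinAt

end Smooth

/-- Coordinate vector fields commute. -/
lemma bracket_constField (hq : q ∈ (chartAt 𝓔 p).source) (u v : 𝓔) :
    bracket (constField p u) (constField p v) q = 0 := by
  have hinv : ∀ y ∈ (chartAt 𝓔 p).source,
      (mfderiv (𝓡 (2 * n)) (𝓡 (2 * n)) (chartAt 𝓔 p) y).inverse = ofCoord p y := by
    intro y hy
    rw [mfderiv_chartAt hy]
    exact ContinuousLinearMap.inverse_eq (ContinuousLinearMap.ext fun a => toCoord_ofCoord hy a)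
      (ContinuousLinearMap.ext fun a => ofCoord_toCoord hy a)
  let K (w : 𝓔) (x : 𝓔) : TangentSpace (𝓡 (2 * n)) x := w
  have hpull : ∀ w : 𝓔, VectorField.mpullback (𝓡 (2 * n)) (𝓡 (2 * n)) (chartAt 𝓔 p)
      (K w) =ᶠ[𝓝 q] constField p w := by
    intro w
    filter_upwards [eventually_mem_chart_source hq] with y hy
    exact congrArg (fun T => T w) (hinv y hy)
  have hK : ∀ w x, MDifferentiableAt (𝓡 (2 * n)) (𝓡 (2 * n)).tangent
      (fun x => (⟨x, K w x⟩ : TangentBundle (𝓡 (2 * n)) 𝓔)) x := by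
    intro w x
    have := contMDiffAt_vectorSpace_iff_contDiffAt (𝕜 := ℝ) (n := 1) (V := fun _ : 𝓔 => w) (x := x)
    exact (this.2 contDiffAt_const).mdifferentiableAt (by simp)
  have hle : minSmoothness ℝ 2 ≤ ∞ := by
    rw [minSmoothness_of_isRCLikeNormedField]
    exact WithTop.coe_le_coe.2 (le_top : (2 : ℕ∞) ≤ ⊤)
  have : IsManifold (𝓡 (2 * n)) (minSmoothness ℝ 2) M := IsManifold.of_le hle
  have h1 := VectorField.mpullback_mlieBracket (n := ∞) (x₀ := q) (hK u _) (hK v _)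
    ((contMDiffOn_chart (x := p)).contMDiffAt (eventually_mem_chart_source hq)) hle
  rw [bracket, ← (hpull u).mlieBracket_vectorField_eq (hpull v), ← h1, VectorField.mpullback_apply]
  have h2 : VectorField.mlieBracket (𝓡 (2 * n)) (K u) (K v) (chartAt 𝓔 p q) = 0 := by
    rw [← VectorField.mlieBracketWithin_univ, VectorField.mlieBracketWithin_eq_lieBracketWithin,
      VectorField.lieBracketWithin_univ]
    simp only [VectorField.lieBracket, fderiv_fun_const]
    exact sub_self _
  rw [h2, map_zero]

lemma christoffel_symm {nabla : LinearConnection n M} (ht : nabla.torsion = 0)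
    (hq : q ∈ (chartAt 𝓔 p).source) (u v : 𝓔) :
    christoffel nabla p (chartAt 𝓔 p q) u v = christoffel nabla p (chartAt 𝓔 p q) v u := by
  have h := (CovariantDerivative.torsion_eq_zero_iff nabla).1 ht (constField_diffAt hq u)
    (constField_diffAt hq v)
  rw [christoffel_eq nabla hq, christoffel_eq nabla hq]
  have h2 := h.trans (bracket_constField hq u v)
  rw [covDeriv, covDeriv, sub_eq_zero.1 h2]

/-- The symplectic form in the chart at `p`. -/
def formInChart (om : SymplecticForm n M) (p : M) (x : 𝓔) : 𝓔 →L[ℝ] 𝓔 →L[ℝ] ℝ :=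
  let b : 𝓔 →L[ℝ] 𝓔 →L[ℝ] ℝ := om.toFun ((chartAt 𝓔 p).symm x)
  let S : 𝓔 →L[ℝ] 𝓔 := ofCoord p ((chartAt 𝓔 p).symm x)
  b.bilinearComp S S

lemma formInChart_apply (om : SymplecticForm n M) (hq : q ∈ (chartAt 𝓔 p).source) (u v : 𝓔) :
    formInChart om p (chartAt 𝓔 p q) u v = om.toFun q (ofCoord p q u) (ofCoord p q v) := by
  have h : ∀ q', q' = q → om.toFun q' (ofCoord p q' u) (ofCoord p q' v) =
      om.toFun q (ofCoord p q u) (ofCoord p q v) := by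
    rintro q' rfl
    rfl
  exact h _ ((chartAt 𝓔 p).left_inv hq)

lemma formInChart_toCoord (om : SymplecticForm n M) (hq : q ∈ (chartAt 𝓔 p).source)
    (u v : TangentSpace (𝓡 (2 * n)) q) :
    formInChart om p (chartAt 𝓔 p q) (toCoord p q u) (toCoord p q v) = om.toFun q u v := by
  rw [formInChart_apply om hq, ofCoord_toCoord hq, ofCoord_toCoord hq]

lemma SymplecticForm.contMDiffAt_apply (om : SymplecticForm n M) {X Y : VField n M}
    (hX : ContMDiffAt (𝓡 (2 * n)) (𝓡 (2 * n)).tangent ∞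
      (fun x => (⟨x, X x⟩ : TangentBundle (𝓡 (2 * n)) M)) q)
    (hY : ContMDiffAt (𝓡 (2 * n)) (𝓡 (2 * n)).tangent ∞
      (fun x => (⟨x, Y x⟩ : TangentBundle (𝓡 (2 * n)) M)) q) :
    ContMDiffAt (𝓡 (2 * n)) 𝓘(ℝ, ℝ) ∞ (fun x => om.toFun x (X x) (Y x)) q := by
  have h : ContMDiffAt (𝓡 (2 * n)) ((𝓡 (2 * n)).prod 𝓘(ℝ, ℝ)) ∞
      (fun x => Bundle.TotalSpace.mk' ℝ (E := Bundle.Trivial M ℝ) x (om.toFun x (X x) (Y x))) q :=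
    ContMDiffAt.clm_bundle_apply₂ (F₁ := 𝓔) (F₂ := 𝓔) (om.smooth q) hX hY
  rw [Bundle.contMDiffAt_totalSpace] at h
  exact h.2

lemma formInChart_smooth (om : SymplecticForm n M) (p : M) :
    ContDiffOn ℝ ∞ (formInChart om p) (chartAt 𝓔 p).target := by
  refine contDiffOn_clm₂ fun u v => fun x hx => ?_
  have hq := (chartAt 𝓔 p).map_target hx
  have h := (contMDiffAt_iff_comp_chart_symm hq _).1 (om.contMDiffAt_apply
    (constField_contMDiffAt hq u) (constField_contMDiffAt hq v))
  rw [(chartAt 𝓔 p).right_inv hx] at h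
  exact h.contDiffWithinAt

/-- The form is parallel, for vector fields which are only defined near a point. -/
lemma lieDeriv_form [T2Space M] {om : SymplecticForm n M} {nabla : LinearConnection n M}
    (h : IsSymplecticConnection om nabla) {X Y Z : VField n M}
    (hX : ∀ᶠ y in 𝓝 q, ContMDiffAt (𝓡 (2 * n)) (𝓡 (2 * n)).tangent ∞
      (fun x => (⟨x, X x⟩ : TangentBundle (𝓡 (2 * n)) M)) y)
    (hY : ∀ᶠ y in 𝓝 q, ContMDiffAt (𝓡 (2 * n)) (𝓡 (2 * n)).tangent ∞
      (fun x => (⟨x, Y x⟩ : TangentBundle (𝓡 (2 * n)) M)) y)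
    (hZ : ∀ᶠ y in 𝓝 q, ContMDiffAt (𝓡 (2 * n)) (𝓡 (2 * n)).tangent ∞
      (fun x => (⟨x, Z x⟩ : TangentBundle (𝓡 (2 * n)) M)) y) :
    lieDeriv X (fun y => om.toFun y (Y y) (Z y)) q =
      om.toFun q (covDeriv nabla X Y q) (Z q) + om.toFun q (Y q) (covDeriv nabla X Z q) := by
  obtain ⟨X', hX', hXe⟩ := exists_smooth_vField_eventuallyEq hX (fun y hy => hy)
  obtain ⟨Y', hY', hYe⟩ := exists_smooth_vField_eventuallyEq hY (fun y hy => hy)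
  obtain ⟨Z', hZ', hZe⟩ := exists_smooth_vField_eventuallyEq hZ (fun y hy => hy)
  have hp := h.parallel X' Y' Z' hX' hY' hZ' q
  have hnY : nabla Y' q = nabla Y q :=
    nabla.isCovariantDerivativeOn.congr_of_eventuallyEq ((hY' q).mdifferentiableAt (by simp))
      (hY.self_of_nhds.mdifferentiableAt (by simp)) Filter.univ_mem hYe
  have hnZ : nabla Z' q = nabla Z q :=
    nabla.isCovariantDerivativeOn.congr_of_eventuallyEq ((hZ' q).mdifferentiableAt (by simp))
      (hZ.self_of_nhds.mdifferentiableAt (by simp)) Filter.univ_mem hZe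
  have hd : lieDeriv X' (fun y => om.toFun y (Y' y) (Z' y)) q =
      lieDeriv X (fun y => om.toFun y (Y y) (Z y)) q := by
    have he : (fun y => om.toFun y (Y' y) (Z' y)) =ᶠ[𝓝 q] fun y => om.toFun y (Y y) (Z y) := by
      filter_upwards [hYe, hZe] with y h1 h2
      rw [h1, h2]
    rw [lieDeriv, lieDeriv, mvfderiv, mvfderiv, he.mfderiv_eq, hXe.self_of_nhds]
    rfl
  rw [hd] at hp
  simp only [covDeriv, hnY, hnZ, hXe.self_of_nhds, hYe.self_of_nhds, hZe.self_of_nhds] at hp ⊢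
  linarith

/-- The equation `∇ω = 0` in a chart, tested on coordinate vector fields. -/
lemma formInChart_parallel [T2Space M] {om : SymplecticForm n M} {nabla : LinearConnection n M}
    (h : IsSymplecticConnection om nabla) (hq : q ∈ (chartAt 𝓔 p).source) (u v z : 𝓔) :
    fderiv ℝ (formInChart om p) (chartAt 𝓔 p q) u v z =
      formInChart om p (chartAt 𝓔 p q) (christoffel nabla p (chartAt 𝓔 p q) u v) z +
      formInChart om p (chartAt 𝓔 p q) v (christoffel nabla p (chartAt 𝓔 p q) u z) := by
  have h1 := lieDeriv_form h (eventually_constField_contMDiffAt hq u)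
    (eventually_constField_contMDiffAt hq v) (eventually_constField_contMDiffAt hq z)
  have h2 := (om.contMDiffAt_apply (constField_contMDiffAt hq v)
    (constField_contMDiffAt hq z)).mdifferentiableAt (by simp)
  rw [lieDeriv, mvfderiv_eq_fderiv_comp_chart_symm hq h2] at h1
  have h3 : DifferentiableAt ℝ (formInChart om p) (chartAt 𝓔 p q) :=
    differentiableAt_of_smoothOn (chartAt 𝓔 p).open_target (formInChart_smooth om p)
      ((chartAt 𝓔 p).map_source hq)
  have h4 : HasFDerivAt (fun x => formInChart om p x v z) _ (chartAt 𝓔 p q) :=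
    (h3.hasFDerivAt.clm_apply (hasFDerivAt_const v _)).clm_apply (hasFDerivAt_const z _)
  have h5 : fderiv ℝ (fun x => formInChart om p x v z) (chartAt 𝓔 p q) u =
      fderiv ℝ (formInChart om p) (chartAt 𝓔 p q) u v z := by
    rw [h4.fderiv]
    simp
  have h6 : toCoord p q (constField p u q) = u := toCoord_ofCoord hq u
  rw [← h5, christoffel_eq nabla hq, christoffel_eq nabla hq]
  have h7 : ∀ a b, formInChart om p (chartAt 𝓔 p q) (toCoord p q a) b =
      om.toFun q a (ofCoord p q b) := fun a b => by
    rw [formInChart_apply om hq, ofCoord_toCoord hq]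
  have h8 : ∀ a b, formInChart om p (chartAt 𝓔 p q) a (toCoord p q b) =
      om.toFun q (ofCoord p q a) b := fun a b => by
    rw [formInChart_apply om hq, ofCoord_toCoord hq]
  rw [h6] at h1
  rw [h7, h8]
  exact h1

lemma isSymplecticChart_chartAt [T2Space M] {om : SymplecticForm n M}
    {nabla : LinearConnection n M} (h : IsSymplecticConnection om nabla) (p : M) :
    IsSymplecticChart (chartAt 𝓔 p).target (christoffel nabla p) (formInChart om p) where
  isOpen := (chartAt 𝓔 p).open_target
  smooth_Γ := christoffel_smooth h.smooth p
  smooth_w := formInChart_smooth om p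
  alternating x _ u := om.alternating _ _
  nondegenerate x hx u hu := by
    have hq := (chartAt 𝓔 p).map_target hx
    have h1 := om.nondegenerate _ (ofCoord p ((chartAt 𝓔 p).symm x) u) fun v => by
      have h2 : om.toFun _ (ofCoord p _ u) (ofCoord p ((chartAt 𝓔 p).symm x) (toCoord p _ v)) = 0 :=
        hu (toCoord p _ v)
      rwa [ofCoord_toCoord hq] at h2
    rw [← toCoord_ofCoord hq u, h1, map_zero]
  symm x hx u v := by
    have := christoffel_symm h.torsion_eq_zero ((chartAt 𝓔 p).map_target hx) u v
    rwa [(chartAt 𝓔 p).right_inv hx] at this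
  parallel x hx u v z := by
    have := formInChart_parallel h ((chartAt 𝓔 p).map_target hx) u v z
    rwa [(chartAt 𝓔 p).right_inv hx] at this

/-! ### Curvature in a chart -/

lemma coordField_covDeriv (nabla : LinearConnection n M) (hq : q ∈ (chartAt 𝓔 p).source)
    (Y : VField n M) {Z : VField n M} (hZ : Z.DiffAt q) :
    coordField p (covDeriv nabla Y Z) (chartAt 𝓔 p q) =
      chartCov (christoffel nabla p) (coordField p Y) (coordField p Z) (chartAt 𝓔 p q) := by
  rw [coordField_chart hq, covDeriv, toCoord_nabla nabla hq hZ, chartCov, coordField_chart hq,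
    coordField_chart hq]

lemma eventuallyEq_coordField_covDeriv (nabla : LinearConnection n M)
    (hq : q ∈ (chartAt 𝓔 p).source) (Y : VField n M) {Z : VField n M}
    (hZ : ∀ᶠ y in 𝓝 q, Z.DiffAt y) :
    coordField p (covDeriv nabla Y Z) =ᶠ[𝓝 (chartAt 𝓔 p q)]
      chartCov (christoffel nabla p) (coordField p Y) (coordField p Z) := by
  have h1 : Filter.Tendsto (chartAt 𝓔 p).symm (𝓝 (chartAt 𝓔 p q)) (𝓝 q) := by
    have := (chartAt 𝓔 p).continuousAt_symm ((chartAt 𝓔 p).map_source hq)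
    rwa [ContinuousAt, (chartAt 𝓔 p).left_inv hq] at this
  filter_upwards [(chartAt 𝓔 p).open_target.mem_nhds ((chartAt 𝓔 p).map_source hq),
    h1.eventually hZ] with x hx hx'
  have := coordField_covDeriv nabla ((chartAt 𝓔 p).map_target hx) Y hx'
  rwa [(chartAt 𝓔 p).right_inv hx] at this

/-- The components of the bracket of vector fields. The torsion of the given connection vanishes,
hence the bracket is `∇_X Y - ∇_Y X`, in which the Christoffel symbols cancel. -/
lemma toCoord_bracket {nabla : LinearConnection n M} (ht : nabla.torsion = 0)
    (hq : q ∈ (chartAt 𝓔 p).source) {X Y : VField n M} (hX : X.DiffAt q) (hY : Y.DiffAt q) :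
    toCoord p q (bracket X Y q) =
      fderiv ℝ (coordField p Y) (chartAt 𝓔 p q) (coordField p X (chartAt 𝓔 p q)) -
      fderiv ℝ (coordField p X) (chartAt 𝓔 p q) (coordField p Y (chartAt 𝓔 p q)) := by
  have h : nabla Y q (X q) - nabla X q (Y q) = bracket X Y q :=
    (CovariantDerivative.torsion_eq_zero_iff nabla).1 ht hX hY
  rw [← h, map_sub, toCoord_nabla nabla hq hX, toCoord_nabla nabla hq hY,
    christoffel_symm ht hq (toCoord p q (Y q)), coordField_chart hq, coordField_chart hq]
  abel

/-- The extension of a tangent vector in the definition of the curvature is the vector field with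
constant components in the chart at its base point. -/
lemma extend_eq_constField (u : TangentSpace (𝓡 (2 * n)) q) {y : M}
    (hy : y ∈ (chartAt 𝓔 q).source) :
    (FiberBundle.extend 𝓔 u : VField n M) y = constField q (toCoord q q u) y := by
  rw [toCoord_eq (mem_chart_source 𝓔 q), FiberBundle.extend, constField, ofCoord]
  exact (Bundle.Trivialization.symmL_apply (R := ℝ) _ (mem_baseSet_iff.2 hy) _).symm

lemma eventually_extend_contMDiffAt (u : TangentSpace (𝓡 (2 * n)) q) :
    ∀ᶠ y in 𝓝 q, ContMDiffAt (𝓡 (2 * n)) (𝓡 (2 * n)).tangent ∞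
      (fun x => (⟨x, (FiberBundle.extend 𝓔 u : VField n M) x⟩ :
        TangentBundle (𝓡 (2 * n)) M)) y := by
  filter_upwards [eventually_mem_chart_source (mem_chart_source 𝓔 q)] with y hy
  refine (constField_contMDiffAt hy (toCoord q q u)).congr_of_eventuallyEq ?_
  filter_upwards [eventually_mem_chart_source hy] with x hx
  rw [extend_eq_constField u hx]

/-- The curvature of the connection is the curvature of its Christoffel symbols. -/
lemma toCoord_curvature [T2Space M] {nabla : LinearConnection n M}
    (hn : nabla.ContMDiffCovariantDerivative ∞) (ht : nabla.torsion = 0)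
    (hq : q ∈ (chartAt 𝓔 p).source) (u v z : TangentSpace (𝓡 (2 * n)) q) :
    toCoord p q (curvature nabla q u v z) =
      chartCurv (christoffel nabla p) (chartAt 𝓔 p q) (toCoord p q u) (toCoord p q v)
        (toCoord p q z) := by
  have hs : ∀ u : TangentSpace (𝓡 (2 * n)) q,
      ContDiffAt ℝ ∞ (coordField p (FiberBundle.extend 𝓔 u : VField n M)) (chartAt 𝓔 p q) :=
    fun u => (contMDiffAt_vField_iff hq _).1 (eventually_extend_contMDiffAt u).self_of_nhds
  have hd : ∀ u : TangentSpace (𝓡 (2 * n)) q,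
      ∀ᶠ y in 𝓝 q, VField.DiffAt (FiberBundle.extend 𝓔 u) y := fun u => by
    filter_upwards [eventually_extend_contMDiffAt u] with y hy
    exact hy.mdifferentiableAt (by simp)
  have hc : ∀ u v : TangentSpace (𝓡 (2 * n)) q, (covDeriv nabla
      (FiberBundle.extend 𝓔 u : VField n M) (FiberBundle.extend 𝓔 v : VField n M)).DiffAt q :=
    fun u v => (covDeriv_contMDiffAt hn (eventually_extend_contMDiffAt u).self_of_nhds
      (eventually_extend_contMDiffAt v)).mdifferentiableAt (by simp)
  have hv : ∀ u : TangentSpace (𝓡 (2 * n)) q,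
      coordField p (FiberBundle.extend 𝓔 u : VField n M) (chartAt 𝓔 p q) = toCoord p q u :=
    fun u => by rw [coordField_chart hq, FiberBundle.extend_apply_self]
  have hΓ : DifferentiableAt ℝ (christoffel nabla p) (chartAt 𝓔 p q) :=
    differentiableAt_of_smoothOn (chartAt 𝓔 p).open_target (christoffel_smooth hn p)
      ((chartAt 𝓔 p).map_source hq)
  have key := chartCov_commutator hΓ (hs u) (hs v) (hs z)
  rw [hv, hv, hv] at key
  rw [← key]
  set X : VField n M := FiberBundle.extend 𝓔 u
  set Y : VField n M := FiberBundle.extend 𝓔 v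
  set Z : VField n M := FiberBundle.extend 𝓔 z
  have h1 : curvature nabla q u v z = covDeriv nabla X (covDeriv nabla Y Z) q -
    covDeriv nabla Y (covDeriv nabla X Z) q - covDeriv nabla (bracket X Y) Z q := rfl
  have h2 : ∀ X Y : VField n M, (covDeriv nabla Y Z).DiffAt q →
      toCoord p q (covDeriv nabla X (covDeriv nabla Y Z) q) = chartCov (christoffel nabla p)
      (coordField p X) (chartCov (christoffel nabla p) (coordField p Y) (coordField p Z))
      (chartAt 𝓔 p q) := by
    intro X Y hd'
    rw [← coordField_chart hq, coordField_covDeriv nabla hq X hd', chartCov, chartCov]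
    have he := eventuallyEq_coordField_covDeriv nabla hq Y (hd z)
    rw [he.fderiv_eq, he.eq_of_nhds]
  have h3 : toCoord p q (covDeriv nabla (bracket X Y) Z q) = chartCov (christoffel nabla p)
      (fun y => fderiv ℝ (coordField p Y) y (coordField p X y) -
        fderiv ℝ (coordField p X) y (coordField p Y y)) (coordField p Z) (chartAt 𝓔 p q) := by
    have h4 := toCoord_bracket ht hq (hd u).self_of_nhds (hd v).self_of_nhds
    rw [covDeriv, toCoord_nabla nabla hq (hd z).self_of_nhds, h4, ← coordField_chart hq]
    rfl
  rw [h1, map_sub, map_sub, h2 X Y (hc v z), h2 Y X (hc u z), h3]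

/-- The Ricci tensor of the connection is the Ricci tensor of its Christoffel symbols. -/
lemma ricci_eq [T2Space M] {nabla : LinearConnection n M}
    (hn : nabla.ContMDiffCovariantDerivative ∞) (ht : nabla.torsion = 0)
    (hq : q ∈ (chartAt 𝓔 p).source) (u v : TangentSpace (𝓡 (2 * n)) q) :
    ricci nabla q u v =
      chartRicci (christoffel nabla p) (chartAt 𝓔 p q) (toCoord p q u) (toCoord p q v) := by
  let T : 𝓔 ≃ₗ[ℝ] 𝓔 := LinearEquiv.ofLinearMap (toCoord p q : 𝓔 →L[ℝ] 𝓔).toLinearMap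
    (ofCoord p q : 𝓔 →L[ℝ] 𝓔).toLinearMap (LinearMap.ext fun a => toCoord_ofCoord hq a)
    (LinearMap.ext fun a => ofCoord_toCoord hq a)
  let R : 𝓔 →ₗ[ℝ] 𝓔 := T.symm.conj (chartCurvMap (christoffel nabla p) (chartAt 𝓔 p q)
    (toCoord p q u) (toCoord p q v) : 𝓔 →ₗ[ℝ] 𝓔)
  have hR : ∀ z : 𝓔, R z = curvature nabla q u z v := by
    intro z
    have h1 := toCoord_curvature hn ht hq u z v
    have h2 : R z = ofCoord p q (chartCurv (christoffel nabla p) (chartAt 𝓔 p q) (toCoord p q u)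
      (toCoord p q z) (toCoord p q v)) := rfl
    rw [h2, ← h1, ofCoord_toCoord hq]
  rw [chartRicci, ← LinearMap.trace_conj' _ T.symm, LinearMap.trace_eq_matrix_trace ℝ
    (EuclideanSpace.basisFun (Fin (2 * n)) ℝ).toBasis, Matrix.trace, ricci]
  refine Finset.sum_congr rfl fun i _ => ?_
  rw [Matrix.diag_apply, LinearMap.toMatrix_apply]
  exact congrArg ((EuclideanSpace.basisFun (Fin (2 * n)) ℝ).toBasis.coord i) (hR _).symm

lemma isRicciTypeChart_chartAt [T2Space M] {om : SymplecticForm n M}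
    {nabla : LinearConnection n M} (h : IsRicciTypeConnection om nabla) (p : M) :
    IsRicciTypeChart n (chartAt 𝓔 p).target (christoffel nabla p) (formInChart om p) := by
  intro x hx u v y z
  have hq := (chartAt 𝓔 p).map_target hx
  set q := (chartAt 𝓔 p).symm x
  have hxq : x = chartAt 𝓔 p q := ((chartAt 𝓔 p).right_inv hx).symm
  have h1 := h.weylPart_eq_zero q (ofCoord p q u) (ofCoord p q v) (ofCoord p q y) (ofCoord p q z)
  rw [weylPart, sub_eq_zero, symplecticCurvature, ricciPart] at h1
  simp only [ricci_eq h.smooth h.torsion_eq_zero hq, toCoord_ofCoord hq,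
    ← formInChart_apply om hq] at h1
  rw [← formInChart_toCoord om hq, toCoord_curvature h.smooth h.torsion_eq_zero hq] at h1
  simp only [toCoord_ofCoord hq] at h1
  rw [hxq]
  exact h1

/-! ### Local isomorphisms -/

lemma mfderiv_chart_trans {φ : OpenPartialHomeomorph 𝓔 𝓔} (hφ : ContDiffOn ℝ ∞ φ φ.source)
    (hq : q ∈ ((chartAt 𝓔 p).trans φ).source) :
    mfderiv (𝓡 (2 * n)) (𝓡 (2 * n)) ((chartAt 𝓔 p).trans φ) q =
      (fderiv ℝ φ (chartAt 𝓔 p q)).comp (toCoord p q) := by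
  rw [OpenPartialHomeomorph.trans_source] at hq
  have h1 : DifferentiableAt ℝ φ (chartAt 𝓔 p q) :=
    differentiableAt_of_smoothOn φ.open_source hφ hq.2
  have h2 : MDifferentiableAt (𝓡 (2 * n)) (𝓡 (2 * n)) (chartAt 𝓔 p) q :=
    mdifferentiableAt_atlas (chart_mem_atlas 𝓔 p) hq.1
  have h3 := mfderiv_comp q h1.mdifferentiableAt h2
  rw [mfderiv_chartAt hq.1, mfderiv_eq_fderiv] at h3
  exact h3

/-- A local isomorphism in the chart at `p` is a local isomorphism of the manifold. -/
lemma isLocalIso_chart_trans {om : SymplecticForm n M} {nabla : LinearConnection n M}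
    {A : BigSpace n →L[ℝ] BigSpace n} {x₀ : BigSpace n} (L : LocalReduction A x₀)
    {φ : OpenPartialHomeomorph 𝓔 𝓔} (hp : chartAt 𝓔 p p ∈ φ.source)
    (hφ0 : φ (chartAt 𝓔 p p) = 0) (ht : φ.target ⊆ L.D)
    (hφ : ContDiffOn ℝ ∞ φ φ.source) (hφs : ContDiffOn ℝ ∞ φ.symm φ.target)
    (hw : ∀ x ∈ φ.source, ∀ X Y, L.reducedForm (φ x) (fderiv ℝ φ x X) (fderiv ℝ φ x Y) =
      formInChart om p x X Y)
    (hΓ : ∀ x ∈ φ.source, ∀ X, ∀ Y Y' : 𝓔 → 𝓔, DifferentiableAt ℝ Y x →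
      (∀ z ∈ φ.source, Y' (φ z) = fderiv ℝ φ z (Y z)) →
      L.reducedConnection (fderiv ℝ φ x X) Y' (φ x) =
        fderiv ℝ φ x (fderiv ℝ Y x X + christoffel nabla p x X (Y x)))
    (hs : φ.source ⊆ (chartAt 𝓔 p).target) :
    IsLocalIso om nabla p L ((chartAt 𝓔 p).trans φ) where
  mem_source := by
    rw [OpenPartialHomeomorph.trans_source]
    exact ⟨mem_chart_source 𝓔 p, hp⟩
  map_base := hφ0
  target_subset := fun y hy => by
    rw [OpenPartialHomeomorph.trans_target] at hy
    exact ht hy.1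
  smooth := by
    rw [OpenPartialHomeomorph.trans_source]
    exact hφ.contMDiffOn.comp ((contMDiffOn_chart (x := p)).mono Set.inter_subset_left)
      fun q hq => hq.2
  smooth_symm := by
    rw [OpenPartialHomeomorph.trans_target]
    exact (contMDiffOn_chart_symm (x := p)).comp (hφs.contMDiffOn.mono Set.inter_subset_left)
      fun q hq => hq.2
  symplectic q hq u v := by
    rw [mfderiv_chart_trans hφ hq]
    rw [OpenPartialHomeomorph.trans_source] at hq
    rw [← formInChart_toCoord om hq.1]
    exact hw _ hq.2 _ _
  affine q hq X Y hY := by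
    have hd : ∀ (Z : VField n M), ∀ q ∈ ((chartAt 𝓔 p).trans φ).source,
        pushforward ((chartAt 𝓔 p).trans φ) Z (((chartAt 𝓔 p).trans φ) q) =
          fderiv ℝ φ (chartAt 𝓔 p q) (toCoord p q (Z q)) := by
      intro Z q hq
      rw [pushforward, ((chartAt 𝓔 p).trans φ).left_inv hq, mfderiv_chart_trans hφ hq]
      rfl
    rw [hd X q hq, mfderiv_chart_trans hφ hq]
    have hq' := hq
    rw [OpenPartialHomeomorph.trans_source] at hq'
    have h1 := hΓ _ hq'.2 (toCoord p q (X q)) (coordField p Y)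
      (pushforward ((chartAt 𝓔 p).trans φ) Y) ((VField.diffAt_iff hq'.1 Y).1 hY) fun z hz => by
        have hz' : (chartAt 𝓔 p).symm z ∈ ((chartAt 𝓔 p).trans φ).source := by
          rw [OpenPartialHomeomorph.trans_source]
          refine ⟨(chartAt 𝓔 p).map_target (hs hz), ?_⟩
          rwa [Set.mem_preimage, (chartAt 𝓔 p).right_inv (hs hz)]
        have h2 := hd Y _ hz'
        rw [← coordField_chart ((chartAt 𝓔 p).map_target (hs hz)), OpenPartialHomeomorph.coe_trans,
          Function.comp_apply, (chartAt 𝓔 p).right_inv (hs hz)] at h2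
        exact h2
    refine Eq.trans ?_ h1.symm
    rw [coordField_chart hq'.1, ← toCoord_nabla nabla hq'.1 hY]
    rfl

end Manifold

end RicciType

end

open RicciType in
theorem theorem4p6 (n : ℕ) (hn : 2 ≤ n) (M : Type*) [TopologicalSpace M] [T2Space M]
    [ChartedSpace (EuclideanSpace ℝ (Fin (2 * n))) M] [IsManifold (𝓡 (2 * n)) ∞ M]
    (om : SymplecticForm n M) (nabla : LinearConnection n M)
    (h : IsRicciTypeConnection om nabla) (p : M) :
    ∃ A : BigSpace n →L[ℝ] BigSpace n, InSp A ∧ e0 n ∈ constraintSurface A ∧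
      Nonempty (LocalReduction A (e0 n)) ∧
      ∀ L : LocalReduction A (e0 n),
        ∃ φ : OpenPartialHomeomorph M (EuclideanSpace ℝ (Fin (2 * n))),
          IsLocalIso om nabla p L φ := by
  have hdim : Module.finrank ℝ (EuclideanSpace ℝ (Fin (2 * n))) = 2 * n := by simp
  have hs := isSymplecticChart_chartAt h.toIsSymplecticConnection p
  obtain ⟨S, U, f, hd⟩ := exists_ricciTypeData (by rw [hdim]; omega) hs
    (isRicciTypeChart_chartAt h p)
  obtain ⟨V', hpV, A, hA, Φ, B, α, hdev, hV, hΦ⟩ := hd.exists_development hdim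
    (mem_chart_target (EuclideanSpace ℝ (Fin (2 * n))) p)
  have h0 : e0 n ∈ constraintSurface A := by
    rw [mem_constraintSurface_iff, ← hΦ]
    exact hdev.omega_A _ hpV
  refine ⟨A, hA, h0, nonempty_localReduction hA h0, fun L => ?_⟩
  obtain ⟨φ, hp, hφV, hφ0, ht, hφ, hφs, hw, hΓ⟩ := IsDevelopment.exists_local_iso L hA hdev
    (fun x hx => hs.nondegenerate x (hV hx)) hpV hΦ
  exact ⟨_, isLocalIso_chart_trans L hp hφ0 ht hφ hφs hw hΓ (hφV.trans hV)⟩
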